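/- All graphs are labelled and simple; a graph or multigraph is series-parallel (SP) if it has no $K_4$ minor, and its excess is its number of edges minus its number of vertices. For an integer $k$ let $\overline{C}_k(x)=\sum_{n\ge 0} c_{n}\frac{x^n}{n!}$ be the exponential generating function in which $c_n$ is the number of pairs $(G,T)$ with $G$ a connected SP graph on $n$ labelled vertices of excess $k$ and $T$ a spanning tree of $G$; $[x^n]\overline{C}_k(x)=c_n/n!$ denotes its $n$-th coefficient. A multigraph may have loops (each contributing $2$ to the degree of its vertex) and multiple edges. The weight of a cubic multigraph $M$ with $l_1$ loops, $l_2$ double edges and $l_3$ triple edges is $w(M)=2^{-l_1-l_2}6^{-l_3}$. A cubic multigraph of excess $k$ has $2k$ vertices. Let $$\overline{g}_k=\frac{1}{(2k)!}\sum_{M} w(M)\,\tau(M),$$ where $M$ ranges over the SP cubic multigraphs of excess $k$ on the vertex set $\{1,\dots,2k\}$ and $\tau(M)$ is the number of spanning trees of $M$, the copies of a multiple edge being regarded as distinct (so $\overline{g}_k$ is the weighted number of cubic SP multigraphs of excess $k$ with a distinguished spanning tree). Proposition. For every fixed integer $k>1$, as $n\to\infty$, $$[x^n]\,\overline{C}_k(x)=\overline{g}_k\,\frac{1}{2^{2k+1/2}}\,\frac{n^{2k-1/2}}{\Gamma(2k+1/2)}\,e^n\,(1+o(1)).$$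 -/

import Mathlib

open Filter Asymptotics
open scoped Topology Nat

noncomputable section

namespace SPGraphs

/-- `H` is a minor of the simple graph `G`: there are pairwise disjoint branch sets in `G`, one for
each vertex of `H`, each inducing a connected (in particular nonempty) subgraph of `G`, such that
adjacent vertices of `H` have branch sets joined by an edge of `G`. -/
def IsMinor {W V : Type*} (H : SimpleGraph W) (G : SimpleGraph V) : Prop :=
  ∃ B : W → Set V,
    (∀ w, (G.induce (B w)).Connected) ∧
    (∀ w w', w ≠ w' → Disjoint (B w) (B w')) ∧
    (∀ w w', H.Adj w w' → ∃ x ∈ B w, ∃ y ∈ B w', G.Adj x y)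

/-- A simple graph is series-parallel if it has no `K₄` minor. -/
def IsSeriesParallel {V : Type*} (G : SimpleGraph V) : Prop :=
  ¬ IsMinor (SimpleGraph.completeGraph (Fin 4)) G

/-- The number of pairs `(G, T)` where `G` is a connected series-parallel simple graph with vertex
set `{0, …, n-1}` and excess `k` (that is, with `n + k` edges), and `T` is a spanning tree of `G`. -/
def numSPWithTree (k n : ℕ) : ℕ :=
  Nat.card {p : SimpleGraph (Fin n) × SimpleGraph (Fin n) //
    p.1.Connected ∧ IsSeriesParallel p.1 ∧ (p.1.edgeSet.ncard : ℤ) - (n : ℤ) = (k : ℤ) ∧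
    p.2 ≤ p.1 ∧ p.2.IsTree}

/-- The exponential generating function (in the number of vertices) of connected series-parallel
graphs of excess `k` with a distinguished spanning tree. -/
def CBar (k : ℕ) : PowerSeries ℝ :=
  PowerSeries.mk fun n => (numSPWithTree k n : ℝ) / (n ! : ℝ)

/-- A (vertex-labelled) multigraph on `V`, loops allowed, given by the multiplicity of each
unordered pair of vertices; `mult s(v, v)` is the number of loops at `v`. -/
@[ext]
structure Multigraph (V : Type*) where
  mult : Sym2 V → ℕ

namespace Multigraph

variable {V : Type*} (M : Multigraph V)

/-- The edges of `M`, where the copies of a multiple edge are distinguished. -/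
def Edge : Type _ := Σ e : Sym2 V, Fin (M.mult e)

/-- The simple graph obtained by deleting loops and merging parallel edges. -/
def toSimple : SimpleGraph V :=
  SimpleGraph.fromEdgeSet {e | 0 < M.mult e}

/-- A multigraph is series-parallel if it has no `K₄` minor. Loops and repeated edges are
irrelevant for having a `K₄` minor. -/
def IsSP : Prop := IsSeriesParallel M.toSimple

/-- A set `T` of edges of `M` is a spanning tree if it has no loops and no two parallel edges, and
the simple graph on `V` that its edges form is a tree. -/
def IsSpanningTree (T : Set M.Edge) : Prop :=
  (∀ a ∈ T, ¬ a.1.IsDiag) ∧ Set.InjOn (fun a : M.Edge => a.1) T ∧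
    (SimpleGraph.fromEdgeSet ((fun a : M.Edge => a.1) '' T)).IsTree

/-- The number of spanning trees of `M`; copies of a multiple edge are distinguished. -/
def numSpanningTrees : ℕ := Nat.card {T : Set M.Edge // M.IsSpanningTree T}

variable [Fintype V] [DecidableEq V]

/-- The degree of a vertex; a loop contributes two to the degree of its vertex. -/
def degree (v : V) : ℕ := ∑ e : Sym2 V, M.mult e * e.toMultiset.count v

/-- All degrees are equal to three. -/
def IsCubic : Prop := ∀ v, M.degree v = 3

/-- The number of edges, with multiplicity. -/
def numEdges : ℕ := ∑ e : Sym2 V, M.mult e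

/-- The number of edges minus the number of vertices. -/
def excess : ℤ := (M.numEdges : ℤ) - (Fintype.card V : ℤ)

/-- The number of loops. -/
def numLoops : ℕ := ∑ v : V, M.mult s(v, v)

/-- The number of pairs of distinct vertices joined by exactly `j` parallel edges. -/
def numMultiple (j : ℕ) : ℕ :=
  (Finset.univ.filter fun e : Sym2 V => ¬ e.IsDiag ∧ M.mult e = j).card

/-- The weight `2 ^ (-l₁ - l₂) * 6 ^ (-l₃)` (compensation factor) of a cubic multigraph with
`l₁` loops, `l₂` double edges and `l₃` triple edges. -/
def weight : ℝ :=
  ((2 : ℝ) ^ (M.numLoops + M.numMultiple 2) * (6 : ℝ) ^ M.numMultiple 3)⁻¹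

theorem IsCubic.mult_le {M : Multigraph V} (h : M.IsCubic) (e : Sym2 V) : M.mult e ≤ 3 := by
  induction e using Sym2.ind with
  | _ a b =>
    have h1 := h a
    unfold degree at h1
    have h2 := Finset.single_le_sum
      (f := fun e : Sym2 V => M.mult e * e.toMultiset.count a) (fun _ _ => Nat.zero_le _)
      (Finset.mem_univ s(a, b))
    have h3 : 1 ≤ (Sym2.toMultiset s(a, b)).count a := by
      rw [Multiset.one_le_count_iff_mem, Sym2.mem_toMultiset]
      exact Sym2.mem_mk_left a b
    nlinarith

/-- There are finitely many cubic multigraphs on a given finite vertex set. -/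
theorem finite_setOf_isCubic : {M : Multigraph V | M.IsCubic}.Finite := by
  have : Finite {M : Multigraph V // M.IsCubic} :=
    Finite.of_injective
      (fun (M : {M : Multigraph V // M.IsCubic}) (e : Sym2 V) =>
        (⟨M.1.mult e, Nat.lt_succ_of_le (M.2.mult_le e)⟩ : Fin 4))
      (fun M N h => by
        apply Subtype.ext
        apply Multigraph.ext
        funext e
        have := congrFun h e
        simpa using this)
  exact Set.finite_coe_iff.mp this

/-- A cubic multigraph of excess `k` has `2k` vertices. -/
theorem IsCubic.card_eq {M : Multigraph V} (h : M.IsCubic) {k : ℕ} (hk : M.excess = k) :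
    Fintype.card V = 2 * k := by
  have h1 : ∑ v, M.degree v = 2 * M.numEdges := by
    unfold degree numEdges
    rw [Finset.sum_comm, Finset.mul_sum]
    refine Finset.sum_congr rfl fun e _ => ?_
    rw [← Finset.mul_sum, Multiset.sum_count_eq_card (fun _ _ => Finset.mem_univ _),
      Sym2.card_toMultiset, mul_comm]
  have h2 : ∑ v, M.degree v = Fintype.card V * 3 := by
    rw [Finset.sum_congr rfl fun v _ => h v]
    simp
  unfold excess at hk
  omega

end Multigraph

/-- The weighted number of cubic series-parallel multigraphs of excess `k` with a distinguished
spanning tree, the vertices (of which there are necessarily `2k`) being labelled and counted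
exponentially: each pair of such a multigraph on `{0, …, 2k-1}` and a spanning tree of it
contributes the weight of the multigraph divided by `(2k)!`. The sum has finite support. -/
def gBar (k : ℕ) : ℝ :=
  (∑ᶠ M ∈ {M : Multigraph (Fin (2 * k)) | M.IsCubic ∧ M.IsSP ∧ M.excess = (k : ℤ)},
    M.weight * (M.numSpanningTrees : ℝ)) / ((2 * k)! : ℝ)

end SPGraphs

end

/-! A connected graph of excess k with a spanning tree T is T plus k + 1 further edges. Numbering
and orienting these edges contributes exactly (k+1)! 2^(k+1) (`numSPWithTree_eq`) and turns the pair
into a tree with 2k + 2 marks. Rooting the tree at the first mark encodes it as a parent function f,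
with no choice of root left over.

The marks together with the points where the paths between them branch form the meet closure. Each
mark other than the root adds at most two points to it, so its size w is at most 4k + 2
(`card_meetClosure_le`). The tree then consists of a reduced tree on these w points, whose w - 1
edges are subdivided into paths, and of trees hanging from the resulting skeleton. If the skeleton
has s points, the hanging trees can be chosen in s n^(n-s-1) ways (`card_isForest`), and the extra
points are distributed over the edges in a number of ways of order s^(w-2) (`card_isRefinement`).
Summing over s gives n^(n-1) times a moment of order w - 1 of the weights p_s =
n(n-1)...(n-s+1)/n^s. The moment of order 2i+1 is asymptotic to 2^i i! n^(i+1), and the one of order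
2i is of smaller order (`tendsto_moment`), so only w = 4k + 2 matters.

For w = 4k + 2 the marks are distinct leaves of the reduced tree, the root included, and each of the
other 2k points has exactly two children (`children_of_card_meetClosure`). Deleting the leaves and
joining the points that carried paired marks gives a cubic multigraph on 2k vertices with a spanning
tree. Only vertices of degree at most two are suppressed on the way, which neither creates nor
destroys a K₄ minor (`Suppresses.isSeriesParallel_iff`). A multigraph M with a given simple spanning
tree arises from (k+1)! 2^(k+1) w(M) times the product of the multiplicities along the tree
(`card_gluedMultigraph_eq`), so the kernels are counted by `gBar k` (`gBar_eq`).

Altogether the number of pairs is asymptotic to `gBar k` 2^(2k) (2k)!/(4k)! n^(n+2k). Stirling's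
formula and the value of Γ at half-integers give the stated form; `gBar_pos` makes this a genuine
equivalence. -/

namespace SPGraphs

/-! ### Invariance of series-parallelness under suppression of vertices of degree at most two -/

theorem connected_of_cover {V W : Type*} {H : SimpleGraph V} {G : SimpleGraph W} (p : V → W)
    (hadj : ∀ x y, H.Adj x y → G.Reachable (p x) (p y))
    (hcover : ∀ y, ∃ x, G.Reachable (p x) y) (hH : H.Connected) : G.Connected := by
  have key : ∀ x y, H.Reachable x y → G.Reachable (p x) (p y) := by
    rintro x y ⟨w⟩
    induction w with
    | nil => exact SimpleGraph.Reachable.refl _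
    | cons h _ ih => exact (hadj _ _ h).trans ih
  obtain ⟨x0⟩ := hH.nonempty
  have : Nonempty W := ⟨p x0⟩
  refine SimpleGraph.Connected.mk fun y y' => ?_
  obtain ⟨x, hx⟩ := hcover y
  obtain ⟨x', hx'⟩ := hcover y'
  exact hx.symm.trans ((key x x' (hH.preconnected x x')).trans hx')

theorem exists_adj_of_induce_connected {V : Type*} {G : SimpleGraph V} {B : Set V}
    (hB : (G.induce B).Connected) {x y : V} (hx : x ∈ B) (hy : y ∈ B) (hxy : x ≠ y) :
    ∃ c ∈ B, G.Adj x c := by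
  obtain ⟨w⟩ := hB.preconnected ⟨x, hx⟩ ⟨y, hy⟩
  cases w with
  | nil => exact absurd rfl hxy
  | cons h _ => exact ⟨_, Subtype.coe_prop _, h⟩

theorem exists_three_others : ∀ w : Fin 4, ∃ w1 w2 w3 : Fin 4,
    w ≠ w1 ∧ w ≠ w2 ∧ w ≠ w3 ∧ w1 ≠ w2 ∧ w1 ≠ w3 ∧ w2 ≠ w3 := by
  decide

/-- Branch sets of a `K₄` minor contain no isolated vertices. -/
theorem exists_adj_of_mem_branch {V : Type*} {G : SimpleGraph V} {B : Fin 4 → Set V}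
    (hc : ∀ w, (G.induce (B w)).Connected)
    (ha : ∀ w w', (SimpleGraph.completeGraph (Fin 4)).Adj w w' → ∃ x ∈ B w, ∃ y ∈ B w', G.Adj x y)
    {w : Fin 4} {x : V} (hx : x ∈ B w) : ∃ y, G.Adj x y := by
  by_cases h : ∃ y ∈ B w, x ≠ y
  · obtain ⟨y, hy, hxy⟩ := h
    obtain ⟨c, -, h⟩ := exists_adj_of_induce_connected (hc w) hx hy hxy
    exact ⟨c, h⟩
  · push Not at h
    obtain ⟨w', hw'⟩ : ∃ w' : Fin 4, w ≠ w' := by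
      obtain ⟨w', -, -, h, -⟩ := exists_three_others w
      exact ⟨w', h⟩
    obtain ⟨y, hy, z, -, hyz⟩ := ha w w' hw'
    rw [← h y hy] at hyz
    exact ⟨z, hyz⟩

/-- The images of the branch sets under p serve as new branch sets. As p does not leave a branch
set, they stay disjoint, and for the same reason an edge between two different branch sets cannot
collapse. -/
theorem IsMinor.of_map {V W : Type*} {H : SimpleGraph W} {G G' : SimpleGraph V} {B : W → Set V}
    (hc : ∀ w, (G.induce (B w)).Connected)
    (hd : ∀ w w', w ≠ w' → Disjoint (B w) (B w'))
    (ha : ∀ w w', H.Adj w w' → ∃ x ∈ B w, ∃ y ∈ B w', G.Adj x y)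
    (p : V → V) (hp : ∀ w, ∀ x ∈ B w, p x ∈ B w)
    (hadj : ∀ w w', ∀ x ∈ B w, ∀ y ∈ B w', G.Adj x y → p x = p y ∨ G'.Adj (p x) (p y)) :
    IsMinor H G' := by
  refine ⟨fun w => p '' B w, fun w => ?_, fun w w' h => ?_, fun w w' h => ?_⟩
  · refine connected_of_cover (H := G.induce (B w))
      (fun x => (⟨p x, Set.mem_image_of_mem p x.2⟩ : p '' B w)) ?_ ?_ (hc w)
    · rintro ⟨x, hx⟩ ⟨y, hy⟩ hxy
      rcases hadj w w x hx y hy hxy with h | h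
      · simp only [h]; exact SimpleGraph.Reachable.refl _
      · exact SimpleGraph.Adj.reachable h
    · rintro ⟨_, x, hx, rfl⟩
      exact ⟨⟨x, hx⟩, SimpleGraph.Reachable.refl _⟩
  · refine (hd w w' h).mono ?_ ?_
    · rintro _ ⟨x, hx, rfl⟩; exact hp w x hx
    · rintro _ ⟨x, hx, rfl⟩; exact hp w' x hx
  · obtain ⟨x, hx, y, hy, hxy⟩ := ha w w' h
    refine ⟨p x, ⟨x, hx, rfl⟩, p y, ⟨y, hy, rfl⟩, ?_⟩
    rcases hadj w w' x hx y hy hxy with h' | h'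
    · by_cases hw : w = w'
      · subst hw; exact absurd h (H.loopless.irrefl _)
      · exact absurd h' fun h' =>
          Set.disjoint_left.1 (hd w w' hw) (hp w x hx) (h' ▸ hp w' y hy)
    · exact h'

theorem IsMinor.mono {V W : Type*} {H : SimpleGraph W} {G G' : SimpleGraph V} (h : G ≤ G')
    (hG : IsMinor H G) : IsMinor H G' := by
  obtain ⟨B, hc, hd, ha⟩ := hG
  exact IsMinor.of_map hc hd ha id (fun _ _ h => h) (fun _ _ _ _ _ _ hxy => Or.inr (h hxy))

/-- `H` is obtained from `G` by isolating a vertex `z` of degree at most two and joining its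
neighbours. -/
structure Suppresses {V : Type*} (G H : SimpleGraph V) (z a b : V) : Prop where
  nbr : ∀ x, G.Adj z x → x = a ∨ x = b
  adj : ∀ x y, H.Adj x y ↔ x ≠ z ∧ y ≠ z ∧ x ≠ y ∧ (G.Adj x y ∨ (G.Adj z x ∧ G.Adj z y))

/-- If z lies in a branch set, then z has a neighbour c in it: otherwise the branch set is {z}, and
z would need neighbours in three disjoint branch sets while having at most two. Sending z to c then
works, since H joins c to the other neighbour of z. -/
theorem Suppresses.isMinor_of {V : Type*} {G H : SimpleGraph V} {z a b : V}
    (h : Suppresses G H z a b) (hG : IsMinor (SimpleGraph.completeGraph (Fin 4)) G) :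
    IsMinor (SimpleGraph.completeGraph (Fin 4)) H := by
  classical
  obtain ⟨B, hc, hd, ha⟩ := hG
  by_cases hz : ∃ w, z ∈ B w
  · obtain ⟨w, hz⟩ := hz
    obtain ⟨c, hcB, hzc⟩ : ∃ c ∈ B w, G.Adj z c := by
      by_cases hne : ∃ y ∈ B w, z ≠ y
      · obtain ⟨y, hy, hzy⟩ := hne
        exact exists_adj_of_induce_connected (hc w) hz hy hzy
      · push Not at hne
        exfalso
        have hn : ∀ w', w ≠ w' → ∃ y ∈ B w', G.Adj z y := by
          intro w' hw'
          obtain ⟨x, hx, y, hy, hxy⟩ := ha w w' hw'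
          rw [← hne x hx] at hxy
          exact ⟨y, hy, hxy⟩
        have hn' : ∀ w', w ≠ w' → a ∈ B w' ∨ b ∈ B w' := by
          intro w' hw'
          obtain ⟨y, hy, hzy⟩ := hn w' hw'
          rcases h.nbr y hzy with rfl | rfl
          · exact Or.inl hy
          · exact Or.inr hy
        have hd' : ∀ w1 w2, w1 ≠ w2 → ∀ x, x ∈ B w1 → x ∈ B w2 → False :=
          fun w1 w2 h12 x h1 h2 => Set.disjoint_left.1 (hd w1 w2 h12) h1 h2
        obtain ⟨w1, w2, w3, h1, h2, h3, h12, h13, h23⟩ :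
            ∃ w1 w2 w3 : Fin 4, w ≠ w1 ∧ w ≠ w2 ∧ w ≠ w3 ∧ w1 ≠ w2 ∧ w1 ≠ w3 ∧ w2 ≠ w3 :=
          exists_three_others w
        have d12 := hd' _ _ h12
        have d13 := hd' _ _ h13
        have d23 := hd' _ _ h23
        rcases hn' _ h1 with h1 | h1 <;> rcases hn' _ h2 with h2 | h2 <;>
          rcases hn' _ h3 with h3 | h3 <;> first
            | exact d12 _ h1 h2
            | exact d13 _ h1 h3
            | exact d23 _ h2 h3
    have hcz : c ≠ z := hzc.ne'
    refine IsMinor.of_map hc hd ha (fun x => if x = z then c else x) ?_ ?_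
    · intro w' x hx
      split_ifs with hxz
      · subst hxz
        by_cases hw : w = w'
        · exact hw ▸ hcB
        · exact absurd hx (Set.disjoint_left.1 (hd w w' hw) hz)
      · exact hx
    · intro _ _ x _ y _ hxy
      split_ifs with h1 h2 h2
      · exact Or.inl rfl
      · subst h1
        by_cases hcy : c = y
        · exact Or.inl hcy
        · exact Or.inr ((h.adj _ _).2 ⟨hcz, h2, hcy, Or.inr ⟨hzc, hxy⟩⟩)
      · subst h2
        by_cases hcy : x = c
        · exact Or.inl hcy
        · exact Or.inr ((h.adj _ _).2 ⟨h1, hcz, hcy, Or.inr ⟨hxy.symm, hzc⟩⟩)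
      · exact Or.inr ((h.adj _ _).2 ⟨h1, h2, hxy.ne, Or.inl hxy⟩)
  · push Not at hz
    refine IsMinor.of_map hc hd ha id (fun _ _ h => h) ?_
    intro w w' x hx y hy hxy
    refine Or.inr ((h.adj _ _).2 ⟨?_, ?_, hxy.ne, Or.inl hxy⟩)
    · rintro rfl; exact hz w hx
    · rintro rfl; exact hz w' hy

/-- If z is not adjacent to a, it has at most one neighbour and H has no new edge. Otherwise z,
which is isolated in H and hence in no branch set, is added to the branch set of a, if there is one.
A new edge of H has a as an endpoint, so z can replace it. -/
theorem Suppresses.of_isMinor {V : Type*} {G H : SimpleGraph V} {z a b : V}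
    (h : Suppresses G H z a b) (hH : IsMinor (SimpleGraph.completeGraph (Fin 4)) H) :
    IsMinor (SimpleGraph.completeGraph (Fin 4)) G := by
  classical
  by_cases hza : G.Adj z a
  swap
  · refine hH.mono fun x y hxy => ?_
    obtain ⟨-, -, hne, h1 | ⟨h1, h2⟩⟩ := (h.adj x y).1 hxy
    · exact h1
    · rcases h.nbr x h1 with rfl | rfl
      · exact absurd h1 hza
      · rcases h.nbr y h2 with rfl | rfl
        · exact absurd h2 hza
        · exact absurd rfl hne
  obtain ⟨B, hc, hd, ha⟩ := hH
  have hz : ∀ w, z ∉ B w := by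
    intro w hw
    obtain ⟨y, hy⟩ := exists_adj_of_mem_branch hc ha hw
    exact ((h.adj _ _).1 hy).1 rfl
  have hnew : ∀ x y, G.Adj z x → G.Adj z y → x ≠ y → x = a ∨ y = a := by
    intro x y hx hy hxy
    rcases h.nbr x hx with rfl | rfl
    · exact Or.inl rfl
    · rcases h.nbr y hy with rfl | rfl
      · exact Or.inr rfl
      · exact absurd rfl hxy
  let B' : Fin 4 → Set V := fun w => {x | x ∈ B w ∨ (x = z ∧ a ∈ B w)}
  refine ⟨B', fun w => ?_, fun w w' hw => ?_, fun w w' hw => ?_⟩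
  · refine connected_of_cover (H := H.induce (B w))
      (fun x => (⟨x.1, Or.inl x.2⟩ : B' w)) ?_ ?_ (hc w)
    · rintro ⟨x, hx⟩ ⟨y, hy⟩ hxy
      obtain ⟨-, -, hne, h1 | ⟨h1, h2⟩⟩ := (h.adj x y).1 hxy
      · exact SimpleGraph.Adj.reachable h1
      · have haB : a ∈ B w := by
          rcases hnew x y h1 h2 hne with rfl | rfl
          · exact hx
          · exact hy
        have r1 : (G.induce (B' w)).Adj ⟨x, Or.inl hx⟩ ⟨z, Or.inr ⟨rfl, haB⟩⟩ := h1.symm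
        have r2 : (G.induce (B' w)).Adj ⟨z, Or.inr ⟨rfl, haB⟩⟩ ⟨y, Or.inl hy⟩ := h2
        exact r1.reachable.trans r2.reachable
    · rintro ⟨y, hy | ⟨rfl, hy⟩⟩
      · exact ⟨⟨y, hy⟩, SimpleGraph.Reachable.refl _⟩
      · exact ⟨⟨a, hy⟩, SimpleGraph.Adj.reachable (show G.Adj a y from hza.symm)⟩
  · rw [Set.disjoint_left]
    have hdis := Set.disjoint_left.1 (hd w w' hw)
    rintro x (hx | ⟨rfl, hx⟩) (hx' | ⟨h1, hx'⟩)
    · exact hdis hx hx'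
    · subst h1; exact hz _ hx
    · exact hz _ hx'
    · exact hdis hx hx'
  · obtain ⟨x, hx, y, hy, hxy⟩ := ha w w' hw
    obtain ⟨-, -, hne, h1 | ⟨h1, h2⟩⟩ := (h.adj x y).1 hxy
    · exact ⟨x, Or.inl hx, y, Or.inl hy, h1⟩
    · rcases hnew x y h1 h2 hne with rfl | rfl
      · exact ⟨z, Or.inr ⟨rfl, hx⟩, y, Or.inl hy, h2⟩
      · exact ⟨x, Or.inl hx, z, Or.inr ⟨rfl, hy⟩, h1.symm⟩

theorem Suppresses.isSeriesParallel_iff {V : Type*} {G H : SimpleGraph V} {z a b : V}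
    (h : Suppresses G H z a b) : IsSeriesParallel G ↔ IsSeriesParallel H :=
  not_congr ⟨h.isMinor_of, h.of_isMinor⟩

/-- Isolated vertices are irrelevant for series-parallelness. -/
theorem isSeriesParallel_iff_of_embedding {V W : Type*} {G : SimpleGraph V} {H : SimpleGraph W}
    (e : W ↪ V) (he : ∀ x y, H.Adj x y ↔ G.Adj (e x) (e y))
    (hG : ∀ x y, G.Adj x y → x ∈ Set.range e) : IsSeriesParallel G ↔ IsSeriesParallel H := by
  refine not_congr ⟨?_, ?_⟩
  · rintro ⟨B, hc, hd, ha⟩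
    have hr : ∀ w, ∀ x ∈ B w, x ∈ Set.range e := fun w x hx => by
      obtain ⟨y, hy⟩ := exists_adj_of_mem_branch hc ha hx
      exact hG x y hy
    refine ⟨fun w => e ⁻¹' B w, fun w => ?_, fun w w' h => (hd w w' h).preimage e,
      fun w w' h => ?_⟩
    · choose p hp using fun x : B w => hr w x.1 x.2
      refine connected_of_cover (H := G.induce (B w))
        (fun x => (⟨p x, by rw [Set.mem_preimage, hp]; exact x.2⟩ : e ⁻¹' B w)) ?_ ?_ (hc w)
      · intro x y hxy
        refine SimpleGraph.Adj.reachable ?_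
        change H.Adj (p x) (p y)
        rw [he, hp, hp]; exact hxy
      · rintro ⟨y, hy⟩
        refine ⟨⟨e y, hy⟩, ?_⟩
        have : p ⟨e y, hy⟩ = y := e.injective (hp _)
        simp only [this]; exact SimpleGraph.Reachable.refl _
    · obtain ⟨x, hx, y, hy, hxy⟩ := ha w w' h
      obtain ⟨x, rfl⟩ := hr w x hx
      obtain ⟨y, rfl⟩ := hr w' y hy
      exact ⟨x, hx, y, hy, (he _ _).2 hxy⟩
  · rintro ⟨B, hc, hd, ha⟩
    refine ⟨fun w => e '' B w, fun w => ?_,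
      fun w w' h => Set.disjoint_image_of_injective e.injective (hd w w' h), fun w w' h => ?_⟩
    · refine connected_of_cover (H := H.induce (B w))
        (fun x => (⟨e x, Set.mem_image_of_mem e x.2⟩ : e '' B w)) ?_ ?_ (hc w)
      · intro x y hxy
        exact SimpleGraph.Adj.reachable ((he _ _).1 hxy)
      · rintro ⟨_, y, hy, rfl⟩
        exact ⟨⟨y, hy⟩, SimpleGraph.Reachable.refl _⟩
    · obtain ⟨x, hx, y, hy, hxy⟩ := ha w w' h
      exact ⟨e x, ⟨x, hx, rfl⟩, e y, ⟨y, hy, rfl⟩, (he _ _).1 hxy⟩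

theorem isSeriesParallel_bot {V : Type*} : IsSeriesParallel (⊥ : SimpleGraph V) := by
  rintro ⟨B, -, -, ha⟩
  obtain ⟨x, -, y, -, h⟩ := ha 0 1 (by decide)
  exact h

/-! ### Rooted trees as functions -/

/-- `f` is the parent function of a tree rooted at `r`. -/
def Rooted {V : Type*} (f : V → V) (r : V) : Prop := f r = r ∧ ∀ x, ∃ i, f^[i] x = r

/-- The graph joining each point to its image under `f`. -/
def treeGraph {V : Type*} (f : V → V) : SimpleGraph V where
  Adj x y := x ≠ y ∧ (f x = y ∨ f y = x)
  symm := ⟨fun _ _ h => ⟨h.1.symm, h.2.symm⟩⟩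
  loopless := ⟨fun _ h => h.1 rfl⟩

/-- The graph obtained from `T` by joining `v (i, false)` to `v (i, true)` for every `i`. -/
def glue {V β : Type*} (T : SimpleGraph V) (v : β × Bool → V) : SimpleGraph V where
  Adj x y := T.Adj x y ∨ (x ≠ y ∧ ∃ i, s(v (i, false), v (i, true)) = s(x, y))
  symm := ⟨fun _ _ h => h.imp SimpleGraph.Adj.symm fun h => ⟨h.1.symm, by
    obtain ⟨-, i, h⟩ := h; exact ⟨i, h.trans Sym2.eq_swap⟩⟩⟩
  loopless := ⟨fun _ h => h.elim (fun h => h.ne rfl) fun h => h.1 rfl⟩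

theorem Rooted.eq_root {V : Type*} {f : V → V} {r x : V} (h : Rooted f r) (hx : f x = x) :
    x = r := by
  obtain ⟨i, hi⟩ := h.2 x
  rwa [Function.iterate_fixed hx] at hi

theorem Rooted.isTree {V : Type*} [Finite V] {f : V → V} {r : V} (h : Rooted f r) :
    (treeGraph f).IsTree := by
  have hadj : ∀ x, x ≠ r → (treeGraph f).Adj x (f x) := fun x hx =>
    ⟨fun h' => hx (h.eq_root h'.symm), Or.inl rfl⟩
  have hstep : ∀ x, (treeGraph f).Reachable x (f x) := fun x => by
    by_cases hx : x = r
    · subst hx; rw [h.1]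
    · exact (hadj x hx).reachable
  have hreach : ∀ i x, (treeGraph f).Reachable x (f^[i] x) := by
    intro i
    induction i with
    | zero => exact fun x => SimpleGraph.Reachable.refl _
    | succ i ih => exact fun x => (hstep x).trans (ih (f x))
  have hr : ∀ x, (treeGraph f).Reachable x r := fun x => by
    obtain ⟨i, hi⟩ := h.2 x
    simpa [hi] using hreach i x
  have : Nonempty V := ⟨r⟩
  have hconn : (treeGraph f).Connected :=
    SimpleGraph.Connected.mk fun x y => (hr x).trans (hr y).symm
  refine SimpleGraph.isTree_iff_connected_and_card.2 ⟨hconn, ?_⟩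
  refine le_antisymm ?_ hconn.card_vert_le_card_edgeSet_add_one
  have : Fintype V := Fintype.ofFinite V
  have hsub : (treeGraph f).edgeSet ⊆ (fun x => s(x, f x)) '' {r}ᶜ := by
    intro e
    induction e with
    | _ x y =>
      rintro ⟨hne, h' | h'⟩
      · refine ⟨x, ?_, by simp [h']⟩
        rintro rfl
        exact hne (h.1.symm.trans h')
      · refine ⟨y, ?_, by simp [h', Sym2.eq_swap]⟩
        rintro rfl
        exact hne (h'.symm.trans h.1)
  have h1 := Set.ncard_le_ncard hsub
  have h2 := Set.ncard_image_le (f := fun x => s(x, f x)) (s := ({r}ᶜ : Set V))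
  have h3 := Set.ncard_add_ncard_compl ({r} : Set V)
  rw [Set.ncard_singleton] at h3
  rw [Nat.card_coe_set_eq]
  omega

/-- A disagreement at x passes on to g x. The edge from x to g x belongs to the tree of f, so f (g
x) = x; if also g (g x) = x, then the g-orbit of x would alternate between two points and could not
end at the fixed point r. Following g, the disagreement would reach the root, where both functions
agree. -/
theorem Rooted.eq_of_treeGraph_eq {V : Type*} {f g : V → V} {r : V} (hf : Rooted f r)
    (hg : Rooted g r) (h : treeGraph f = treeGraph g) : f = g := by
  by_contra hne
  obtain ⟨x, hx⟩ := Function.ne_iff.1 hne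
  have step : ∀ x, f x ≠ g x → f (g x) ≠ g (g x) := by
    intro x hx hx'
    have hxr : x ≠ r := by rintro rfl; exact hx (hf.1.trans hg.1.symm)
    have hadj : (treeGraph f).Adj x (g x) := by
      rw [h]; exact ⟨fun h' => hxr (hg.eq_root h'.symm), Or.inl rfl⟩
    have hfg : f (g x) = x := hadj.2.resolve_left hx
    rw [hfg] at hx'
    obtain ⟨i, hi⟩ := hg.2 x
    have : ∀ i, g^[i] x = x ∨ g^[i] x = g x := by
      intro i
      induction i with
      | zero => exact Or.inl rfl
      | succ i ih =>
        rw [Function.iterate_succ_apply']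
        rcases ih with h | h
        · exact Or.inr (by rw [h])
        · exact Or.inl (by rw [h, ← hx'])
    rcases this i with h' | h'
    · exact hxr (h'.symm.trans hi)
    · have h2 : g x = r := h'.symm.trans hi
      rw [h2, hf.1] at hfg
      exact hxr hfg.symm
  obtain ⟨i, hi⟩ := hg.2 x
  have : ∀ i, f (g^[i] x) ≠ g (g^[i] x) := by
    intro i
    induction i with
    | zero => exact hx
    | succ i ih => rw [Function.iterate_succ_apply']; exact step _ ih
  exact this i (by rw [hi, hf.1, hg.1])

/-- The parent of x is a neighbour closer to r. The resulting tree is contained in T and has equally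
many edges. -/
theorem exists_rooted {V : Type*} [Finite V] {T : SimpleGraph V} (hT : T.IsTree) (r : V) :
    ∃ f, Rooted f r ∧ treeGraph f = T := by
  classical
  have hcl : ∀ x, x ≠ r → ∃ y, T.Adj x y ∧ T.dist y r + 1 = T.dist x r := by
    intro x hx
    obtain ⟨w, hw⟩ := hT.connected.exists_walk_length_eq_dist x r
    cases w with
    | nil => exact absurd rfl hx
    | @cons _ y _ hxy w =>
      refine ⟨y, hxy, ?_⟩
      have h1 := SimpleGraph.dist_le w
      have h2 := hT.dist_ne_of_adj r hxy
      have h3 := hT.connected.dist_triangle (u := x) (v := y) (w := r)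
      rw [SimpleGraph.dist_eq_one_iff_adj.2 hxy] at h3
      simp only [SimpleGraph.Walk.length_cons] at hw
      omega
  choose! p hp using hcl
  let f : V → V := fun x => if x = r then r else p x
  have hf : Rooted f r := by
    refine ⟨by simp [f], fun x => ?_⟩
    induction hd : T.dist x r generalizing x with
    | zero => exact ⟨0, (hT.connected.dist_eq_zero_iff).1 hd⟩
    | succ d ih =>
      have hx : x ≠ r := by
        rintro rfl
        simp at hd
      obtain ⟨i, hi⟩ := ih (p x) (by have := (hp x hx).2; omega)
      refine ⟨i + 1, ?_⟩
      rw [Function.iterate_succ_apply]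
      simpa [f, hx] using hi
  refine ⟨f, hf, ?_⟩
  have hle : treeGraph f ≤ T := by
    have key : ∀ x y, x ≠ y → f x = y → T.Adj x y := by
      intro x y hxy h
      have hx : x ≠ r := by
        rintro rfl
        exact hxy (by simpa [f] using h)
      have : p x = y := by simpa [f, hx] using h
      exact this ▸ (hp x hx).1
    rintro x y ⟨hxy, h | h⟩
    · exact key x y hxy h
    · exact (key y x hxy.symm h).symm
  have := Fintype.ofFinite V
  have h1 := (SimpleGraph.isTree_iff_connected_and_card.1 hf.isTree).2
  have h2 := (SimpleGraph.isTree_iff_connected_and_card.1 hT).2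
  rw [Nat.card_coe_set_eq] at h1 h2
  exact SimpleGraph.edgeSet_injective
    (Set.eq_of_subset_of_ncard_le (SimpleGraph.edgeSet_mono hle) (by omega))

/-- Undoing the subdivision of the edge from `c` to its parent. -/
theorem suppresses_subdivision {V β : Type*} [DecidableEq V] {h : V → V} (v : β × Bool → V)
    {c y : V} (hcy : c ≠ y) (hy : ∀ x, h x = y → x = y) (hyy : h y = y)
    (hv : ∀ i, v i ≠ y) :
    Suppresses (glue (treeGraph (Function.update (Function.update h c y) y (h c))) v)
      (glue (treeGraph h) v) y c (h c) := by
  have hcy' : h c ≠ y := fun h' => hcy (hy c h')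
  have e1 : ∀ x, (Function.update (Function.update h c y) y (h c)) x =
      if x = y then h c else if x = c then y else h x := fun x => by
    simp only [Function.update_apply]
  have hs : ∀ i x, s(v (i, false), v (i, true)) ≠ s(y, x) := by
    intro i x hi
    have : y ∈ s(v (i, false), v (i, true)) := hi ▸ Sym2.mem_mk_left y x
    rcases Sym2.mem_iff.1 this with h' | h'
    · exact hv _ h'.symm
    · exact hv _ h'.symm
  have hyadj : ∀ x, (glue (treeGraph (Function.update (Function.update h c y) y (h c))) v).Adj y x
      ↔ x = c ∨ x = h c := by
    intro x
    simp only [glue, treeGraph, e1, hs, exists_false, and_false, or_false]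
    constructor
    · rintro ⟨h1, h2⟩
      grind
    · rintro (rfl | rfl) <;> grind
  refine ⟨fun x => (hyadj x).1, fun x x' => ?_⟩
  rw [hyadj, hyadj]
  by_cases hx : x = y
  · subst hx
    simp only [glue, treeGraph, hs, exists_false, and_false, or_false, ne_eq, not_true_eq_false,
      false_and, iff_false]
    grind
  by_cases hx' : x' = y
  · subst hx'
    simp only [glue, treeGraph, Sym2.eq_swap (a := x), hs, exists_false, and_false, or_false,
      ne_eq, not_true_eq_false, false_and, iff_false]
    grind
  simp only [glue, treeGraph, e1, hx, hx', ne_eq, not_false_eq_true, true_and, if_false]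
  grind

/-- Removing a leaf. -/
theorem suppresses_leaf {V β : Type*} [DecidableEq V] {f : V → V} (v : β × Bool → V)
    {z : V} (hz : ∀ x, f x ≠ z) (hv : ∀ i, v i ≠ z) :
    Suppresses (glue (treeGraph f) v) (glue (treeGraph (Function.update f z z)) v)
      z (f z) (f z) := by
  have e1 : ∀ x, (Function.update f z z) x = if x = z then z else f x := fun x => by
    simp only [Function.update_apply]
  have hs : ∀ i x, s(v (i, false), v (i, true)) ≠ s(z, x) := by
    intro i x hi
    have : z ∈ s(v (i, false), v (i, true)) := hi ▸ Sym2.mem_mk_left z x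
    rcases Sym2.mem_iff.1 this with h' | h'
    · exact hv _ h'.symm
    · exact hv _ h'.symm
  have hzadj : ∀ x, (glue (treeGraph f) v).Adj z x ↔ x = f z := by
    intro x
    simp only [glue, treeGraph, hs, exists_false, and_false, or_false]
    grind
  refine ⟨fun x hx => Or.inl ((hzadj x).1 hx), fun x x' => ?_⟩
  rw [hzadj, hzadj]
  by_cases hx : x = z
  · subst hx
    simp only [glue, treeGraph, hs, e1, exists_false, and_false, or_false, ne_eq,
      not_true_eq_false, false_and, iff_false]
    grind
  by_cases hx' : x' = z
  · subst hx'
    simp only [glue, treeGraph, Sym2.eq_swap (a := x), hs, e1, exists_false, and_false, or_false,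
      ne_eq, not_true_eq_false, false_and, iff_false]
    grind
  simp only [glue, treeGraph, e1, hx, hx', ne_eq, not_false_eq_true, true_and, if_false]
  grind

/-! ### Counting functions with a prescribed reduced tree -/

section Counting

variable {V : Type*}

/-- The number of self-maps of `V` with a given property. -/
noncomputable def cnt (P : (V → V) → Prop) : ℕ := Nat.card {f // P f}

theorem cnt_congr {P Q : (V → V) → Prop} (h : ∀ f, P f ↔ Q f) : cnt P = cnt Q := by
  rw [show P = Q from funext fun f => propext (h f)]

theorem cnt_eq_zero {P : (V → V) → Prop} (h : ∀ f, ¬ P f) : cnt P = 0 := by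
  have : IsEmpty {f // P f} := ⟨fun f => h f.1 f.2⟩
  exact Nat.card_of_isEmpty

theorem cnt_eq_sum [Fintype V] (P : (V → V) → Prop) (c : V) :
    cnt P = ∑ y, cnt (fun f => P f ∧ f c = y) := by
  classical
  unfold cnt
  have e : {f // P f} ≃ Σ y, {f : V → V // P f ∧ f c = y} :=
    { toFun := fun f => ⟨f.1 c, f.1, f.2, rfl⟩
      invFun := fun f => ⟨f.2.1, f.2.2.1⟩
      left_inv := fun f => rfl
      right_inv := by rintro ⟨y, f, h, rfl⟩; rfl }
  rw [Nat.card_congr e, Nat.card_sigma]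

variable [Fintype V] [DecidableEq V]

/-- `f` agrees with `g` on `R` and every point reaches `R` under iteration of `f`. -/
def IsForest (R : Finset V) (g f : V → V) : Prop :=
  (∀ x ∈ R, f x = g x) ∧ ∀ x, ∃ i, f^[i] x ∈ R

/-- `f` is a forest with root set `R₀` that agrees with `g` on `R \ {z}`. -/
def IsForestThrough (R₀ R : Finset V) (z : V) (g f : V → V) : Prop :=
  (∀ x ∈ R, x ≠ z → f x = g x) ∧ ∀ x, ∃ i, f^[i] x ∈ R₀

/-- The points of R outside R₀ form paths with prescribed steps leading to z, and only the
continuation after z is free. There are three possibilities for y = f z. If y is in R₀, the rest is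
a forest with root set R, counted by the hypothesis `hF`. If y is in R but not in R₀, a cycle
arises. If y is outside R, the path has been prolonged and induction applies. With n = |R| + b, the
sum is |R₀| n^b (|R| + b) = |R₀| n^(b+1). -/
theorem card_isForestThrough {R₀ : Finset V}
    (hF : ∀ (R : Finset V) (g : V → V), R₀ ⊂ R →
      Fintype.card V * cnt (IsForest R g) =
        R.card * Fintype.card V ^ (Fintype.card V - R.card)) (b : ℕ) :
    ∀ (R : Finset V) (z : V) (g : V → V), R₀ ⊆ R → z ∈ R → z ∉ R₀ →
      Fintype.card V - R.card = b →
      (∀ f : V → V, (∀ x ∈ R, x ≠ z → f x = g x) → ∀ x ∈ R, x ∉ R₀ →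
        ∃ i, f^[i] x = z ∧ ∀ j ≤ i, f^[j] x ∉ R₀) →
      Fintype.card V * cnt (IsForestThrough R₀ R z g) = R₀.card * Fintype.card V ^ (b + 1) := by
  set n := Fintype.card V with hn
  induction b using Nat.strong_induction_on with
  | _ b ih =>
    intro R z g h0 hz hz0 hb hpath
    have hR0 : R₀ ⊂ R := Finset.ssubset_iff_of_subset h0 |>.2 ⟨z, hz, hz0⟩
    rw [cnt_eq_sum _ z, Finset.mul_sum]
    have hy : ∀ y, n * cnt (fun f => IsForestThrough R₀ R z g f ∧ f z = y) =
        (if y ∈ R₀ then R.card * n ^ b else 0) +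
          (if y ∈ Rᶜ then R₀.card * n ^ b else 0) := by
      intro y
      by_cases hy : y ∈ R₀
      · have h1 := hF R (Function.update g z y) hR0
        rw [if_pos hy, if_neg (by simpa using h0 hy), add_zero, ← hb, ← h1]
        congr 1
        refine cnt_congr fun f => ?_
        constructor
        · rintro ⟨⟨h1, h2⟩, h3⟩
          refine ⟨fun x hx => ?_, fun x => (h2 x).imp fun i hi => h0 hi⟩
          by_cases hxz : x = z
          · subst hxz; simp [h3]
          · simp [hxz, h1 x hx hxz]
        · rintro ⟨h1, h2⟩
          have h3 : f z = y := by simp [h1 z hz]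
          have h4 : ∀ x ∈ R, x ≠ z → f x = g x := fun x hx hxz => by simp [h1 x hx, hxz]
          refine ⟨⟨h4, fun x => ?_⟩, h3⟩
          obtain ⟨j, hj⟩ := h2 x
          by_cases hx0 : f^[j] x ∈ R₀
          · exact ⟨j, hx0⟩
          · obtain ⟨i, hi, -⟩ := hpath f h4 _ hj hx0
            refine ⟨i + 1 + j, ?_⟩
            rw [Function.iterate_add_apply, Function.iterate_succ_apply', hi, h3]
            exact hy
      · by_cases hyR : y ∈ R
        · rw [if_neg hy, if_neg (by simpa using hyR), cnt_eq_zero, mul_zero, add_zero]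
          rintro f ⟨⟨h1, h2⟩, h3⟩
          -- The path from y to z followed by the step from z to y is a cycle avoiding R₀, so y
          -- never reaches R₀.
          obtain ⟨i, hi, hi'⟩ := hpath f h1 y hyR hy
          have hper : Function.IsPeriodicPt f (i + 1) y := by
            change f^[i + 1] y = y
            rw [Function.iterate_succ_apply', hi, h3]
          obtain ⟨j, hj⟩ := h2 y
          rw [← hper.iterate_mod_apply] at hj
          exact hi' _ (Nat.lt_succ_iff.1 (Nat.mod_lt _ (Nat.succ_pos i))) hj
        · have hzy : z ≠ y := fun h => hyR (h ▸ hz)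
          have hb1 : b = b - 1 + 1 := by
            have := Finset.card_lt_univ_of_notMem hyR
            omega
          rw [if_neg hy, if_pos (by simpa using hyR), zero_add, hb1,
            ← ih (b - 1) (by omega) (insert y R) y (Function.update g z y) (h0.trans (Finset.subset_insert _ _))
              (Finset.mem_insert_self _ _) hy
              (by rw [Finset.card_insert_of_notMem hyR]; omega) ?_]
          · congr 1
            refine cnt_congr fun f => ?_
            constructor
            · rintro ⟨⟨h1, h2⟩, h3⟩
              refine ⟨fun x hx hxy => ?_, h2⟩
              by_cases hxz : x = z
              · subst hxz; simp [h3]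
              · simp [hxz, h1 x (Finset.mem_of_mem_insert_of_ne hx hxy) hxz]
            · rintro ⟨h1, h2⟩
              refine ⟨⟨fun x hx hxz => ?_, h2⟩, ?_⟩
              · rw [h1 x (Finset.mem_insert_of_mem hx) (fun h => hyR (h ▸ hx))]
                simp [hxz]
              · rw [h1 z (Finset.mem_insert_of_mem hz) hzy]; simp
          · intro f hf x hx hx0
            rcases Finset.mem_insert.1 hx with rfl | hx
            · exact ⟨0, rfl, fun j hj => by simpa [Nat.le_zero.1 hj] using hx0⟩
            · have hfz : f z = y := by rw [hf z (Finset.mem_insert_of_mem hz) hzy]; simp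
              obtain ⟨i, hi, hi'⟩ := hpath f (fun x hx hxz => by
                rw [hf x (Finset.mem_insert_of_mem hx) (fun h => hyR (h ▸ hx))]
                simp [hxz]) x hx hx0
              refine ⟨i + 1, by rw [Function.iterate_succ_apply', hi, hfz], fun j hj => ?_⟩
              rcases Nat.lt_or_ge i j with h | h
              · rw [show j = i + 1 by omega, Function.iterate_succ_apply', hi, hfz]
                exact hy
              · exact hi' j h
    simp_rw [hy]
    rw [Finset.sum_add_distrib, Finset.sum_ite_mem, Finset.sum_ite_mem, Finset.univ_inter,
      Finset.univ_inter, Finset.sum_const, Finset.sum_const, Finset.card_compl, ← hn, hb,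
      smul_eq_mul, smul_eq_mul]
    have : n = R.card + b := by
      have := Finset.card_le_univ R
      omega
    calc _ = R₀.card * n ^ b * (R.card + b) := by ring
      _ = _ := by rw [← this]; ring

/-- The number of forests with root set `R`. -/
theorem card_isForest (R : Finset V) (g : V → V) :
    Fintype.card V * cnt (IsForest R g) =
      R.card * Fintype.card V ^ (Fintype.card V - R.card) := by
  induction hb : Fintype.card V - R.card using Nat.strong_induction_on generalizing R g with
  | _ b ih =>
    by_cases hR : R = Finset.univ
    · subst hR
      have : cnt (IsForest Finset.univ g) = 1 := by
        unfold cnt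
        rw [Nat.card_eq_one_iff_unique]
        exact ⟨⟨fun f f' => Subtype.ext (funext fun x => by
          rw [f.2.1 x (Finset.mem_univ x), f'.2.1 x (Finset.mem_univ x)])⟩,
          ⟨⟨g, fun _ _ => rfl, fun x => ⟨0, Finset.mem_univ _⟩⟩⟩⟩
      rw [this, ← hb, Finset.card_univ]
      simp
    · obtain ⟨z, hz⟩ : ∃ z, z ∉ R := by
        by_contra h
        push Not at h
        exact hR (Finset.eq_univ_of_forall h)
      have hlt : R.card < Fintype.card V := Finset.card_lt_univ_of_notMem hz
      -- A one-point path {z} imposes no condition, because the value at z is left free; forests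
      -- through it are all the forests with root set R.
      have := card_isForestThrough (R₀ := R) (fun R' g' hR' => ih _ (by
          have := Finset.card_lt_card hR'; omega) R' g' rfl) (b - 1) (insert z R) z g
          (Finset.subset_insert _ _) (Finset.mem_insert_self _ _) hz
          (by rw [Finset.card_insert_of_notMem hz]; omega) (fun f _ x hx hxR => by
            rcases Finset.mem_insert.1 hx with rfl | hx
            · exact ⟨0, rfl, fun j hj => by simpa [Nat.le_zero.1 hj] using hxR⟩
            · exact absurd hx hxR)
      rw [Nat.sub_add_cancel (by omega)] at this
      rw [← this]
      congr 1
      refine cnt_congr fun f => and_congr_left fun _ => ?_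
      constructor
      · intro h x hx hxz
        exact h x (Finset.mem_of_mem_insert_of_ne hx hxz)
      · intro h x hx
        exact h x (Finset.mem_insert_of_mem hx) (fun h' => hz (h' ▸ hx))

end Counting

/-! ### Subdividing the edges of a reduced tree and hanging trees from it. -/

section Refinements

variable {V : Type*}

/-- `x` lies on the forward orbit under `f` of some point of `R`. -/
def Anc (f : V → V) (R : Finset V) (x : V) : Prop := ∃ d ∈ R, ∃ i, f^[i] d = x

/-- Two distinct points above `R` can only have the same parent if this parent lies in `R`. -/
def MeetClosed (f : V → V) (R : Finset V) : Prop :=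
  ∀ x y, Anc f R x → Anc f R y → f x = f y → f x ∉ R → x = y

theorem Anc.of_mem {f : V → V} {R : Finset V} {x : V} (hx : x ∈ R) : Anc f R x :=
  ⟨x, hx, 0, rfl⟩

theorem Anc.map {f : V → V} {R : Finset V} {x : V} (hx : Anc f R x) : Anc f R (f x) := by
  obtain ⟨d, hd, i, rfl⟩ := hx
  exact ⟨d, hd, i + 1, Function.iterate_succ_apply' f i d⟩

theorem Anc.iterate {f : V → V} {R : Finset V} {x : V} (hx : Anc f R x) (i : ℕ) :
    Anc f R (f^[i] x) := by
  induction i with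
  | zero => exact hx
  | succ i ih => rw [Function.iterate_succ_apply']; exact ih.map

theorem Anc.mono {f : V → V} {R R' : Finset V} (h : R ⊆ R') {x : V} (hx : Anc f R x) :
    Anc f R' x := by
  obtain ⟨d, hd, hi⟩ := hx
  exact ⟨d, h hd, hi⟩

/-- The orbit leading to x is restarted at its last visit to R. -/
theorem Anc.exists_last {f : V → V} {R : Finset V} {x : V} (hx : Anc f R x) :
    ∃ d ∈ R, ∃ j, f^[j] d = x ∧ ∀ j' < j, f^[j' + 1] d ∉ R := by
  obtain ⟨d, hd, i, rfl⟩ := hx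
  induction i using Nat.strong_induction_on generalizing d with
  | _ i ih =>
    by_cases h : ∃ j' < i, f^[j' + 1] d ∈ R
    · obtain ⟨j', hj', hR⟩ := h
      obtain ⟨e, he, j, hj, hj''⟩ := ih (i - (j' + 1)) (by omega) _ hR
      refine ⟨e, he, j, ?_, hj''⟩
      rw [hj, ← Function.iterate_add_apply]
      congr 1
      omega
    · push Not at h
      exact ⟨d, hd, i, rfl, h⟩

/-- The first return of `c` to `R` under `f` is `d`. -/
def FirstReturn (f : V → V) (R : Finset V) (c d : V) : Prop :=
  ∃ i, f^[i + 1] c = d ∧ ∀ j < i, f^[j + 1] c ∉ R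

theorem FirstReturn.eq {f : V → V} {R : Finset V} {c d : V} (h : FirstReturn f R c d) (hd : d ∈ R)
    {j : ℕ} (hj : f^[j + 1] c ∈ R) (hj' : ∀ j' < j, f^[j' + 1] c ∉ R) : f^[j + 1] c = d := by
  obtain ⟨i, hi, hi'⟩ := h
  rcases lt_trichotomy i j with h | h | h
  · exact absurd (hi ▸ hd) (hj' i h)
  · rw [← h, hi]
  · exact absurd hj (hi' j h)

theorem FirstReturn.unique {f : V → V} {R : Finset V} {c d d' : V} (h : FirstReturn f R c d)
    (hd : d ∈ R) (h' : FirstReturn f R c d') (hd' : d' ∈ R) : d = d' := by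
  obtain ⟨j, rfl, hj⟩ := h'
  exact (h.eq hd hd' hj).symm

/-- `f` is a function all of whose orbits reach `R`, and its reduction to `R` is `h`: first return
to `R` is given by `h`, it happens in one step outside of `J`, and all branching happens in `R`. -/
structure IsRefinement (R J : Finset V) (h f : V → V) : Prop where
  reach : ∀ x, ∃ i, f^[i] x ∈ R
  direct : ∀ c ∈ R, c ∉ J → f c = h c
  ret : ∀ c ∈ J, FirstReturn f R c (h c)
  meet : MeetClosed f R

theorem IsRefinement.firstReturn {R J : Finset V} {h f : V → V} (H : IsRefinement R J h f)
    {c : V} (hc : c ∈ R) : FirstReturn f R c (h c) := by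
  by_cases hJ : c ∈ J
  · exact H.ret c hJ
  · exact ⟨0, H.direct c hc hJ, by simp⟩

/-- The path segments between consecutive points of `R`. -/
theorem IsRefinement.exists_segment {R J : Finset V} {h f : V → V} (H : IsRefinement R J h f)
    (hR : ∀ x ∈ R, h x ∈ R) {x : V} (hx : Anc f R x) (hfx : f x ∈ R) :
    ∃ d ∈ R, h d = f x ∧ (∃ j, f^[j] d = x ∧ ∀ j' < j, f^[j' + 1] d ∉ R) ∧ (d ∉ J → x = d) := by
  obtain ⟨d, hd, j, rfl, hj⟩ := hx.exists_last
  rw [← Function.iterate_succ_apply' f] at hfx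
  have h1 := (H.firstReturn hd).eq (hR d hd) hfx hj
  refine ⟨d, hd, ?_, ⟨j, rfl, hj⟩, fun hdJ => ?_⟩
  · rw [← Function.iterate_succ_apply' f, ← h1]
  · rcases Nat.eq_zero_or_pos j with rfl | hj0
    · rfl
    · exact absurd (by simpa [H.direct d hd hdJ] using hR d hd) (hj 0 hj0)

/-- When no edge may be subdivided, f maps R to itself, so every point above R has its parent in R
and the meet condition is vacuous. -/
theorem isRefinement_empty_iff {R : Finset V} {h f : V → V} (hR : ∀ x ∈ R, h x ∈ R) :
    IsRefinement R ∅ h f ↔ IsForest R h f := by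
  constructor
  · intro H
    exact ⟨fun x hx => H.direct x hx (Finset.notMem_empty x), H.reach⟩
  · rintro ⟨h1, h2⟩
    refine ⟨h2, fun c hc _ => h1 c hc, by simp, fun x x' hx _ _ hn => absurd ?_ hn⟩
    obtain ⟨d, hd, i, rfl⟩ := hx
    rw [← Function.iterate_succ_apply' f]
    have : ∀ i, f^[i] d ∈ R := by
      intro i
      induction i with
      | zero => exact hd
      | succ i ih =>
        rw [Function.iterate_succ_apply', h1 _ ih]
        exact hR _ ih
    exact this (i + 1)

variable [DecidableEq V]

theorem isRefinement_erase_iff {R J : Finset V} {h f : V → V} {c : V} (hcJ : c ∈ J)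
    (hJ : J ⊆ R) : (IsRefinement R J h f ∧ f c = h c) ↔ IsRefinement R (J.erase c) h f := by
  constructor
  · rintro ⟨H, hc⟩
    refine ⟨H.reach, fun d hd hdJ => ?_, fun d hd => H.ret d (Finset.mem_of_mem_erase hd), H.meet⟩
    by_cases hdc : d = c
    · rw [hdc, hc]
    · exact H.direct d hd fun h => hdJ (Finset.mem_erase.2 ⟨hdc, h⟩)
  · intro H
    have hc : f c = h c := H.direct c (hJ hcJ) (Finset.notMem_erase c J)
    refine ⟨⟨H.reach, fun d hd hdJ => H.direct d hd fun h => hdJ (Finset.mem_of_mem_erase h),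
      fun d hd => H.firstReturn (hJ hd), H.meet⟩, hc⟩

/-- The first inner point y of the path from c to h c is promoted to a point of the reduced tree.
The edge from c to y is now direct and the edge from y to h c may still be subdivided, so R grows by
one while J keeps its size. The meet condition ensures that no other path between points of R enters
y. -/
theorem isRefinement_insert_iff {R J : Finset V} {h f : V → V} {c y : V} (hcJ : c ∈ J)
    (hJ : J ⊆ R) (hR : ∀ x ∈ R, h x ∈ R) (hy : y ∉ R) :
    (IsRefinement R J h f ∧ f c = y) ↔ IsRefinement (insert y R) (insert y (J.erase c))
      (Function.update (Function.update h c y) y (h c)) f := by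
  have hcR : c ∈ R := hJ hcJ
  have hne : ∀ x ∈ R, x ≠ y := fun x hx h => hy (h ▸ hx)
  have hcy : c ≠ y := hne c hcR
  set h' := Function.update (Function.update h c y) y (h c) with hh'
  have h'c : h' c = y := by simp [hh', hcy]
  have h'y : h' y = h c := by simp [hh']
  have h'x : ∀ x, x ≠ c → x ≠ y → h' x = h x := fun x h1 h2 => by simp [hh', h1, h2]
  constructor
  · rintro ⟨H, hfc⟩
    refine ⟨fun x => (H.reach x).imp fun i hi => Finset.mem_insert_of_mem hi, ?_, ?_, ?_⟩
    · intro d hd hdJ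
      have hdy : d ≠ y := fun h => hdJ (h ▸ Finset.mem_insert_self _ _)
      by_cases hdc : d = c
      · rw [hdc, h'c, hfc]
      · rw [h'x d hdc hdy]
        refine H.direct d (Finset.mem_of_mem_insert_of_ne hd hdy) fun h => hdJ ?_
        exact Finset.mem_insert_of_mem (Finset.mem_erase.2 ⟨hdc, h⟩)
    · -- a visit to `y` strictly inside a segment starting at `d ∈ J` forces `d = c`
      have key : ∀ d ∈ R, ∀ j, (∀ j' < j, f^[j' + 1] d ∉ R) → f^[j + 1] d = y →
          j = 0 ∧ d = c := by
        intro d hd j hj hjy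
        have h1 : f^[j] d = c := by
          refine H.meet _ _ ⟨d, hd, j, rfl⟩ (Anc.of_mem hcR) ?_ ?_
          · rw [hfc, ← hjy, Function.iterate_succ_apply']
          · rw [← Function.iterate_succ_apply' f, hjy]; exact hy
        rcases Nat.eq_zero_or_pos j with rfl | hj0
        · exact ⟨rfl, h1⟩
        · have := hj (j - 1) (by omega)
          rw [Nat.sub_add_cancel hj0, h1] at this
          exact absurd hcR this
      intro d hd
      rcases Finset.mem_insert.1 hd with rfl | hd
      · rw [h'y]
        obtain ⟨i, hi, hi'⟩ := H.ret c hcJ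
        rcases Nat.eq_zero_or_pos i with rfl | hi0
        · exact absurd (hR c hcR) (by rw [← hi]; simpa [hfc] using hy)
        · obtain ⟨i, rfl⟩ := Nat.exists_eq_add_of_le' hi0
          refine ⟨i, by rw [← hfc, ← Function.iterate_succ_apply]; exact hi, fun j hj hmem => ?_⟩
          have e : f^[j + 1] d = f^[j + 1 + 1] c := by
            rw [← hfc, ← Function.iterate_succ_apply]
          rw [e] at hmem
          rcases Finset.mem_insert.1 hmem with h | h
          · have := (key c hcR (j + 1) (fun j' hj' => hi' j' (by omega)) h).1
            omega
          · exact hi' (j + 1) (by omega) h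
      · have hdJ := Finset.mem_of_mem_erase hd
        have hdc := Finset.ne_of_mem_erase hd
        rw [h'x d hdc (hne d (hJ hdJ))]
        obtain ⟨i, hi, hi'⟩ := H.ret d hdJ
        refine ⟨i, hi, fun j hj hmem => ?_⟩
        rcases Finset.mem_insert.1 hmem with h | h
        · exact hdc (key d (hJ hdJ) j (fun j' hj' => hi' j' (by omega)) h).2
        · exact hi' j hj h
    · have hanc : ∀ x, Anc f (insert y R) x → Anc f R x := by
        rintro x ⟨d, hd, i, rfl⟩
        rcases Finset.mem_insert.1 hd with rfl | hd
        · rw [← hfc]; exact ((Anc.of_mem hcR).map).iterate i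
        · exact ⟨d, hd, i, rfl⟩
      intro x x' hx hx' hxx hn
      exact H.meet x x' (hanc x hx) (hanc x' hx') hxx fun h => hn (Finset.mem_insert_of_mem h)
  · intro H
    have hR' : ∀ x ∈ insert y R, h' x ∈ insert y R := by
      intro x hx
      by_cases hxy : x = y
      · rw [hxy, h'y]; exact Finset.mem_insert_of_mem (hR c hcR)
      · by_cases hxc : x = c
        · rw [hxc, h'c]; exact Finset.mem_insert_self _ _
        · rw [h'x x hxc hxy]
          exact Finset.mem_insert_of_mem (hR x (Finset.mem_of_mem_insert_of_ne hx hxy))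
    have hcJ' : c ∉ insert y (J.erase c) := by simp [hcy]
    have hfc : f c = y := by rw [H.direct c (Finset.mem_insert_of_mem hcR) hcJ', h'c]
    obtain ⟨iy, hiy, hiy'⟩ := H.ret y (Finset.mem_insert_self _ _)
    rw [h'y] at hiy
    refine ⟨⟨fun x => ?_, fun d hd hdJ => ?_, fun d hd => ?_, ?_⟩, hfc⟩
    · obtain ⟨i, hi⟩ := H.reach x
      rcases Finset.mem_insert.1 hi with h | h
      · refine ⟨iy + 1 + i, ?_⟩
        rw [Function.iterate_add_apply, h, hiy]
        exact hR c hcR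
      · exact ⟨i, h⟩
    · have hdc : d ≠ c := fun h => hdJ (h ▸ hcJ)
      rw [← h'x d hdc (hne d hd)]
      refine H.direct d (Finset.mem_insert_of_mem hd) ?_
      simp [hne d hd, hdJ]
    · by_cases hdc : d = c
      · subst hdc
        refine ⟨iy + 1, by rw [Function.iterate_succ_apply, hfc, hiy], fun j hj => ?_⟩
        rw [Function.iterate_succ_apply, hfc]
        rcases Nat.eq_zero_or_pos j with rfl | hj0
        · exact hy
        · have := hiy' (j - 1) (by omega)
          rw [Nat.sub_add_cancel hj0] at this
          exact fun h => this (Finset.mem_insert_of_mem h)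
      · have := H.ret d (Finset.mem_insert_of_mem (Finset.mem_erase.2 ⟨hdc, hd⟩))
        rw [h'x d hdc (hne d (hJ hd))] at this
        obtain ⟨i, hi, hi'⟩ := this
        exact ⟨i, hi, fun j hj h => hi' j hj (Finset.mem_insert_of_mem h)⟩
    -- In the enlarged reduced tree c is the only point sent to y, and its edge is direct. Hence y
    -- can be removed again without losing the meet condition.
    · have key : ∀ x, Anc f R x → f x = y → x = c := by
        intro x hx hxy
        obtain ⟨d, hd, hdx, -, hdJ⟩ := H.exists_segment hR' (hx.mono (Finset.subset_insert y R))
          (by rw [hxy]; exact Finset.mem_insert_self _ _)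
        rw [hxy] at hdx
        have hdc : d = c := by
          by_contra hdc
          by_cases hdy : d = y
          · rw [hdy, h'y] at hdx
            exact hne _ (hR c hcR) hdx
          · rw [h'x d hdc hdy] at hdx
            exact hne _ (hR d (Finset.mem_of_mem_insert_of_ne hd hdy)) hdx
        rw [← hdc]
        exact hdJ (hdc ▸ hcJ')
      intro x x' hx hx' hxx hn
      by_cases hxy : f x = y
      · rw [key x hx hxy, key x' hx' (hxx ▸ hxy)]
      · exact H.meet x x' (hx.mono (Finset.subset_insert _ _)) (hx'.mono (Finset.subset_insert _ _))
          hxx (by simp [hxy, hn])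

/-- `n` times the number of refinements on `n` points of a reduced tree with `a` points, `j` of
whose edges may be subdivided, where `b = n - a`. -/
def refinementSum (n j a b : ℕ) : ℕ :=
  ∑ i ∈ Finset.range (b + 1), b.descFactorial i * j.multichoose i * (a + i) * n ^ (b - i)

theorem refinementSum_zero (n a b : ℕ) : refinementSum n 0 a b = a * n ^ b := by
  unfold refinementSum
  rw [Finset.sum_range_succ', Finset.sum_eq_zero]
  · simp
  · intro i _
    simp [Nat.multichoose_zero_succ]

theorem refinementSum_succ_zero (n j a : ℕ) :
    refinementSum n (j + 1) a 0 = refinementSum n j a 0 := by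
  simp [refinementSum]

/-- Pascal's rule for `Nat.multichoose`: a chosen edge either receives no further point or one of
the b + 1 free points, after which it may be subdivided again. -/
theorem refinementSum_succ_succ (n j a b : ℕ) :
    refinementSum n (j + 1) a (b + 1) =
      refinementSum n j a (b + 1) + (b + 1) * refinementSum n (j + 1) (a + 1) b := by
  unfold refinementSum
  rw [Finset.sum_range_succ' _ (b + 1), Finset.sum_range_succ' _ (b + 1), Finset.mul_sum,
    add_right_comm, ← Finset.sum_add_distrib]
  simp only [Nat.multichoose_zero_right]
  congr 1
  refine Finset.sum_congr rfl fun i _ => ?_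
  rw [Nat.multichoose_succ_succ, Nat.succ_descFactorial_succ, Nat.add_sub_add_right]
  ring

/-- In the i-th summand of `refinementSum`, i further points are chosen in order and distributed
over the j paths, and (a + i) n^(b-i) is n times the number of forests on the resulting a + i roots.
The proof fixes c in J and splits by f c: either f c = h c and c leaves J, or f c is one of the b
points outside R and is inserted into the reduced tree. -/
theorem card_isRefinement [Fintype V] (b : ℕ) : ∀ (j : ℕ) (R J : Finset V) (h : V → V), J ⊆ R →
    (∀ x ∈ R, h x ∈ R) → J.card = j → Fintype.card V - R.card = b →
    Fintype.card V * cnt (IsRefinement R J h) =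
      refinementSum (Fintype.card V) j R.card b := by
  induction b using Nat.strong_induction_on with
  | _ b ihb =>
    intro j
    induction j with
    | zero =>
      intro R J h hJ hR hj hb
      rw [Finset.card_eq_zero] at hj
      subst hj
      rw [refinementSum_zero, ← hb, ← card_isForest R h]
      congr 1
      exact cnt_congr fun f => isRefinement_empty_iff hR
    | succ j ihj =>
      intro R J h hJ hR hj hb
      obtain ⟨c, hc⟩ : J.Nonempty := Finset.card_pos.1 (by omega)
      have hcR := hJ hc
      have hjc : (J.erase c).card = j := by rw [Finset.card_erase_of_mem hc]; omega
      rw [cnt_eq_sum _ c, Finset.mul_sum]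
      have hy : ∀ y, Fintype.card V * cnt (fun f => IsRefinement R J h f ∧ f c = y) =
          (if h c = y then refinementSum (Fintype.card V) j R.card b else 0) +
          (if y ∈ Rᶜ then refinementSum (Fintype.card V) (j + 1) (R.card + 1) (b - 1) else 0) := by
        intro y
        by_cases hyc : h c = y
        · subst hyc
          rw [if_pos rfl, if_neg (by simpa using hR c hcR), add_zero,
            ← ihj R (J.erase c) h ((Finset.erase_subset _ _).trans hJ) hR hjc hb]
          congr 1
          exact cnt_congr fun f => isRefinement_erase_iff hc hJ
        · rw [if_neg hyc, zero_add]
          by_cases hyR : y ∈ R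
          · rw [if_neg (by simpa using hyR), cnt_eq_zero, mul_zero]
            rintro f ⟨H, hf⟩
            refine hyc ((H.ret c hc).eq (hR c hcR) (j := 0) ?_ (by simp) |>.symm.trans ?_)
            · simpa [hf] using hyR
            · simp [hf]
          · have hlt := Finset.card_lt_univ_of_notMem hyR
            have hyJ : y ∉ J.erase c := fun h => hyR (hJ (Finset.mem_of_mem_erase h))
            have hne : ∀ x ∈ R, x ≠ y := fun x hx h => hyR (h ▸ hx)
            rw [if_pos (by simpa using hyR), ← Finset.card_insert_of_notMem hyR,
              ← ihb (b - 1) (by omega) (j + 1) (insert y R) (insert y (J.erase c))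
                (Function.update (Function.update h c y) y (h c))
                (Finset.insert_subset_insert _ ((Finset.erase_subset _ _).trans hJ)) ?_
                (by rw [Finset.card_insert_of_notMem hyJ, hjc])
                (by rw [Finset.card_insert_of_notMem hyR]; omega)]
            · congr 1
              exact cnt_congr fun f => isRefinement_insert_iff hc hJ hR hyR
            · intro x hx
              simp only [Function.update_apply]
              split_ifs with h1 h2
              · exact Finset.mem_insert_of_mem (hR c hcR)
              · exact Finset.mem_insert_self _ _
              · exact Finset.mem_insert_of_mem (hR x (Finset.mem_of_mem_insert_of_ne hx h1))
      simp_rw [hy]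
      rw [Finset.sum_add_distrib, Finset.sum_ite_eq, if_pos (Finset.mem_univ _),
        Finset.sum_ite_mem, Finset.univ_inter, Finset.sum_const, Finset.card_compl, hb,
        smul_eq_mul]
      cases b with
      | zero => simp [refinementSum_succ_zero]
      | succ b => rw [refinementSum_succ_succ]; simp

/-- The function `h` restricted to `R` and extended by the identity. -/
def restrictTo (R : Finset V) (h : V → V) : V → V := fun x => if x ∈ R then h x else x

theorem restrictTo_insert_forest {R : Finset V} {h : V → V} {z : V} (hz : z ∉ R) :
    Function.update (restrictTo (insert z R) h) z z = restrictTo R h := by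
  funext x
  by_cases hx : x = z
  · subst hx; simp [restrictTo, hz]
  · simp [restrictTo, hx]

/-- The hanging trees carry no marks, so they can be stripped leaf by leaf. The induction goes from
all of V down to R: a point z outside R with parent in R is a leaf of the tree restricted to R and
z. -/
theorem isSeriesParallel_forest_iff [Fintype V] {β : Type*} (v : β × Bool → V) {f : V → V}
    (b : ℕ) : ∀ R : Finset V, Fintype.card V - R.card = b → (∀ i, v i ∈ R) →
    (∀ x ∈ R, f x ∈ R) → (∀ x, ∃ i, f^[i] x ∈ R) →
    (IsSeriesParallel (glue (treeGraph f) v) ↔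
      IsSeriesParallel (glue (treeGraph (restrictTo R f)) v)) := by
  induction b with
  | zero =>
    intro R hb _ _ _
    have : R = Finset.univ :=
      Finset.eq_univ_of_card R (le_antisymm (Finset.card_le_univ R) (by omega))
    subst this
    rw [show restrictTo Finset.univ f = f from funext fun x => by simp [restrictTo]]
  | succ b ih =>
    intro R hb hv hR hreach
    obtain ⟨z, hz, hfz⟩ : ∃ z, z ∉ R ∧ f z ∈ R := by
      obtain ⟨x, hx⟩ : ∃ x, x ∉ R := by
        by_contra h
        push Not at h
        rw [Finset.eq_univ_of_forall h, Finset.card_univ] at hb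
        omega
      have hi := Nat.find_spec (hreach x)
      have hmin := fun m => Nat.find_min (hreach x) (m := m)
      set i := Nat.find (hreach x)
      cases hi' : i with
      | zero => rw [hi'] at hi; exact absurd hi hx
      | succ i' =>
        rw [hi'] at hi
        exact ⟨f^[i'] x, hmin i' (by omega), by rwa [← Function.iterate_succ_apply' f]⟩
    have hc := Finset.card_insert_of_notMem hz
    rw [ih (insert z R) (by omega) (fun i => Finset.mem_insert_of_mem (hv i))
      (fun x hx => by
        rcases Finset.mem_insert.1 hx with rfl | hx
        · exact Finset.mem_insert_of_mem hfz
        · exact Finset.mem_insert_of_mem (hR x hx))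
      (fun x => (hreach x).imp fun i hi => Finset.mem_insert_of_mem hi),
      ← restrictTo_insert_forest hz]
    refine (suppresses_leaf v (fun x => ?_) fun i h => hz (by rw [← h]; exact hv i)).isSeriesParallel_iff
    unfold restrictTo
    split_ifs with h
    · rcases Finset.mem_insert.1 h with rfl | h
      · exact fun h' => hz (h' ▸ hfz)
      · exact fun h' => hz (h' ▸ hR x h)
    · exact fun h' => h (h' ▸ Finset.mem_insert_self _ _)

/-- Refining a reduced tree whose points include all marks preserves series-parallelness. -/
theorem IsRefinement.isSeriesParallel_iff [Fintype V] {β : Type*} (v : β × Bool → V) {f : V → V}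
    (b : ℕ) : ∀ (j : ℕ) (R J : Finset V) (h : V → V), J ⊆ R →
    (∀ x ∈ R, h x ∈ R) → J.card = j → Fintype.card V - R.card = b → (∀ i, v i ∈ R) →
    IsRefinement R J h f →
    (IsSeriesParallel (glue (treeGraph f) v) ↔
      IsSeriesParallel (glue (treeGraph (restrictTo R h)) v)) := by
  induction b using Nat.strong_induction_on with
  | _ b ihb =>
    intro j
    induction j with
    | zero =>
      intro R J h hJ hR hj hb hv H
      rw [Finset.card_eq_zero] at hj
      subst hj
      obtain ⟨h1, h2⟩ := (isRefinement_empty_iff hR).1 H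
      rw [isSeriesParallel_forest_iff v b R hb hv (fun x hx => by rw [h1 x hx]; exact hR x hx) h2]
      rw [show restrictTo R f = restrictTo R h from funext fun x => by
        unfold restrictTo
        split_ifs with hx
        · exact h1 x hx
        · rfl]
    | succ j ihj =>
      intro R J h hJ hR hj hb hv H
      obtain ⟨c, hc⟩ : J.Nonempty := Finset.card_pos.1 (by omega)
      have hcR := hJ hc
      have hjc : (J.erase c).card = j := by rw [Finset.card_erase_of_mem hc]; omega
      by_cases hyR : f c ∈ R
      · have hfc : f c = h c :=
          (H.ret c hc).eq (hR c hcR) (j := 0) (by simpa using hyR) (by simp)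
        exact ihj R (J.erase c) h ((Finset.erase_subset _ _).trans hJ) hR hjc hb hv
          ((isRefinement_erase_iff hc hJ).1 ⟨H, hfc⟩)
      · have H' := (isRefinement_insert_iff hc hJ hR hyR).1 ⟨H, rfl⟩
        have hyJ : f c ∉ J.erase c := fun h => hyR (hJ (Finset.mem_of_mem_erase h))
        have hlt := Finset.card_lt_univ_of_notMem hyR
        have hcy : c ≠ f c := fun h => hyR (h ▸ hcR)
        rw [ihb (b - 1) (by omega) (j + 1) _ _ _
          (Finset.insert_subset_insert _ ((Finset.erase_subset _ _).trans hJ)) ?_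
          (by rw [Finset.card_insert_of_notMem hyJ, hjc])
          (by rw [Finset.card_insert_of_notMem hyR]; omega)
          (fun i => Finset.mem_insert_of_mem (hv i)) H']
        · have e : restrictTo (insert (f c) R)
              (Function.update (Function.update h c (f c)) (f c) (h c)) =
              Function.update (Function.update (restrictTo R h) c (f c)) (f c)
                (restrictTo R h c) := by
            funext x
            simp only [restrictTo, Function.update_apply, Finset.mem_insert]
            by_cases hx : x = f c
            · simp [hx, hcR]
            · by_cases hxc : x = c
              · simp [hxc, hcR]
              · simp [hx, hxc]
          rw [e]
          refine (suppresses_subdivision v hcy (fun x hx => ?_) ?_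
            fun i h => hyR (by rw [← h]; exact hv i)).isSeriesParallel_iff
          · unfold restrictTo at hx
            split_ifs at hx with h1
            · exact absurd (hx ▸ hR x h1) hyR
            · exact hx
          · simp [restrictTo, hyR]
        · intro x hx
          simp only [Function.update_apply]
          split_ifs with h1 h2
          · exact Finset.mem_insert_of_mem (hR c hcR)
          · exact Finset.mem_insert_self _ _
          · exact Finset.mem_insert_of_mem (hR x (Finset.mem_of_mem_insert_of_ne hx h1))

end Refinements

/-! ### Meet-closed sets -/

section MeetClosure

variable {V : Type*}

/-- From a common point outside R the meet condition allows only one way back, so the two segments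
can be retraced together to their starting points. -/
theorem IsRefinement.segment_eq {R J : Finset V} {h f : V → V} (H : IsRefinement R J h f)
    {d d' : V} (hd : d ∈ R) (hd' : d' ∈ R) {i i' : ℕ} (hi : ∀ j < i, f^[j + 1] d ∉ R)
    (hi' : ∀ j < i', f^[j + 1] d' ∉ R) (heq : f^[i] d = f^[i'] d') : d = d' := by
  induction i generalizing i' with
  | zero =>
    cases i' with
    | zero => exact heq
    | succ i' => exact absurd (heq ▸ hd) (hi' i' (Nat.lt_succ_self _))
  | succ i ih =>
    cases i' with
    | zero => exact absurd (heq ▸ hd') (hi i (Nat.lt_succ_self _))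
    | succ i' =>
      refine ih (i' := i') (fun j hj => hi j (by omega)) (fun j hj => hi' j (by omega)) ?_
      rw [Function.iterate_succ_apply', Function.iterate_succ_apply' f i'] at heq
      refine H.meet _ _ ⟨d, hd, i, rfl⟩ ⟨d', hd', i', rfl⟩ heq ?_
      rw [← Function.iterate_succ_apply' f]
      exact hi i (Nat.lt_succ_self _)

variable [DecidableEq V]

/-- The orbit of x is disjoint from the tree spanned by W until it enters it at y. The only new
branching is therefore at y, and adding x and y suffices. -/
theorem MeetClosed.insert_insert {f : V → V} {W : Finset V} (hW : MeetClosed f W) {x y : V}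
    {i₀ : ℕ} (hy : f^[i₀] x = y) (hyW : Anc f W y) (hmin : ∀ i < i₀, ¬ Anc f W (f^[i] x)) :
    MeetClosed f (insert x (insert y W)) := by
  have hanc : ∀ p, Anc f (insert x (insert y W)) p → Anc f W p ∨ ∃ i < i₀, f^[i] x = p := by
    rintro p ⟨d, hd, i, rfl⟩
    rcases Finset.mem_insert.1 hd with rfl | hd
    · rcases Nat.lt_or_ge i i₀ with h | h
      · exact Or.inr ⟨i, h, rfl⟩
      · left
        rw [← Nat.sub_add_cancel h, Function.iterate_add_apply, hy]
        exact hyW.iterate _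
    · rcases Finset.mem_insert.1 hd with rfl | hd
      · exact Or.inl (hyW.iterate i)
      · exact Or.inl ⟨d, hd, i, rfl⟩
  have hseg : ∀ i < i₀, f (f^[i] x) ∉ insert x (insert y W) → ¬ Anc f W (f (f^[i] x)) := by
    intro i hi hn
    rw [← Function.iterate_succ_apply' f]
    rcases Nat.lt_or_ge (i + 1) i₀ with h | h
    · exact hmin _ h
    · exfalso
      apply hn
      rw [← Function.iterate_succ_apply' f, show i.succ = i₀ by omega, hy]
      exact Finset.mem_insert_of_mem (Finset.mem_insert_self _ _)
  -- A repetition before time i₀ would let the orbit skip j - i steps and reach y too early.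
  have hper : ∀ i j, i < j → j < i₀ → f (f^[i] x) ≠ f (f^[j] x) := by
    intro i j hij hj h
    rw [← Function.iterate_succ_apply' f, ← Function.iterate_succ_apply' f] at h
    refine hmin (i₀ - (j + 1) + (i + 1)) (by omega) ?_
    rw [Function.iterate_add_apply, h, ← Function.iterate_add_apply, Nat.sub_add_cancel hj, hy]
    exact hyW
  intro p q hp hq hpq hn
  rcases hanc p hp with hp | ⟨i, hi, rfl⟩ <;> rcases hanc q hq with hq | ⟨j, hj, rfl⟩
  · exact hW p q hp hq hpq fun h => hn (by simp [h])
  · exact absurd (hpq ▸ hp.map) (hseg j hj (hpq ▸ hn))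
  · exact absurd (hpq ▸ hq.map) (hseg i hi hn)
  · rcases lt_trichotomy i j with h | h | h
    · exact absurd hpq (hper i j h hj)
    · rw [h]
    · exact absurd hpq.symm (hper j i h hi)

/-- Every element of S adds at most two points. The first one is cheaper: its orbit joins {r} at r
itself, which makes room for the root in the bound 2|S|. -/
theorem exists_meetClosed {f : V → V} {r : V} (hf : Rooted f r) (S : Finset V) :
    ∃ W, insert r S ⊆ W ∧ MeetClosed f W ∧ (W.card ≤ 2 * S.card ∨ W = {r}) := by
  have hr : ∀ i, f^[i] r = r := fun i => Function.iterate_fixed hf.1 i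
  induction S using Finset.induction_on with
  | empty =>
    refine ⟨{r}, by simp, ?_, Or.inr rfl⟩
    rintro x y ⟨d, hd, i, rfl⟩ ⟨d', hd', i', rfl⟩ - -
    rw [Finset.mem_singleton.1 hd, Finset.mem_singleton.1 hd', hr, hr]
  | insert x S hx ih =>
    obtain ⟨W, hSW, hW, hcard⟩ := ih
    have hrW : r ∈ W := hSW (Finset.mem_insert_self _ _)
    classical
    have hex : ∃ i, Anc f W (f^[i] x) := (hf.2 x).imp fun i hi => by
      rw [hi]; exact Anc.of_mem hrW
    refine ⟨insert x (insert (f^[Nat.find hex] x) W), ?_,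
      hW.insert_insert rfl (Nat.find_spec hex) fun i hi => Nat.find_min hex hi, Or.inl ?_⟩
    · rw [Finset.insert_comm]
      exact Finset.insert_subset_insert _ (hSW.trans (Finset.subset_insert _ _))
    · rw [Finset.card_insert_of_notMem hx]
      rcases hcard with hcard | rfl
      · have h1 := Finset.card_insert_le x (insert (f^[Nat.find hex] x) W)
        have h2 := Finset.card_insert_le (f^[Nat.find hex] x) W
        omega
      · obtain ⟨d, hd, i, hi⟩ := Nat.find_spec hex
        rw [Finset.mem_singleton.1 hd, hr] at hi
        rw [← hi]
        have h1 := Finset.card_insert_le x (insert r {r})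
        simp only [Finset.insert_eq_of_mem (Finset.mem_singleton_self r),
          Finset.card_singleton] at h1 ⊢
        omega

open Classical in
/-- The smallest meet-closed set containing `S`. -/
noncomputable def meetClosure [Fintype V] (f : V → V) (S : Finset V) : Finset V :=
  Finset.univ.filter fun x => ∀ W, S ⊆ W → MeetClosed f W → x ∈ W

theorem meetClosure_subset [Fintype V] {f : V → V} {S W : Finset V} (hS : S ⊆ W) (hW : MeetClosed f W) :
    meetClosure f S ⊆ W := fun x hx => by
  simp only [meetClosure, Finset.mem_filter] at hx
  exact hx.2 W hS hW

theorem subset_meetClosure [Fintype V] (f : V → V) (S : Finset V) : S ⊆ meetClosure f S := fun x hx => by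
  simp only [meetClosure, Finset.mem_filter, Finset.mem_univ, true_and]
  exact fun W hW _ => hW hx

/-- Being meet-closed is preserved under intersection: a parent outside the intersection is outside
one of the sets W, and W already forces the two points to coincide. -/
theorem meetClosed_meetClosure [Fintype V] (f : V → V) (S : Finset V) : MeetClosed f (meetClosure f S) := by
  intro x y hx hy hxy hn
  simp only [meetClosure, Finset.mem_filter, Finset.mem_univ, true_and] at hn
  push Not at hn
  obtain ⟨W, hS, hW, hn⟩ := hn
  exact hW x y (hx.mono (meetClosure_subset hS hW)) (hy.mono (meetClosure_subset hS hW)) hxy hn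

theorem exists_isRefinement {f : V → V} {r : V} (hf : Rooted f r) {W : Finset V} (hr : r ∈ W)
    (hW : MeetClosed f W) :
    ∃ h : V → V, (∀ c ∈ W, h c ∈ W) ∧ h r = r ∧ IsRefinement W (W.erase r) h f := by
  classical
  have hreach : ∀ x, ∃ i, f^[i] x ∈ W := fun x => (hf.2 x).imp fun i hi => by rw [hi]; exact hr
  have hex : ∀ c, ∃ i, f^[i + 1] c ∈ W := fun c => (hreach (f c)).imp fun i hi => by
    rwa [Function.iterate_succ_apply]
  let h : V → V := fun c => f^[Nat.find (hex c) + 1] c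
  have h1 : ∀ c, h c ∈ W := fun c => Nat.find_spec (hex c)
  have hrr : h r = r := Function.iterate_fixed hf.1 _
  refine ⟨h, fun c _ => h1 c, hrr, hreach, fun c hc hcr => ?_,
    fun c hc => ⟨_, rfl, fun j hj => Nat.find_min (hex c) hj⟩, hW⟩
  have : c = r := by
    by_contra hne
    exact hcr (Finset.mem_erase.2 ⟨hne, hc⟩)
  rw [this, hrr, hf.1]

/-- The children of `c` in the reduced tree `h` on `W`. -/
def children (W : Finset V) (r : V) (h : V → V) (c : V) : Finset V :=
  (W.erase r).filter fun d => h d = c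

/-- Two points of the tree with parent c lie on segments starting at reduced children of c. With at
most one such child they are the same point, so c is not needed. By minimality, the unmarked points
of a meet closure have at least two children. -/
theorem MeetClosed.erase {f h : V → V} {r c : V} {W : Finset V}
    (hR : ∀ x ∈ W, h x ∈ W) (hrr : h r = r) (H : IsRefinement W (W.erase r) h f) (hcr : c ≠ r)
    (hch : (children W r h c).card ≤ 1) : MeetClosed f (W.erase c) := by
  intro p q hp hq hpq hn
  have hp' := hp.mono (Finset.erase_subset c W)
  have hq' := hq.mono (Finset.erase_subset c W)
  by_cases hW : f p ∈ W
  · have hc : f p = c := by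
      by_contra hne
      exact hn (Finset.mem_erase.2 ⟨hne, hW⟩)
    obtain ⟨d, hd, hdc, ⟨j, rfl, hj⟩, -⟩ := H.exists_segment hR hp' hW
    obtain ⟨d', hd', hdc', ⟨j', rfl, hj'⟩, -⟩ := H.exists_segment hR hq' (hpq ▸ hW)
    have hmem : ∀ d ∈ W, h d = c → d ∈ children W r h c := fun d hd hdc =>
      Finset.mem_filter.2 ⟨Finset.mem_erase.2 ⟨fun h' => hcr (by rw [← hdc, h', hrr]), hd⟩, hdc⟩
    obtain rfl : d = d' := Finset.card_le_one.1 hch d (hmem d hd (hdc.trans hc)) d'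
      (hmem d' hd' (hdc'.trans (hpq ▸ hc)))
    rw [← Function.iterate_succ_apply' f, ← Function.iterate_succ_apply' f] at hpq
    rw [← Function.iterate_succ_apply' f] at hW
    rcases lt_trichotomy j j' with h | h | h
    · exact absurd hW (hj' j h)
    · rw [h]
    · exact absurd (hpq ▸ hW) (hj j' h)
  · exact H.meet p q hp' hq' hpq hW

theorem exists_child_root {f h : V → V} {r w : V} (hf : Rooted f r) {W : Finset V} (hr : r ∈ W)
    (hR : ∀ x ∈ W, h x ∈ W) (H : IsRefinement W (W.erase r) h f) (hw : w ∈ W) (hwr : w ≠ r) :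
    (children W r h r).Nonempty := by
  classical
  have hmin := fun m => Nat.find_min (hf.2 w) (m := m)
  have hi := Nat.find_spec (hf.2 w)
  set i := Nat.find (hf.2 w)
  obtain ⟨i', hi'⟩ : ∃ i', i = i' + 1 := Nat.exists_eq_succ_of_ne_zero fun h0 => by
    rw [h0] at hi
    exact hwr hi
  rw [hi', Function.iterate_succ_apply'] at hi
  obtain ⟨d, hd, hdr, ⟨j, hj, -⟩, -⟩ := H.exists_segment hR ⟨w, hw, i', rfl⟩ (by rw [hi]; exact hr)
  refine ⟨d, Finset.mem_filter.2 ⟨Finset.mem_erase.2 ⟨?_, hd⟩, hdr.trans hi⟩⟩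
  rintro rfl
  rw [Function.iterate_fixed hf.1] at hj
  exact hmin i' (by omega) hj.symm

/-- The shape of the reduced tree when the meet closure has the largest possible size. -/
theorem children_of_card_meetClosure [Fintype V] {f h : V → V} {r : V} (hf : Rooted f r) {S : Finset V}
    (hrS : r ∈ S) {k : ℕ} (hS : S.card ≤ 2 * k + 2)
    (hcard : (meetClosure f S).card = 4 * k + 2)
    (hR : ∀ x ∈ meetClosure f S, h x ∈ meetClosure f S) (hrr : h r = r)
    (H : IsRefinement (meetClosure f S) ((meetClosure f S).erase r) h f) :
    S.card = 2 * k + 2 ∧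
      (∀ c ∈ meetClosure f S \ S, (children (meetClosure f S) r h c).card = 2) ∧
      (children (meetClosure f S) r h r).card = 1 ∧
      (∀ c ∈ S, c ≠ r → (children (meetClosure f S) r h c).card = 0) := by
  set W := meetClosure f S with hW
  have hSW : S ⊆ W := subset_meetClosure f S
  have hrW := hSW hrS
  have h2 : ∀ c ∈ W \ S, 2 ≤ (children W r h c).card := by
    intro c hc
    obtain ⟨hcW, hcS⟩ := Finset.mem_sdiff.1 hc
    by_contra hlt
    have hmc := MeetClosed.erase hR hrr H (fun h' => hcS (by rw [h']; exact hrS))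
      (by omega : (children W r h c).card ≤ 1)
    exact Finset.notMem_erase c W (meetClosure_subset
      (fun x hx => Finset.mem_erase.2 ⟨fun h' => hcS (by rw [← h']; exact hx), hSW hx⟩) hmc hcW)
  obtain ⟨w, hw, hwr⟩ : ∃ w ∈ W, w ≠ r :=
    Finset.exists_mem_ne (by omega) r
  have h1 : 1 ≤ (children W r h r).card :=
    Finset.card_pos.2 (exists_child_root hf hrW hR H hw hwr)
  have hsum : ∑ c ∈ W, (children W r h c).card = 4 * k + 1 := by
    have := Finset.card_eq_sum_card_fiberwise (f := h) (s := W.erase r) (t := W)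
      (fun x hx => hR x (Finset.mem_of_mem_erase hx))
    rw [Finset.card_erase_of_mem hrW] at this
    unfold children
    omega
  have hd1 := Finset.sum_sdiff (f := fun c => (children W r h c).card) hSW
  have hd2 := Finset.add_sum_erase S (fun c => (children W r h c).card) hrS
  have hge : ∑ c ∈ W \ S, 2 ≤ ∑ c ∈ W \ S, (children W r h c).card := Finset.sum_le_sum h2
  have hcd := Finset.card_sdiff_add_card_eq_card hSW
  -- The 4k + 1 points other than the root are children of someone. The root has at least one child
  -- and each of the at least 2k unmarked points at least two, which already makes 4k + 1; all the
  -- inequalities are equalities.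
  rw [Finset.sum_const, smul_eq_mul] at hge
  have heq : ∑ c ∈ W \ S, 2 = ∑ c ∈ W \ S, (children W r h c).card := by
    rw [Finset.sum_const, smul_eq_mul]
    omega
  have hz : ∑ c ∈ S.erase r, (children W r h c).card = 0 := by omega
  refine ⟨by omega, fun c hc => ?_, by omega, fun c hc hcr => ?_⟩
  · exact ((Finset.sum_eq_sum_iff_of_le h2).1 heq c hc).symm
  · exact (Finset.sum_eq_zero_iff.1 hz) c (Finset.mem_erase.2 ⟨hcr, hc⟩)

end MeetClosure

/-! ### Kernels -/

section Kernel

variable {V A ι : Type*}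

/-- The self-map of `V` induced by a self-map of `α` along an embedding, the identity elsewhere. -/
noncomputable def lift {α : Type*} (e : α ↪ V) (g : α → α) : V → V :=
  Function.extend e (e ∘ g) id

theorem lift_apply {α : Type*} (e : α ↪ V) (g : α → α) (c : α) : lift e g (e c) = e (g c) :=
  e.injective.extend_apply _ _ _

theorem lift_apply' {α : Type*} (e : α ↪ V) (g : α → α) {x : V} (hx : ¬ ∃ c, e c = x) :
    lift e g x = x :=
  Function.extend_apply' _ _ _ hx

theorem IsRefinement.congr {R J : Finset V} {h h' f : V → V} (H : IsRefinement R J h f)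
    (hJ : J ⊆ R) (hh : ∀ x ∈ R, h x = h' x) : IsRefinement R J h' f :=
  ⟨H.reach, fun c hc hcJ => by rw [← hh c hc]; exact H.direct c hc hcJ,
    fun c hc => by rw [← hh c (hJ hc)]; exact H.ret c hc, H.meet⟩

theorem IsRefinement.exists_iterate_eq {f h : V → V} {r : V} (hf : Rooted f r) {W J : Finset V}
    (hr : r ∈ W) (hR : ∀ x ∈ W, h x ∈ W) (H : IsRefinement W J h f) {x : V} (hx : x ∈ W) :
    ∃ i, h^[i] x = r := by
  obtain ⟨n, hn⟩ := hf.2 x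
  induction n using Nat.strong_induction_on generalizing x with
  | _ n ih =>
    by_cases hxr : x = r
    · exact ⟨0, hxr⟩
    obtain ⟨i, hi, hi'⟩ := H.firstReturn hx
    have hn0 : n ≠ 0 := by
      rintro rfl
      exact hxr hn
    have hle : i + 1 ≤ n := by
      by_contra hlt
      refine hi' (n - 1) (by omega) ?_
      rw [Nat.sub_add_cancel (by omega), hn]
      exact hr
    obtain ⟨j, hj⟩ := ih (n - (i + 1)) (by omega) (hR x hx) (by
      rw [← hi, ← Function.iterate_add_apply, Nat.sub_add_cancel hle, hn])
    exact ⟨j + 1, by rw [Function.iterate_succ_apply, hj]⟩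

variable [DecidableEq A] [DecidableEq ι]

/-- The tree rooted at `inr r₀` obtained from the tree `h` rooted at `a r₀` by attaching a leaf
`inr i` to `a i` for each `i`. -/
def withLeaves (h : A → A) (a : ι → A) (r₀ : ι) : A ⊕ ι → A ⊕ ι
  | Sum.inl x => if x = a r₀ then Sum.inr r₀ else Sum.inl (h x)
  | Sum.inr i => if i = r₀ then Sum.inr r₀ else Sum.inl (a i)

theorem withLeaves_root (h : A → A) (a : ι → A) (r₀ : ι) :
    withLeaves h a r₀ (Sum.inr r₀) = Sum.inr r₀ := if_pos rfl

theorem rooted_withLeaves {h : A → A} {a : ι → A} {r₀ : ι} (hh : Rooted h (a r₀)) :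
    Rooted (withLeaves h a r₀) (Sum.inr r₀) := by
  have hinl : ∀ i x, h^[i] x = a r₀ → ∃ j, (withLeaves h a r₀)^[j] (Sum.inl x) = Sum.inr r₀ := by
    intro i
    induction i with
    | zero =>
      intro x hx
      exact ⟨1, if_pos hx⟩
    | succ i ih =>
      intro x hx
      by_cases hxa : x = a r₀
      · exact ⟨1, if_pos hxa⟩
      · obtain ⟨j, hj⟩ := ih (h x) hx
        exact ⟨j + 1, by rw [Function.iterate_succ_apply]; simpa [withLeaves, hxa] using hj⟩
  refine ⟨withLeaves_root h a r₀, ?_⟩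
  rintro (x | i)
  · obtain ⟨i, hi⟩ := hh.2 x
    exact hinl i x hi
  · by_cases hi : i = r₀
    · exact ⟨0, by rw [hi]; rfl⟩
    · obtain ⟨i', hi'⟩ := hh.2 (a i)
      obtain ⟨j, hj⟩ := hinl i' (a i) hi'
      exact ⟨j + 1, by rw [Function.iterate_succ_apply]; simpa [withLeaves, hi] using hj⟩

theorem withLeaves_injective {h h' : A → A} {a a' : ι → A} {r₀ : ι} (hh : Rooted h (a r₀))
    (hh' : Rooted h' (a' r₀)) (heq : withLeaves h a r₀ = withLeaves h' a' r₀) :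
    h = h' ∧ a = a' := by
  have hr : a r₀ = a' r₀ := by
    have := congrFun heq (Sum.inl (a r₀))
    by_contra hne
    simp [withLeaves, hne] at this
  constructor
  · funext x
    by_cases hx : x = a r₀
    · rw [hx, hh.1, hr, hh'.1]
    · have := congrFun heq (Sum.inl x)
      simp only [withLeaves] at this
      rw [if_neg hx, if_neg (hr ▸ hx)] at this
      exact Sum.inl_injective this
  · funext i
    by_cases hi : i = r₀
    · rw [hi, hr]
    · have := congrFun heq (Sum.inr i)
      simp only [withLeaves] at this
      rw [if_neg hi, if_neg hi] at this
      exact Sum.inl_injective this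

variable [Fintype A] [Fintype ι]

/-- `h` is a tree rooted at `a r₀` and becomes cubic when a leaf is attached at each `a i`. -/
structure IsKernel (h : A → A) (a : ι → A) (r₀ : ι) : Prop where
  rooted : Rooted h (a r₀)
  cubic : ∀ x, (Finset.univ.filter fun d =>
    d ≠ Sum.inr r₀ ∧ withLeaves h a r₀ d = Sum.inl x).card = 2

/-- The only child of the root must be an `inl` point, because the orbit of any `inl` point enters
the root through it and the other `inr` points have no children. That child is the image of r₀ under
the attachment map. -/
theorem exists_withLeaves_eq [Nonempty A] {g : A ⊕ ι → A ⊕ ι} {r₀ : ι}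
    (hg : Rooted g (Sum.inr r₀))
    (h1 : (Finset.univ.filter fun d => d ≠ Sum.inr r₀ ∧ g d = Sum.inr r₀).card = 1)
    (h0 : ∀ i, i ≠ r₀ → ∀ d, d ≠ Sum.inr r₀ → g d ≠ Sum.inr i) :
    ∃ (h : A → A) (a : ι → A), Rooted h (a r₀) ∧ g = withLeaves h a r₀ := by
  classical
  obtain ⟨d, hd⟩ := Finset.card_eq_one.1 h1
  have hd' : ∀ x, (x ≠ Sum.inr r₀ ∧ g x = Sum.inr r₀) ↔ x = d := fun x => by
    rw [← Finset.mem_singleton (a := d), ← hd]; simp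
  obtain ⟨hdr, hgd⟩ := (hd' d).2 rfl
  obtain ⟨x₀⟩ := ‹Nonempty A›
  have hinl : ∃ a₀, d = Sum.inl a₀ := by
    cases d with
    | inl a₀ => exact ⟨a₀, rfl⟩
    | inr i =>
      exfalso
      have hi : i ≠ r₀ := fun h => hdr (by rw [h])
      have hmin := fun m => Nat.find_min (hg.2 (Sum.inl x₀)) (m := m)
      have hn := Nat.find_spec (hg.2 (Sum.inl x₀))
      set n := Nat.find (hg.2 (Sum.inl x₀))
      clear_value n
      cases n with
      | zero => cases hn
      | succ m =>
        rw [Function.iterate_succ_apply'] at hn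
        have hm := (hd' _).1 ⟨hmin m (by omega), hn⟩
        cases m with
        | zero => cases hm
        | succ m =>
          rw [Function.iterate_succ_apply'] at hm
          exact h0 i hi _ (hmin m (by omega)) hm
  obtain ⟨a₀, rfl⟩ := hinl
  have hr : ∀ i, i ≠ r₀ → ∃ y, g (Sum.inr i) = Sum.inl y := by
    intro i hi
    have hi' : (Sum.inr i : A ⊕ ι) ≠ Sum.inr r₀ := fun h => hi (Sum.inr_injective h)
    cases hgi : g (Sum.inr i) with
    | inl y => exact ⟨y, rfl⟩
    | inr j =>
      exfalso
      by_cases hj : j = r₀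
      · have := (hd' (Sum.inr i)).1 ⟨hi', by rw [hgi, hj]⟩
        cases this
      · exact h0 j hj _ hi' hgi
  have hl : ∀ x, x ≠ a₀ → ∃ y, g (Sum.inl x) = Sum.inl y := by
    intro x hx
    cases hgi : g (Sum.inl x) with
    | inl y => exact ⟨y, rfl⟩
    | inr j =>
      exfalso
      by_cases hj : j = r₀
      · have := (hd' (Sum.inl x)).1 ⟨Sum.inl_ne_inr, by rw [hgi, hj]⟩
        exact hx (Sum.inl_injective this)
      · exact h0 j hj _ Sum.inl_ne_inr hgi
  choose! b hb using hr
  choose! p hp using hl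
  let a : ι → A := fun i => if i = r₀ then a₀ else b i
  let h : A → A := fun x => if x = a₀ then a₀ else p x
  have har : a r₀ = a₀ := if_pos rfl
  have hgeq : g = withLeaves h a r₀ := by
    funext x
    rcases x with x | i
    · by_cases hx : x = a₀
      · simp [withLeaves, har, hx, hgd]
      · simp [withLeaves, har, hx, hp x hx, h]
    · by_cases hi : i = r₀
      · simp [withLeaves, hi, hg.1]
      · simp [withLeaves, hi, hb i hi, a]
  refine ⟨h, a, ⟨by simp [har, h], fun x => ?_⟩, hgeq⟩
  have : ∀ i x, g^[i] (Sum.inl x) = Sum.inr r₀ → ∃ j, h^[j] x = a r₀ := by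
    intro i
    induction i with
    | zero => intro x hx; cases hx
    | succ i ih =>
      intro x hx
      by_cases hxa : x = a₀
      · exact ⟨0, by rw [har]; exact hxa⟩
      · rw [Function.iterate_succ_apply, hp x hxa] at hx
        obtain ⟨j, hj⟩ := ih _ hx
        exact ⟨j + 1, by rw [Function.iterate_succ_apply]; simpa [h, hxa] using hj⟩
  obtain ⟨i, hi⟩ := hg.2 (Sum.inl x)
  exact this i x hi

theorem isRefinement_lift_unique {f : V → V} {r₀ : ι} {e : A ⊕ ι ↪ V} {J : Finset V}
    {h h' : A → A} {a a' : ι → A} (hh : Rooted h (a r₀)) (hh' : Rooted h' (a' r₀))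
    (H : IsRefinement (Finset.univ.map e) J (lift e (withLeaves h a r₀)) f)
    (H' : IsRefinement (Finset.univ.map e) J (lift e (withLeaves h' a' r₀)) f) :
    h = h' ∧ a = a' := by
  refine withLeaves_injective hh hh' (funext fun c => ?_)
  have hc := Finset.mem_map_of_mem e (Finset.mem_univ c)
  have := (H.firstReturn hc).unique (by rw [lift_apply]; simp) (H'.firstReturn hc)
    (by rw [lift_apply]; simp)
  rw [lift_apply, lift_apply] at this
  exact e.injective this

variable [DecidableEq V]

theorem card_children_lift (e : A ⊕ ι ↪ V) (g : A ⊕ ι → A ⊕ ι) (r₀ : ι) (c : A ⊕ ι) :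
    (children (Finset.univ.map e) (e (Sum.inr r₀)) (lift e g) (e c)).card =
      (Finset.univ.filter fun d => d ≠ Sum.inr r₀ ∧ g d = c).card := by
  rw [← Finset.card_map e]
  congr 1
  ext x
  simp only [children, Finset.mem_filter, Finset.mem_erase, Finset.mem_map, Finset.mem_univ,
    true_and]
  constructor
  · rintro ⟨⟨hx, d, rfl⟩, hd⟩
    rw [lift_apply] at hd
    exact ⟨d, ⟨fun h => hx (by rw [h]), e.injective hd⟩, rfl⟩
  · rintro ⟨d, ⟨h1, h2⟩, rfl⟩
    refine ⟨⟨fun h => h1 (e.injective h), d, rfl⟩, ?_⟩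
    rw [lift_apply, h2]

/-- If the meet closure of the marks has the largest possible size then the tree is a refinement
of a kernel. -/
theorem exists_isKernel [Fintype V] {f : V → V} {v : ι → V} {r₀ : ι} (hf : Rooted f (v r₀)) {k : ℕ}
    (hk : 1 ≤ k) (hι : Fintype.card ι = 2 * k + 2)
    (hcard : (meetClosure f (Finset.univ.image v)).card = 4 * k + 2) (e : A ⊕ ι ↪ V)
    (hev : ∀ i, e (Sum.inr i) = v i)
    (he : Finset.univ.map e = meetClosure f (Finset.univ.image v)) :
    ∃ (h : A → A) (a : ι → A), IsKernel h a r₀ ∧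
      IsRefinement (Finset.univ.map e) ((Finset.univ.map e).erase (e (Sum.inr r₀)))
        (lift e (withLeaves h a r₀)) f := by
  classical
  have hrS : v r₀ ∈ Finset.univ.image v := Finset.mem_image_of_mem v (Finset.mem_univ _)
  obtain ⟨h, hR, hrr, H⟩ := exists_isRefinement hf (subset_meetClosure f _ hrS)
    (meetClosed_meetClosure f _)
  obtain ⟨hS, hc2, hc1, hc0⟩ := children_of_card_meetClosure hf hrS
    (Finset.card_image_le.trans (by rw [Finset.card_univ, hι])) hcard hR hrr H
  rw [← he] at hR H hc2 hc1 hc0 hcard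
  rw [← hev] at hf hrr H hc2 hc1
  have hvinj : Function.Injective v := by
    have : (Finset.univ.image v).card = (Finset.univ : Finset ι).card := by
      rw [hS, Finset.card_univ, hι]
    exact fun x y hxy => Finset.card_image_iff.1 this (Finset.mem_coe.2 (Finset.mem_univ x))
      (Finset.mem_coe.2 (Finset.mem_univ y)) hxy
  have hex : ∀ c, ∃ d, e d = h (e c) := fun c => by
    simpa using hR (e c) (Finset.mem_map_of_mem e (Finset.mem_univ c))
  choose g hg using hex
  have hlift : ∀ x ∈ Finset.univ.map e, h x = lift e g x := by
    intro x hx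
    obtain ⟨c, -, rfl⟩ := Finset.mem_map.1 hx
    rw [lift_apply, hg]
  have hch : ∀ c, (children (Finset.univ.map e) (e (Sum.inr r₀)) h (e c)).card =
      (Finset.univ.filter fun d => d ≠ Sum.inr r₀ ∧ g d = c).card := by
    intro c
    rw [← card_children_lift e g r₀ c]
    congr 1
    unfold children
    refine Finset.filter_congr fun x hx => ?_
    rw [hlift x (Finset.mem_of_mem_erase hx)]
  have hA : Nonempty A := by
    rw [← Fintype.card_pos_iff]
    rw [Finset.card_map, Finset.card_univ, Fintype.card_sum, hι] at hcard
    omega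
  have hgr : Rooted g (Sum.inr r₀) := by
    refine ⟨e.injective (by rw [hg, hrr]), fun x => ?_⟩
    obtain ⟨i, hi⟩ := H.exists_iterate_eq hf (Finset.mem_map_of_mem e (Finset.mem_univ _)) hR
      (Finset.mem_map_of_mem e (Finset.mem_univ x))
    refine ⟨i, e.injective ?_⟩
    rw [← hi]
    clear hi
    induction i with
    | zero => rfl
    | succ i ih => rw [Function.iterate_succ_apply', Function.iterate_succ_apply', hg, ih]
  obtain ⟨h', a, hh', rfl⟩ := exists_withLeaves_eq hgr (by rw [← hch]; exact hc1) (by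
    intro i hi d hd hgd
    have h0 := hc0 (e (Sum.inr i)) (by rw [hev]; exact Finset.mem_image_of_mem v (Finset.mem_univ _))
      (by rw [hev]; exact fun h => hi (hvinj h))
    rw [← hev r₀, hch, Finset.card_eq_zero] at h0
    have : d ∈ (∅ : Finset (A ⊕ ι)) := h0 ▸ Finset.mem_filter.2 ⟨Finset.mem_univ _, hd, hgd⟩
    simp at this)
  refine ⟨h', a, ⟨hh', fun x => ?_⟩, H.congr (Finset.erase_subset _ _) hlift⟩
  rw [← hch]
  refine hc2 _ (Finset.mem_sdiff.2 ⟨Finset.mem_map_of_mem e (Finset.mem_univ _), fun h => ?_⟩)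
  obtain ⟨i, -, hi⟩ := Finset.mem_image.1 h
  rw [← hev] at hi
  cases e.injective hi

theorem rooted_of_isRefinement_lift {α : Type*} [Fintype α] {f : V → V} {r : α}
    {e : α ↪ V} {g : α → α} (hg : Rooted g r)
    (H : IsRefinement (Finset.univ.map e) ((Finset.univ.map e).erase (e r))
      (lift e g) f) : Rooted f (e r) := by
  have hmem : ∀ c, e c ∈ Finset.univ.map e := fun c => Finset.mem_map_of_mem e (Finset.mem_univ c)
  refine ⟨?_, fun x => ?_⟩
  · rw [H.direct _ (hmem _) (Finset.notMem_erase _ _), lift_apply, hg.1]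
  · have key : ∀ i c, g^[i] c = r → ∃ n, f^[n] (e c) = e r := by
      intro i
      induction i with
      | zero => intro c hc; exact ⟨0, by rw [← hc]; rfl⟩
      | succ i ih =>
        intro c hc
        obtain ⟨n, hn⟩ := ih (g c) hc
        obtain ⟨m, hm, -⟩ := H.firstReturn (hmem c)
        refine ⟨n + (m + 1), ?_⟩
        rw [Function.iterate_add_apply, hm, lift_apply, hn]
    obtain ⟨i, hi⟩ := H.reach x
    obtain ⟨c, -, hc⟩ := Finset.mem_map.1 hi
    obtain ⟨j, hj⟩ := hg.2 c
    obtain ⟨n, hn⟩ := key j c hj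
    exact ⟨n + i, by rw [Function.iterate_add_apply, ← hc, hn]⟩

/-- An inner point farthest from the root among those missing would have both children in the
closure. As the closure is meet-closed, the two segments entering the missing point would have the
same last vertex, and `IsRefinement.segment_eq` would identify the two children. -/
theorem meetClosure_eq_of_isRefinement_lift [Fintype V] {f : V → V} {r₀ : ι} {e : A ⊕ ι ↪ V}
    {h : A → A} {a : ι → A} (hK : IsKernel h a r₀)
    (H : IsRefinement (Finset.univ.map e) ((Finset.univ.map e).erase (e (Sum.inr r₀)))
      (lift e (withLeaves h a r₀)) f) :
    meetClosure f (Finset.univ.image fun i => e (Sum.inr i)) = Finset.univ.map e := by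
  classical
  set S := Finset.univ.image fun i => e (Sum.inr i)
  set g := withLeaves h a r₀ with hgdef
  have hmem : ∀ c, e c ∈ Finset.univ.map e := fun c => Finset.mem_map_of_mem e (Finset.mem_univ c)
  have hg : Rooted g (Sum.inr r₀) := rooted_withLeaves hK.rooted
  refine Finset.Subset.antisymm (meetClosure_subset (fun x hx => ?_) H.meet) ?_
  · obtain ⟨i, -, rfl⟩ := Finset.mem_image.1 hx
    exact hmem _
  by_contra hnot
  -- choose a missing point as deep as possible
  let miss : Finset (A ⊕ ι) := Finset.univ.filter fun c => e c ∉ meetClosure f S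
  have hne : miss.Nonempty := by
    obtain ⟨x, hx, hx'⟩ := Finset.not_subset.1 hnot
    obtain ⟨c, -, rfl⟩ := Finset.mem_map.1 hx
    exact ⟨c, Finset.mem_filter.2 ⟨Finset.mem_univ _, hx'⟩⟩
  obtain ⟨c, hc, hmax⟩ := Finset.exists_max_image miss (fun c => Nat.find (hg.2 c)) hne
  have hc' : e c ∉ meetClosure f S := (Finset.mem_filter.1 hc).2
  have hchild : ∀ d, d ≠ Sum.inr r₀ → g d = c → e d ∈ meetClosure f S := by
    intro d hd hdc
    by_contra hd'
    have h1 := hmax d (Finset.mem_filter.2 ⟨Finset.mem_univ _, hd'⟩)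
    have h2 := Nat.find_spec (hg.2 d)
    have h3 : Nat.find (hg.2 d) ≠ 0 := fun h => hd (by rw [h] at h2; exact h2)
    obtain ⟨m, hm⟩ := Nat.exists_eq_succ_of_ne_zero h3
    rw [hm, Nat.succ_eq_add_one, Function.iterate_succ_apply, hdc] at h2
    have h4 := Nat.find_min' (hg.2 c) h2
    omega
  have hS : ∀ i, e (Sum.inr i) ∈ meetClosure f S := fun i =>
    subset_meetClosure f S (Finset.mem_image_of_mem _ (Finset.mem_univ i))
  rcases c with x | i
  swap
  · exact hc' (hS i)
  obtain ⟨d, hd, d', hd', hdd⟩ := Finset.one_lt_card.1 (by rw [hK.cubic x]; norm_num)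
  obtain ⟨-, hdr, hdx⟩ := Finset.mem_filter.1 hd
  obtain ⟨-, hdr', hdx'⟩ := Finset.mem_filter.1 hd'
  obtain ⟨i, hi, hi'⟩ := H.firstReturn (hmem d)
  obtain ⟨j, hj, hj'⟩ := H.firstReturn (hmem d')
  rw [lift_apply, hgdef, hdx] at hi
  rw [lift_apply, hgdef, hdx'] at hj
  have heq : f^[i] (e d) = f^[j] (e d') := by
    refine meetClosed_meetClosure f S _ _ ⟨_, hchild d hdr hdx, i, rfl⟩
      ⟨_, hchild d' hdr' hdx', j, rfl⟩ ?_ ?_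
    · rw [← Function.iterate_succ_apply' f, ← Function.iterate_succ_apply' f]
      exact hi.trans hj.symm
    · rw [← Function.iterate_succ_apply' f]
      exact fun h => hc' (hi ▸ h)
  exact hdd (e.injective (H.segment_eq (hmem d) (hmem d') hi' hj' heq))

end Kernel

/-! ### The graph of a kernel and its series-parallelness. -/

section KernelGraph

theorem glue_adj_iff_of_leaf {V β : Type*} {T : SimpleGraph V} {v : β × Bool → V}
    {z p : V} {i : β × Bool} (hp : ∀ x, T.Adj z x ↔ x = p) (hvi : v i = z)
    (hvj : ∀ j, j ≠ i → v j ≠ z) (x : V) :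
    (glue T v).Adj z x ↔ x = p ∨ x = v (i.1, !i.2) := by
  obtain ⟨b, c⟩ := i
  have hq : v (b, !c) ≠ z := hvj _ (by simp)
  simp only [glue, hp]
  refine or_congr_right ?_
  constructor
  · rintro ⟨hzx, b', hb'⟩
    have hb : b' = b := by
      have hz : z ∈ s(v (b', false), v (b', true)) := hb' ▸ Sym2.mem_mk_left z x
      by_contra hne
      rcases Sym2.mem_iff.1 hz with h | h
      · exact hvj (b', false) (by simp [hne]) h.symm
      · exact hvj (b', true) (by simp [hne]) h.symm
    subst hb
    cases c
    · rw [hvi] at hb'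
      exact (Sym2.congr_right.1 hb').symm
    · rw [hvi, Sym2.eq_swap] at hb'
      exact (Sym2.congr_right.1 hb').symm
  · rintro rfl
    refine ⟨hq.symm, b, ?_⟩
    cases c
    · rw [hvi]; rfl
    · rw [hvi, Sym2.eq_swap]; rfl

/-- Moving a mark from a leaf to the neighbour of the leaf. -/
theorem suppresses_mark {V β : Type*} [DecidableEq β] {T T' : SimpleGraph V} {v : β × Bool → V}
    {z p : V} {i : β × Bool} (hp : ∀ x, T.Adj z x ↔ x = p) (hvi : v i = z)
    (hvj : ∀ j, j ≠ i → v j ≠ z) (hT : ∀ x y, T'.Adj x y ↔ T.Adj x y ∧ x ≠ z ∧ y ≠ z) :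
    Suppresses (glue T v) (glue T' (Function.update v i p)) z p (v (i.1, !i.2)) := by
  have hpz : p ≠ z := ((hp p).2 rfl).ne'
  have hnew : ∀ j, Function.update v i p j ≠ z := by
    intro j
    by_cases hj : j = i
    · subst hj; simpa using hpz
    · simpa [hj] using hvj j hj
  have hnz : ∀ x y, s(x, y) ≠ s(z, y) ∨ x = z := by
    intro x y
    by_cases h : x = z
    · exact Or.inr h
    · exact Or.inl fun h' => h (Sym2.congr_left.1 h')
  have hz' : ∀ x, ¬ (glue T' (Function.update v i p)).Adj z x := by
    rintro x (h | ⟨-, b, h⟩)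
    · exact ((hT _ _).1 h).2.1 rfl
    · have hz : z ∈ s(Function.update v i p (b, false), Function.update v i p (b, true)) :=
        h ▸ Sym2.mem_mk_left z x
      rcases Sym2.mem_iff.1 hz with h | h
      · exact hnew _ h.symm
      · exact hnew _ h.symm
  have hzadj := glue_adj_iff_of_leaf hp hvi hvj
  refine ⟨fun x hx => (hzadj x).1 hx, fun x y => ?_⟩
  by_cases hx : x = z
  · subst hx
    simp [hz']
  by_cases hy : y = z
  · subst hy
    simp only [ne_eq, not_true_eq_false, false_and, and_false, iff_false]
    exact fun h => hz' _ h.symm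
  simp only [hzadj, ne_eq, hx, hy, not_false_eq_true, true_and]
  have hold : ∀ b, b ≠ i.1 → ∀ c, Function.update v i p (b, c) = v (b, c) := by
    intro b hb c
    exact Function.update_of_ne (fun h => hb (by rw [← h])) _ _
  have hi1 : s(Function.update v i p (i.1, false), Function.update v i p (i.1, true)) =
      s(p, v (i.1, !i.2)) := by
    obtain ⟨b, c⟩ := i
    cases c
    · simp
    · simp [Sym2.eq_swap]
  have hi2 : z ∈ s(v (i.1, false), v (i.1, true)) := by
    rw [← hvi]
    obtain ⟨b, c⟩ := i
    cases c
    · exact Sym2.mem_mk_left _ _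
    · exact Sym2.mem_mk_right _ _
  constructor
  · intro h
    refine ⟨h.ne, ?_⟩
    rcases h with h | ⟨hxy, b, hb⟩
    · exact Or.inl (Or.inl ((hT x y).1 h).1)
    · by_cases hbi : b = i.1
      · subst hbi
        rw [hi1] at hb
        right
        rcases Sym2.eq_iff.1 hb with ⟨h1, h2⟩ | ⟨h1, h2⟩
        · exact ⟨Or.inl h1.symm, Or.inr h2.symm⟩
        · exact ⟨Or.inr h2.symm, Or.inl h1.symm⟩
      · rw [hold b hbi, hold b hbi] at hb
        exact Or.inl (Or.inr ⟨hxy, b, hb⟩)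
  · rintro ⟨hxy, (h | ⟨-, b, hb⟩) | ⟨h1, h2⟩⟩
    · exact Or.inl ((hT x y).2 ⟨h, hx, hy⟩)
    · refine Or.inr ⟨hxy, b, ?_⟩
      have hbi : b ≠ i.1 := by
        rintro rfl
        rw [hb] at hi2
        rcases Sym2.mem_iff.1 hi2 with h | h
        · exact hx h.symm
        · exact hy h.symm
      rw [hold b hbi, hold b hbi, hb]
    · refine Or.inr ⟨hxy, i.1, ?_⟩
      rw [hi1]
      rcases h1 with rfl | rfl <;> rcases h2 with rfl | rfl
      · exact absurd rfl hxy
      · rfl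
      · exact Sym2.eq_swap
      · exact absurd rfl hxy

variable {V A β : Type*}

theorem isSeriesParallel_lift_iff {α : Type*} (e : α ↪ V) (g : α → α) (w : β × Bool → α) :
    IsSeriesParallel (glue (treeGraph (lift e g)) fun i => e (w i)) ↔
      IsSeriesParallel (glue (treeGraph g) w) := by
  refine isSeriesParallel_iff_of_embedding e (fun x y => ?_) ?_
  · simp only [glue, treeGraph, lift_apply, e.injective.eq_iff, ne_eq]
    have : ∀ p q : α, s(e p, e q) = s(e x, e y) ↔ s(p, q) = s(x, y) := fun p q => by
      rw [Sym2.eq_iff, Sym2.eq_iff]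
      simp [e.injective.eq_iff]
    simp [this]
  · rintro X Y (⟨hne, h | h⟩ | ⟨-, b, hb⟩)
    · by_contra hX
      rw [lift_apply' e g (fun ⟨c, hc⟩ => hX ⟨c, hc⟩)] at h
      exact hne h
    · by_cases hY : ∃ c, e c = Y
      · obtain ⟨c, rfl⟩ := hY
        rw [lift_apply] at h
        exact ⟨_, h⟩
      · rw [lift_apply' e g hY] at h
        exact absurd h.symm hne
    · have : X ∈ s(e (w (b, false)), e (w (b, true))) := hb ▸ Sym2.mem_mk_left _ _
      rcases Sym2.mem_iff.1 this with h | h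
      · exact ⟨_, h.symm⟩
      · exact ⟨_, h.symm⟩

/-- Joining the pairs of marks adds pairwise distinct new edges to `T`. -/
structure AddsSimply (T : SimpleGraph V) (v : β × Bool → V) : Prop where
  inj : Function.Injective fun b => s(v (b, false), v (b, true))
  ne : ∀ b, v (b, false) ≠ v (b, true)
  not_adj : ∀ b, ¬ T.Adj (v (b, false)) (v (b, true))

variable [DecidableEq A] [DecidableEq β]

theorem treeGraph_withLeaves_inr {h : A → A} {a : β × Bool → A} {r₀ : β × Bool}
    (i : β × Bool) (X : A ⊕ (β × Bool)) :
    (treeGraph (withLeaves h a r₀)).Adj (Sum.inr i) X ↔ X = Sum.inl (a i) := by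
  rcases X with x | j
  · by_cases hi : i = r₀ <;> by_cases hx : x = a r₀ <;> simp [treeGraph, withLeaves, hi, hx] <;>
      grind
  · by_cases hi : i = r₀ <;> by_cases hj : j = r₀ <;> simp [treeGraph, withLeaves, hi, hj]
    all_goals grind

theorem treeGraph_withLeaves_inl {h : A → A} {a : β × Bool → A} {r₀ : β × Bool}
    (hh : Rooted h (a r₀)) (x y : A) :
    (treeGraph (withLeaves h a r₀)).Adj (Sum.inl x) (Sum.inl y) ↔ (treeGraph h).Adj x y := by
  have := hh.1
  by_cases hx : x = a r₀ <;> by_cases hy : y = a r₀ <;> simp [treeGraph, withLeaves, hx, hy]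
  all_goals grind

/-- The leaf of a mark has at most two neighbours in the glued graph, namely its attachment point
and the partner of the mark. The leaves are suppressed one by one: `T D` and `v D` describe the tree
and the marks after those in D are gone. -/
theorem isSeriesParallel_withLeaves_iff [Finite β] {h : A → A} {a : β × Bool → A}
    {r₀ : β × Bool} (hh : Rooted h (a r₀)) :
    IsSeriesParallel (glue (treeGraph (withLeaves h a r₀)) Sum.inr) ↔
      IsSeriesParallel (glue (treeGraph h) a) := by
  classical
  have := Fintype.ofFinite β
  let T : Finset (β × Bool) → SimpleGraph (A ⊕ (β × Bool)) := fun D =>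
    { Adj := fun X Y => (treeGraph (withLeaves h a r₀)).Adj X Y ∧
        (∀ i ∈ D, X ≠ Sum.inr i) ∧ ∀ i ∈ D, Y ≠ Sum.inr i
      symm := ⟨fun _ _ h => ⟨h.1.symm, h.2.2, h.2.1⟩⟩
      loopless := ⟨fun _ h => h.1.ne rfl⟩ }
  let v : Finset (β × Bool) → β × Bool → A ⊕ (β × Bool) := fun D i =>
    if i ∈ D then Sum.inl (a i) else Sum.inr i
  have key : ∀ D, IsSeriesParallel (glue (treeGraph (withLeaves h a r₀)) Sum.inr) ↔
      IsSeriesParallel (glue (T D) (v D)) := by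
    intro D
    induction D using Finset.induction_on with
    | empty =>
      have h1 : T ∅ = treeGraph (withLeaves h a r₀) := by
        ext X Y
        simp [T]
      have h2 : v ∅ = Sum.inr := by
        funext i
        simp [v]
      rw [h1, h2]
    | insert i D hi ih =>
      rw [ih]
      have h2 : v (insert i D) = Function.update (v D) i (Sum.inl (a i)) := by
        funext j
        by_cases hj : j = i
        · subst hj; simp [v]
        · simp [v, hj]
      rw [h2]
      refine (suppresses_mark (z := Sum.inr i) (fun X => ?_) ?_ (fun j hj => ?_)
        fun X Y => ?_).isSeriesParallel_iff
      · simp only [T, treeGraph_withLeaves_inr]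
        constructor
        · exact fun h => h.1
        · rintro rfl
          refine ⟨rfl, fun j hj h => hi ?_, fun j _ => Sum.inl_ne_inr⟩
          rw [Sum.inr_injective h]; exact hj
      · simp [v, hi]
      · simp only [v]
        split_ifs
        · exact Sum.inl_ne_inr
        · exact fun h => hj (Sum.inr_injective h)
      · simp only [T, Finset.forall_mem_insert]
        tauto
  rw [key Finset.univ]
  refine isSeriesParallel_iff_of_embedding Function.Embedding.inl (fun x y => ?_) ?_
  · have hv : ∀ i, v Finset.univ i = Sum.inl (a i) := fun i => by simp [v]
    simp only [glue, hv, T, Function.Embedding.inl_apply, treeGraph_withLeaves_inl hh]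
    simp
  · rintro (x | i) Y hY
    · exact ⟨x, rfl⟩
    · exfalso
      rcases hY with h | ⟨-, b, hb⟩
      · exact h.2.1 i (Finset.mem_univ i) rfl
      · have hv : ∀ i, v Finset.univ i = Sum.inl (a i) := fun i => by simp [v]
        rw [hv, hv] at hb
        have : Sum.inr i ∈ s((Sum.inl (a (b, false)) : A ⊕ (β × Bool)), Sum.inl (a (b, true))) :=
          hb ▸ Sym2.mem_mk_left _ _
        rcases Sym2.mem_iff.1 this with h | h <;> cases h

variable [Fintype A] [Fintype β] [DecidableEq V]

theorem isSeriesParallel_iff_of_isRefinement_lift [Fintype V] {f : V → V} {r₀ : β × Bool}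
    {e : A ⊕ (β × Bool) ↪ V} {h : A → A} {a : β × Bool → A} (hh : Rooted h (a r₀))
    (H : IsRefinement (Finset.univ.map e) ((Finset.univ.map e).erase (e (Sum.inr r₀)))
      (lift e (withLeaves h a r₀)) f) :
    IsSeriesParallel (glue (treeGraph f) fun i => e (Sum.inr i)) ↔
      IsSeriesParallel (glue (treeGraph h) a) := by
  rw [H.isSeriesParallel_iff (fun i => e (Sum.inr i)) _ _ _ _ _ (Finset.erase_subset _ _)
    (fun x hx => ?_) rfl rfl (fun i => Finset.mem_map_of_mem e (Finset.mem_univ _)),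
    ← isSeriesParallel_withLeaves_iff hh, ← isSeriesParallel_lift_iff e]
  · rw [show restrictTo (Finset.univ.map e) (lift e (withLeaves h a r₀)) =
      lift e (withLeaves h a r₀) from funext fun x => ?_]
    unfold restrictTo
    split_ifs with hx
    · rfl
    · exact (lift_apply' e _ fun ⟨c, hc⟩ =>
        hx (hc ▸ Finset.mem_map_of_mem e (Finset.mem_univ c))).symm
  · obtain ⟨c, -, rfl⟩ := Finset.mem_map.1 hx
    rw [lift_apply]
    exact Finset.mem_map_of_mem e (Finset.mem_univ _)

/-- Marks are distinct leaves of the reduced tree, so no tree edge joins two of them and no two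
pairs coincide. In the generic case simplicity of the graph is thus automatic, even if the kernel
has loops and multiple edges. -/
theorem addsSimply_of_isRefinement_lift {f : V → V} {r₀ : β × Bool}
    {e : A ⊕ (β × Bool) ↪ V} {h : A → A} {a : β × Bool → A}
    (H : IsRefinement (Finset.univ.map e) ((Finset.univ.map e).erase (e (Sum.inr r₀)))
      (lift e (withLeaves h a r₀)) f) :
    AddsSimply (treeGraph f) fun i : β × Bool => e (Sum.inr i) := by
  have hinj : ∀ i j : β × Bool, e (Sum.inr i) = e (Sum.inr j) → i = j := fun i j h =>
    Sum.inr_injective (e.injective h)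
  have hmem : ∀ c, e c ∈ Finset.univ.map e := fun c => Finset.mem_map_of_mem e (Finset.mem_univ c)
  have hadj : ∀ i j : β × Bool, i ≠ j → f (e (Sum.inr i)) ≠ e (Sum.inr j) := by
    intro i j hij hf
    have h1 := (H.firstReturn (hmem (Sum.inr i))).eq (by rw [lift_apply]; exact hmem _) (j := 0)
      (by simp [hf]) (by simp)
    rw [zero_add, Function.iterate_one, hf, lift_apply] at h1
    have h2 := e.injective h1
    by_cases hi : i = r₀
    · rw [hi, withLeaves_root] at h2
      exact hij (hi.trans (Sum.inr_injective h2).symm)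
    · simp [withLeaves, hi] at h2
  refine ⟨fun b b' hb => ?_, fun b h => by simpa using hinj _ _ h, fun b h => ?_⟩
  · rcases Sym2.eq_iff.1 hb with ⟨h1, -⟩ | ⟨h1, -⟩
    · exact (Prod.ext_iff.1 (hinj _ _ h1)).1
    · exact (Prod.ext_iff.1 (hinj _ _ h1)).1
  · rcases h.2 with h | h
    · exact hadj _ _ (by simp) h
    · exact hadj _ _ (by simp) h

theorem injective_of_card_meetClosure [Fintype V] {ι : Type*} [Fintype ι] {f : V → V} {v : ι → V} {r₀ : ι}
    (hf : Rooted f (v r₀)) {k : ℕ} (hι : Fintype.card ι = 2 * k + 2)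
    (hcard : (meetClosure f (Finset.univ.image v)).card = 4 * k + 2) : Function.Injective v := by
  have hrS : v r₀ ∈ Finset.univ.image v := Finset.mem_image_of_mem v (Finset.mem_univ _)
  obtain ⟨h, hR, hrr, H⟩ := exists_isRefinement hf (subset_meetClosure f _ hrS)
    (meetClosed_meetClosure f _)
  obtain ⟨hS, -⟩ := children_of_card_meetClosure hf hrS
    (Finset.card_image_le.trans (by rw [Finset.card_univ, hι])) hcard hR hrr H
  have : (Finset.univ.image v).card = (Finset.univ : Finset ι).card := by
    rw [hS, Finset.card_univ, hι]
  exact fun x y hxy => Finset.card_image_iff.1 this (Finset.mem_coe.2 (Finset.mem_univ x))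
    (Finset.mem_coe.2 (Finset.mem_univ y)) hxy

end KernelGraph

/-! ### Counting marked trees -/

theorem mul_card_prod_subtype {α β : Type*} [Finite α] [Finite β] {P : α → Prop}
    {Q : α → β → Prop} {m c : ℕ} (h : ∀ a, P a → m * Nat.card {b // Q a b} = c) :
    m * Nat.card {x : α × β // P x.1 ∧ Q x.1 x.2} = Nat.card {a // P a} * c := by
  classical
  have := Fintype.ofFinite {a // P a}
  have e : {x : α × β // P x.1 ∧ Q x.1 x.2} ≃ Σ a : {a // P a}, {b // Q a.1 b} :=
    { toFun := fun x => ⟨⟨x.1.1, x.2.1⟩, x.1.2, x.2.2⟩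
      invFun := fun y => ⟨(y.1.1, y.2.1), y.1.2, y.2.2⟩
      left_inv := fun _ => rfl
      right_inv := fun _ => rfl }
  rw [Nat.card_congr e, Nat.card_sigma, Finset.mul_sum,
    Finset.sum_congr rfl fun a _ => h a.1 a.2, Finset.sum_const, Finset.card_univ,
    Nat.card_eq_fintype_card, smul_eq_mul]

theorem card_prod_subtype {α β : Type*} [Finite α] [Finite β] {P : α → Prop}
    {Q : α → β → Prop} {c : ℕ} (h : ∀ a, P a → Nat.card {b // Q a b} = c) :
    Nat.card {x : α × β // P x.1 ∧ Q x.1 x.2} = Nat.card {a // P a} * c := by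
  simpa using mul_card_prod_subtype (m := 1) (fun a ha => by simpa using h a ha)

section

variable {V β : Type*}

/-- A parent function `p.1` of a tree on `V` together with marks `p.2`, the first of which is the
root, such that joining the pairs of marks adds new edges and gives a series-parallel graph. -/
structure IsMarkedTree (r₀ : β × Bool) (p : (V → V) × (β × Bool → V)) : Prop where
  rooted : Rooted p.1 (p.2 r₀)
  simple : AddsSimply (treeGraph p.1) p.2
  sp : IsSeriesParallel (glue (treeGraph p.1) p.2)

/-- A kernel whose cubic multigraph is series-parallel. -/
def IsSPKernel {A : Type*} [DecidableEq A] [DecidableEq β] [Fintype A] [Fintype β]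
    (r₀ : β × Bool) (q : (A → A) × (β × Bool → A)) : Prop :=
  IsKernel q.1 q.2 r₀ ∧ IsSeriesParallel (glue (treeGraph q.1) q.2)

variable [Fintype V] [DecidableEq V] [Fintype β]

theorem mul_card_isRefinement_lift {α : Type*} [Fintype α] (e : α ↪ V) (g : α → α) (r : α) :
    Fintype.card V * Nat.card {f // IsRefinement (Finset.univ.map e)
      ((Finset.univ.map e).erase (e r)) (lift e g) f} =
    refinementSum (Fintype.card V) (Fintype.card α - 1) (Fintype.card α)
      (Fintype.card V - Fintype.card α) := by
  have hc : (Finset.univ.map e).card = Fintype.card α := by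
    rw [Finset.card_map, Finset.card_univ]
  have := card_isRefinement (V := V) (Fintype.card V - Fintype.card α) (Fintype.card α - 1)
    (Finset.univ.map e) ((Finset.univ.map e).erase (e r)) (lift e g) (Finset.erase_subset _ _)
    (fun x hx => by
      obtain ⟨c, -, rfl⟩ := Finset.mem_map.1 hx
      rw [lift_apply]
      exact Finset.mem_map_of_mem e (Finset.mem_univ _))
    (by rw [Finset.card_erase_of_mem (Finset.mem_map_of_mem e (Finset.mem_univ _)), hc])
    (by rw [hc])
  rw [hc] at this
  exact this

/-- Enumerations of a meet closure of the largest size that extend the marks. -/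
theorem card_enumerations {ι : Type*} [Fintype ι] {A : Type*} [Fintype A] [DecidableEq A]
    {v : ι → V} (hv : Function.Injective v) {W : Finset V} (hW : Finset.univ.image v ⊆ W)
    (hcard : W.card = Fintype.card A + Fintype.card ι) :
    Nat.card {e : A ⊕ ι ↪ V // (∀ i, e (Sum.inr i) = v i) ∧ Finset.univ.map e = W} =
      (Fintype.card A)! := by
  classical
  let D := {x // x ∈ W \ Finset.univ.image v}
  have hD : Fintype.card D = Fintype.card A := by
    rw [Fintype.card_coe, Finset.card_sdiff_of_subset hW, hcard,
      Finset.card_image_of_injective _ hv, Finset.card_univ, Nat.add_sub_cancel]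
  have hDv : ∀ (x : D) i, x.1 ≠ v i := fun x i h =>
    (Finset.mem_sdiff.1 x.2).2 (h ▸ Finset.mem_image_of_mem v (Finset.mem_univ i))
  let F : (A ≃ D) → {e : A ⊕ ι ↪ V // (∀ i, e (Sum.inr i) = v i) ∧ Finset.univ.map e = W} :=
    fun σ => ⟨⟨Sum.elim (fun x => (σ x).1) v,
      (Subtype.val_injective.comp σ.injective).sumElim hv fun x i => hDv (σ x) i⟩,
      fun _ => rfl, by
        refine Finset.eq_of_subset_of_card_le (fun x hx => ?_) ?_
        · obtain ⟨c, -, rfl⟩ := Finset.mem_map.1 hx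
          rcases c with x | i
          · exact (Finset.mem_sdiff.1 (σ x).2).1
          · exact hW (Finset.mem_image_of_mem v (Finset.mem_univ i))
        · rw [Finset.card_map, Finset.card_univ, Fintype.card_sum, hcard]⟩
  have hF : Function.Bijective F := by
    constructor
    · intro σ τ h
      ext x
      have := congrArg (fun e => e.1 (Sum.inl x)) h
      exact this
    · rintro ⟨e, he, heW⟩
      have hmem : ∀ x, e (Sum.inl x) ∈ W \ Finset.univ.image v := fun x => by
        refine Finset.mem_sdiff.2 ⟨heW ▸ Finset.mem_map_of_mem e (Finset.mem_univ _), fun h => ?_⟩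
        obtain ⟨i, -, hi⟩ := Finset.mem_image.1 h
        rw [← he] at hi
        cases e.injective hi
      let s : A → D := fun x => ⟨e (Sum.inl x), hmem x⟩
      have hs : Function.Bijective s := by
        rw [Fintype.bijective_iff_injective_and_card]
        exact ⟨fun x y h => Sum.inl_injective (e.injective (Subtype.ext_iff.1 h)), hD.symm⟩
      refine ⟨Equiv.ofBijective s hs, Subtype.ext (DFunLike.ext _ _ fun c => ?_)⟩
      rcases c with x | i
      · rfl
      · exact (he i).symm
  rw [← Nat.card_eq_of_bijective F hF, Nat.card_eq_fintype_card,
    Fintype.card_equiv (Fintype.equivOfCardEq hD.symm)]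

/-- Double counting of triples formed by an embedding of the kernel with its leaves, a kernel, and a
refinement. A generic marked tree determines the kernel once its 2k branch points are enumerated,
which accounts for (2k)!. -/
theorem card_generic [DecidableEq β] {A : Type*} [Fintype A] [DecidableEq A] {k : ℕ} (hk : 1 ≤ k)
    (hA : Fintype.card A = 2 * k) (hβ : Fintype.card β = k + 1) (r₀ : β × Bool) :
    Fintype.card V * (Nat.card {p : (V → V) × (β × Bool → V) // IsMarkedTree r₀ p ∧
      (meetClosure p.1 (Finset.univ.image p.2)).card = 4 * k + 2} * (2 * k)!) =
    (Fintype.card V).descFactorial (4 * k + 2) *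
      (Nat.card {q : (A → A) × (β × Bool → A) // IsSPKernel r₀ q} *
      refinementSum (Fintype.card V) (4 * k + 1) (4 * k + 2) (Fintype.card V - (4 * k + 2))) := by
  classical
  have hι : Fintype.card (β × Bool) = 2 * k + 2 := by
    rw [Fintype.card_prod, hβ, Fintype.card_bool]; ring
  have hα : Fintype.card (A ⊕ (β × Bool)) = 4 * k + 2 := by
    rw [Fintype.card_sum, hA, hι]; ring
  let P (x : ((A ⊕ (β × Bool)) ↪ V) × (((A → A) × (β × Bool → A)) × (V → V))) : Prop :=
    True ∧ (IsSPKernel r₀ x.2.1 ∧ IsRefinement (Finset.univ.map x.1)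
      ((Finset.univ.map x.1).erase (x.1 (Sum.inr r₀))) (lift x.1 (withLeaves x.2.1.1 x.2.1.2 r₀))
      x.2.2)
  let Q (y : ((V → V) × (β × Bool → V)) × ((A ⊕ (β × Bool)) ↪ V)) : Prop :=
    (IsMarkedTree r₀ y.1 ∧ (meetClosure y.1.1 (Finset.univ.image y.1.2)).card = 4 * k + 2) ∧
      ((∀ i, y.2 (Sum.inr i) = y.1.2 i) ∧
        Finset.univ.map y.2 = meetClosure y.1.1 (Finset.univ.image y.1.2))
  have hPcard : Fintype.card V * Nat.card {x // P x} =
      (Fintype.card V).descFactorial (4 * k + 2) *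
      (Nat.card {q : (A → A) × (β × Bool → A) // IsSPKernel r₀ q} *
      refinementSum (Fintype.card V) (4 * k + 1) (4 * k + 2)
        (Fintype.card V - (4 * k + 2))) := by
    refine (mul_card_prod_subtype (P := fun _ : (A ⊕ (β × Bool)) ↪ V => True)
      (Q := fun e (z : ((A → A) × (β × Bool → A)) × (V → V)) => IsSPKernel r₀ z.1 ∧
      IsRefinement (Finset.univ.map e)
      ((Finset.univ.map e).erase (e (Sum.inr r₀))) (lift e (withLeaves z.1.1 z.1.2 r₀))
      z.2) (c := Nat.card {q : (A → A) × (β × Bool → A) // IsSPKernel r₀ q} *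
      refinementSum (Fintype.card V) (4 * k + 1) (4 * k + 2) (Fintype.card V - (4 * k + 2)))
      ?_).trans ?_
    rotate_left
    · congr 1
      rw [Nat.card_congr (Equiv.subtypeUnivEquiv fun _ => trivial), Nat.card_eq_fintype_card,
        Fintype.card_embedding_eq, hα]
    · intro e _
      refine mul_card_prod_subtype (P := fun q : (A → A) × (β × Bool → A) => IsSPKernel r₀ q)
        (Q := fun q f => IsRefinement (Finset.univ.map e)
          ((Finset.univ.map e).erase (e (Sum.inr r₀))) (lift e (withLeaves q.1 q.2 r₀)) f)
        fun q _ => ?_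
      have := mul_card_isRefinement_lift e (withLeaves q.1 q.2 r₀) (Sum.inr r₀)
      rw [hα] at this
      exact this
  have hQcard : Nat.card {y // Q y} = Nat.card {p : (V → V) × (β × Bool → V) //
      IsMarkedTree r₀ p ∧ (meetClosure p.1 (Finset.univ.image p.2)).card = 4 * k + 2} *
        (2 * k)! := by
    refine card_prod_subtype (P := fun p : (V → V) × (β × Bool → V) => IsMarkedTree r₀ p ∧
      (meetClosure p.1 (Finset.univ.image p.2)).card = 4 * k + 2)
      (Q := fun p (e : (A ⊕ (β × Bool)) ↪ V) => (∀ i, e (Sum.inr i) = p.2 i) ∧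
        Finset.univ.map e = meetClosure p.1 (Finset.univ.image p.2)) ?_
    rintro p ⟨hp, hcard⟩
    rw [← hA]
    exact card_enumerations (injective_of_card_meetClosure hp.rooted hι hcard)
      (subset_meetClosure _ _) (by rw [hcard, hA, hι]; ring)
  rw [← hQcard, ← hPcard]
  congr 1
  symm
  have hto : ∀ x, P x → Q ((x.2.2, fun i => x.1 (Sum.inr i)), x.1) := by
    rintro ⟨e, ⟨h, a⟩, f⟩ ⟨-, ⟨hK, hsp⟩, H⟩
    have hcl := meetClosure_eq_of_isRefinement_lift hK H
    refine ⟨⟨⟨rooted_of_isRefinement_lift (rooted_withLeaves hK.rooted) H,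
      addsSimply_of_isRefinement_lift H, ?_⟩, ?_⟩, fun _ => rfl, hcl.symm⟩
    · exact (isSeriesParallel_iff_of_isRefinement_lift hK.rooted H).2 hsp
    · dsimp only at hcl ⊢
      rw [hcl, Finset.card_map, Finset.card_univ, hα]
  refine Nat.card_eq_of_bijective (fun x : {x // P x} => (⟨_, hto x.1 x.2⟩ : {y // Q y})) ⟨?_, ?_⟩
  · rintro ⟨⟨e, ⟨h, a⟩, f⟩, ht, ⟨hK, hsp⟩, H⟩ ⟨⟨e', ⟨h', a'⟩, f'⟩, ht', ⟨hK', hsp'⟩, H'⟩ heq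
    have h1 := congrArg (fun y => y.1.2) heq
    have h2 := congrArg (fun y => y.1.1.1) heq
    dsimp only at h1 h2
    subst h1 h2
    obtain ⟨h3, h4⟩ := isRefinement_lift_unique hK.rooted hK'.rooted H H'
    dsimp only at h3 h4
    subst h3 h4
    rfl
  · rintro ⟨⟨⟨f, v⟩, e⟩, ⟨hp, hcard⟩, hev, heW⟩
    obtain ⟨h, a, hK, H⟩ := exists_isKernel hp.rooted hk hι hcard e hev heW
    have hv : v = fun i => e (Sum.inr i) := funext fun i => (hev i).symm
    have hsp : IsSeriesParallel (glue (treeGraph h) a) := by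
      have := hp.sp
      dsimp only at this
      rw [hv] at this
      exact (isSeriesParallel_iff_of_isRefinement_lift hK.rooted H).1 this
    refine ⟨⟨(e, (h, a), f), trivial, ⟨hK, hsp⟩, H⟩, ?_⟩
    subst hv
    rfl

/-- There are at most 2k + 1 marks besides the root, each contributing at most two points. -/
theorem card_meetClosure_le {k : ℕ} (hβ : Fintype.card β = k + 1)
    {f : V → V} {v : β × Bool → V} {r₀ : β × Bool} (hf : Rooted f (v r₀)) :
    (meetClosure f (Finset.univ.image v)).card ≤ 4 * k + 2 := by
  obtain ⟨W, hW, hmc, hcard⟩ := exists_meetClosed hf ((Finset.univ.image v).erase (v r₀))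
  have hmem : v r₀ ∈ Finset.univ.image v := Finset.mem_image_of_mem v (Finset.mem_univ _)
  rw [Finset.insert_erase hmem] at hW
  refine (Finset.card_le_card (meetClosure_subset hW hmc)).trans ?_
  have h1 : (Finset.univ.image v).card ≤ 2 * k + 2 := Finset.card_image_le.trans (by
    rw [Finset.card_univ, Fintype.card_prod, hβ, Fintype.card_bool]; omega)
  rw [Finset.card_erase_of_mem hmem] at hcard
  rcases hcard with h | rfl
  · omega
  · simp

/-- A crude bound suffices: the reduced tree is replaced by an arbitrary self-map of `Fin w` and the
marks by arbitrary positions in it. The number of such shapes does not depend on the number of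
vertices. -/
theorem card_nongeneric_le (r₀ : β × Bool) (w : ℕ) :
    Fintype.card V * Nat.card {p : (V → V) × (β × Bool → V) // IsMarkedTree r₀ p ∧
      (meetClosure p.1 (Finset.univ.image p.2)).card = w} ≤
    (Fintype.card V).descFactorial w * (w ^ w * w ^ Fintype.card (β × Bool)) *
      refinementSum (Fintype.card V) (w - 1) w (Fintype.card V - w) := by
  classical
  let P (x : ((Fin w ↪ V) × (Fin w → Fin w) × (β × Bool → Fin w)) × (V → V)) : Prop :=
    True ∧ IsRefinement (Finset.univ.map x.1.1)
      ((Finset.univ.map x.1.1).erase (x.1.1 (x.1.2.2 r₀))) (lift x.1.1 x.1.2.1) x.2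
  have hPcard : Fintype.card V * Nat.card {x // P x} =
      (Fintype.card V).descFactorial w * (w ^ w * w ^ Fintype.card (β × Bool)) *
      refinementSum (Fintype.card V) (w - 1) w (Fintype.card V - w) := by
    refine (mul_card_prod_subtype (P := fun _ => True)
      (Q := fun (z : (Fin w ↪ V) × (Fin w → Fin w) × (β × Bool → Fin w)) f =>
        IsRefinement (Finset.univ.map z.1)
      ((Finset.univ.map z.1).erase (z.1 (z.2.2 r₀))) (lift z.1 z.2.1) f)
      (c := refinementSum (Fintype.card V) (w - 1) w (Fintype.card V - w)) ?_).trans ?_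
    rotate_left
    · congr 1
      rw [Nat.card_congr (Equiv.subtypeUnivEquiv fun _ => trivial), Nat.card_eq_fintype_card,
        Fintype.card_prod, Fintype.card_prod, Fintype.card_embedding_eq, Fintype.card_fun,
        Fintype.card_fun, Fintype.card_fin]
    · rintro z -
      simpa using mul_card_isRefinement_lift z.1 z.2.1 (z.2.2 r₀)
  rw [← hPcard]
  refine Nat.mul_le_mul_left _ ?_
  have hex : ∀ p : {p : (V → V) × (β × Bool → V) // IsMarkedTree r₀ p ∧
      (meetClosure p.1 (Finset.univ.image p.2)).card = w},
      ∃ x : {x // P x}, (x.1.2, fun i => x.1.1.1 (x.1.1.2.2 i)) = p.1 := by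
    rintro ⟨⟨f, v⟩, hp, hcard⟩
    change ∃ x : {x // P x}, _ = (f, v)
    have hS := subset_meetClosure f (Finset.univ.image v)
    have hmc := meetClosed_meetClosure f (Finset.univ.image v)
    dsimp only at hcard
    have hvmem : ∀ i, v i ∈ meetClosure f (Finset.univ.image v) := fun i =>
      hS (Finset.mem_image_of_mem v (Finset.mem_univ i))
    obtain ⟨h, hR, hrr, H⟩ := exists_isRefinement hp.rooted (hvmem r₀) hmc
    dsimp only at H hrr
    generalize meetClosure f (Finset.univ.image v) = W at *
    let e₀ : Fin w ≃ W := (finCongr hcard.symm).trans W.equivFin.symm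
    let e : Fin w ↪ V := e₀.toEmbedding.trans (Function.Embedding.subtype _)
    have heW : Finset.univ.map e = W := by
      ext x
      simp only [Finset.mem_map, Finset.mem_univ, true_and]
      constructor
      · rintro ⟨c, rfl⟩
        exact (e₀ c).2
      · intro hx
        exact ⟨e₀.symm ⟨x, hx⟩, by simp [e]⟩
    have hsurj : ∀ (x : V) (hx : x ∈ W), e (e₀.symm ⟨x, hx⟩) = x := by
      intro x hx
      simp [e]
    have hmemW : ∀ c, e c ∈ W := fun c => (e₀ c).2
    let g : Fin w → Fin w := fun c => e₀.symm ⟨h (e c), hR _ (hmemW c)⟩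
    let u : β × Bool → Fin w := fun i => e₀.symm ⟨v i, hvmem i⟩
    have hu : ∀ i, e (u i) = v i := fun i => hsurj _ _
    refine ⟨⟨((e, g, u), f), trivial, ?_⟩, ?_⟩
    · dsimp only
      rw [heW, hu]
      refine H.congr (Finset.erase_subset _ _) fun x hx => ?_
      rw [← heW] at hx
      obtain ⟨c, -, rfl⟩ := Finset.mem_map.1 hx
      rw [lift_apply]
      exact (hsurj _ _).symm
    · simp [hu]
  choose F hF using hex
  refine Nat.card_le_card_of_injective F fun p p' h => Subtype.ext ?_
  rw [← hF p, ← hF p', h]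

/-- All marked trees, split according to the size of the meet closure. -/
theorem card_isMarkedTree {k : ℕ} (hβ : Fintype.card β = k + 1) (r₀ : β × Bool) :
    Nat.card {p : (V → V) × (β × Bool → V) // IsMarkedTree r₀ p} =
    ∑ w ∈ Finset.range (4 * k + 3), Nat.card {p : (V → V) × (β × Bool → V) // IsMarkedTree r₀ p ∧
      (meetClosure p.1 (Finset.univ.image p.2)).card = w} := by
  classical
  have h1 : ∀ Q : (V → V) × (β × Bool → V) → Prop,
      Nat.card {p // Q p} = (Finset.univ.filter Q).card := fun Q => by
    rw [Nat.card_eq_fintype_card, Fintype.card_subtype]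
  simp only [h1]
  rw [Finset.card_eq_sum_card_fiberwise (t := Finset.range (4 * k + 3))
    (f := fun p => (meetClosure p.1 (Finset.univ.image p.2)).card)]
  · simp only [Finset.filter_filter]
    convert rfl
  · intro p hp
    have := card_meetClosure_le hβ (Finset.mem_filter.1 hp).2.rooted
    exact Finset.mem_coe.2 (Finset.mem_range.2 (Nat.lt_succ_of_le this))

end

/-! ### Counting pairings with prescribed multiplicities -/

section Pairings

variable {β : Type*} [Fintype β]

/-- The multinomial coefficient by double counting: a bijection from β to Σ e, `Fin (m e)`
determines w, and the bijections over a given w form a torsor under the stabilizer of w. -/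
theorem card_functions_with_fibers {E : Type*} [Fintype E] [DecidableEq E] (m : E → ℕ)
    (hm : ∑ e, m e = Fintype.card β) :
    Nat.card {w : β → E // ∀ e, (Finset.univ.filter fun b => w b = e).card = m e} *
      ∏ e, (m e)! = (Fintype.card β)! := by
  classical
  have hN : Nat.card (β ≃ Σ e, Fin (m e)) = (Fintype.card β)! := by
    have e0 : β ≃ Σ e, Fin (m e) := Fintype.equivOfCardEq (by simp [hm])
    rw [Nat.card_eq_fintype_card, Fintype.card_equiv e0]
  have h1 := card_prod_subtype (α := β → E) (β := β ≃ Σ e, Fin (m e))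
    (P := fun w => ∀ e, (Finset.univ.filter fun b => w b = e).card = m e)
    (Q := fun w σ => ∀ b, (σ b).1 = w b) (c := ∏ e, (m e)!) (by
      intro w hw
      have hfib : ∀ e, Fintype.card {b // w b = e} = m e := fun e => by
        rw [Fintype.card_subtype, hw]
      let σ₀ : β ≃ Σ e, Fin (m e) := (Equiv.sigmaFiberEquiv w).symm.trans
        (Equiv.sigmaCongrRight fun e => Fintype.equivFinOfCardEq (hfib e))
      have hσ₀ : ∀ b, (σ₀ b).1 = w b := fun b => rfl
      have e1 : {σ : β ≃ Σ e, Fin (m e) // ∀ b, (σ b).1 = w b} ≃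
          {g : Equiv.Perm β // w ∘ g = w} :=
        { toFun := fun σ => ⟨σ.1.trans σ₀.symm, funext fun b => by
            simp only [Function.comp, Equiv.trans_apply]
            rw [← hσ₀, Equiv.apply_symm_apply, σ.2]⟩
          invFun := fun g => ⟨g.1.trans σ₀, fun b => by
            rw [Equiv.trans_apply, hσ₀]
            exact congrFun g.2 b⟩
          left_inv := fun σ => Subtype.ext (Equiv.ext fun b => by simp)
          right_inv := fun g => Subtype.ext (Equiv.ext fun b => by simp) }
      rw [Nat.card_congr e1, Nat.card_eq_fintype_card, DomMulAct.stabilizer_card]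
      exact Finset.prod_congr rfl fun e _ => by rw [hfib])
  rw [← h1, ← hN]
  refine Nat.card_eq_of_bijective (fun x => x.1.2) ⟨?_, ?_⟩
  · rintro ⟨⟨w, σ⟩, hw, h⟩ ⟨⟨w', σ'⟩, hw', h'⟩ heq
    dsimp only at heq h h'
    subst heq
    have : w = w' := funext fun b => (h b).symm.trans (h' b)
    subst this
    rfl
  · intro σ
    refine ⟨⟨(fun b => (σ b).1, σ), fun e => ?_, fun b => rfl⟩, rfl⟩
    rw [← Fintype.card_subtype, ← Fintype.card_fin (m e)]
    refine Fintype.card_congr ((σ.subtypeEquiv (q := fun x => x.1 = e) fun b => Iff.rfl).trans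
      (Equiv.sigmaSubtype e))

variable {V : Type*} [Fintype V] [DecidableEq V]

theorem card_orientations (w : β → Sym2 V) :
    Nat.card {v : β × Bool → V // ∀ b, s(v (b, false), v (b, true)) = w b} =
      2 ^ (Finset.univ.filter fun b => ¬ (w b).IsDiag).card := by
  classical
  have e1 : {v : β × Bool → V // ∀ b, s(v (b, false), v (b, true)) = w b} ≃
      ((b : β) → {p : V × V // s(p.1, p.2) = w b}) :=
    { toFun := fun v b => ⟨(v.1 (b, false), v.1 (b, true)), v.2 b⟩
      invFun := fun p => ⟨fun i => if i.2 then (p i.1).1.2 else (p i.1).1.1, fun b => by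
        simpa using (p b).2⟩
      left_inv := fun v => Subtype.ext (funext fun ⟨b, c⟩ => by cases c <;> rfl)
      right_inv := fun p => funext fun b => Subtype.ext (by simp) }
  have hc : ∀ e : Sym2 V, Fintype.card {p : V × V // s(p.1, p.2) = e} =
      if e.IsDiag then 1 else 2 := by
    intro e
    induction e with
    | _ x y =>
      rw [Fintype.card_subtype]
      have : (Finset.univ.filter fun p : V × V => s(p.1, p.2) = s(x, y)) = {(x, y), (y, x)} := by
        ext ⟨p, q⟩
        simp
      rw [this]
      simp only [Sym2.mk_isDiag_iff]
      split_ifs with h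
      · subst h; simp
      · rw [Finset.card_pair]
        intro h'
        exact h (Prod.ext_iff.1 h').1
  rw [Nat.card_congr e1, Nat.card_eq_fintype_card, Fintype.card_pi]
  simp only [hc]
  rw [Finset.prod_ite, Finset.prod_const_one, one_mul, Finset.prod_const]

/-- The number of indices `b` for which `v` joins the ends of `e`. -/
def pairCount (v : β × Bool → V) (e : Sym2 V) : ℕ :=
  (Finset.univ.filter fun b => s(v (b, false), v (b, true)) = e).card

/-- Multinomial choice of the labels, then two orientations for each non-loop. A loop has only one,
whence the factor 1/2 per loop in the weight. -/
theorem card_pairCount_eq (m : Sym2 V → ℕ) (hm : ∑ e, m e = Fintype.card β) :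
    Nat.card {v : β × Bool → V // ∀ e, pairCount v e = m e} * ∏ e, (m e)! =
      (Fintype.card β)! * 2 ^ ∑ e ∈ Finset.univ.filter (fun e => ¬ e.IsDiag), m e := by
  classical
  rw [← card_functions_with_fibers m hm, mul_right_comm]
  congr 1
  rw [← card_prod_subtype (Q := fun (w : β → Sym2 V) (v : β × Bool → V) =>
    ∀ b, s(v (b, false), v (b, true)) = w b)]
  · symm
    refine Nat.card_eq_of_bijective (fun x => ⟨x.1.2, fun e => ?_⟩) ⟨?_, ?_⟩
    · have h1 := x.2.1 e
      rw [← h1]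
      unfold pairCount
      congr 1
      exact Finset.filter_congr fun b _ => by rw [x.2.2 b]
    · rintro ⟨⟨w, v⟩, hw, h⟩ ⟨⟨w', v'⟩, hw', h'⟩ heq
      have heq' := Subtype.ext_iff.1 heq
      dsimp only at heq' h h'
      subst heq'
      have : w = w' := funext fun b => (h b).symm.trans (h' b)
      subst this
      rfl
    · rintro ⟨v, hv⟩
      exact ⟨⟨(fun b => s(v (b, false), v (b, true)), v), hv, fun b => rfl⟩, rfl⟩
  · intro w hw
    rw [card_orientations]
    congr 1
    rw [Finset.card_eq_sum_card_fiberwise (f := w)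
      (t := Finset.univ.filter fun e => ¬ e.IsDiag) (fun b hb => by simpa using hb)]
    refine Finset.sum_congr rfl fun e he => ?_
    rw [← hw e, Finset.filter_filter]
    congr 1
    refine Finset.filter_congr fun b _ => ?_
    constructor
    · exact fun h => h.2
    · rintro rfl
      exact ⟨(Finset.mem_filter.1 he).2, rfl⟩

end Pairings

/-! ### Summation over the edges of a rooted tree. -/

section TreeEdges

variable {V : Type*} [Fintype V] [DecidableEq V]

theorem edgeSet_treeGraph {f : V → V} {r : V} (hf : Rooted f r) (e : Sym2 V) :
    e ∈ (treeGraph f).edgeSet ↔ e ∈ (Finset.univ.erase r).image fun x => s(x, f x) := by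
  simp only [Finset.mem_image, Finset.mem_erase, Finset.mem_univ, and_true]
  induction e with
  | _ x y =>
    rw [SimpleGraph.mem_edgeSet]
    constructor
    · rintro ⟨hne, h | h⟩
      · refine ⟨x, ?_, by rw [h]⟩
        rintro rfl
        exact hne (hf.1.symm.trans h)
      · refine ⟨y, ?_, by rw [h, Sym2.eq_swap]⟩
        rintro rfl
        exact hne (h.symm.trans hf.1)
    · rintro ⟨z, hz, h⟩
      have hne : z ≠ f z := fun h' => hz (hf.eq_root h'.symm)
      rcases Sym2.eq_iff.1 h with ⟨rfl, rfl⟩ | ⟨rfl, rfl⟩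
      · exact ⟨hne, Or.inl rfl⟩
      · exact ⟨hne.symm, Or.inr rfl⟩

theorem Rooted.edge_injOn {f : V → V} {r : V} (hf : Rooted f r) :
    Set.InjOn (fun x => s(x, f x)) (Finset.univ.erase r : Finset V) := by
  intro x hx y hy hxy
  have hxr : x ≠ r := Finset.ne_of_mem_erase (Finset.mem_coe.1 hx)
  rcases Sym2.eq_iff.1 hxy with ⟨h, -⟩ | ⟨h1, h2⟩
  · exact h
  · exfalso
    obtain ⟨i, hi⟩ := hf.2 x
    have : ∀ i, f^[i] x = x ∨ f^[i] x = y := by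
      intro i
      induction i with
      | zero => exact Or.inl rfl
      | succ i ih =>
        rw [Function.iterate_succ_apply']
        rcases ih with h | h
        · exact Or.inr (by rw [h, h2])
        · exact Or.inl (by rw [h, h1])
    rcases this i with h | h
    · exact hxr (h.symm.trans hi)
    · exact Finset.ne_of_mem_erase (Finset.mem_coe.1 hy) (h.symm.trans hi)

open Classical in
theorem sum_edges_treeGraph {f : V → V} {r : V} (hf : Rooted f r) (F : Sym2 V → ℕ) :
    ∑ e, (if e ∈ (treeGraph f).edgeSet then F e else 0) =
      ∑ x ∈ Finset.univ.erase r, F s(x, f x) := by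
  simp only [edgeSet_treeGraph hf]
  rw [Finset.sum_ite_mem, Finset.univ_inter, Finset.sum_image hf.edge_injOn]

open Classical in
theorem sum_edges_isTree {T : SimpleGraph V} (hT : T.IsTree) :
    ∑ e, (if e ∈ T.edgeSet then 1 else 0) + 1 = Fintype.card V := by
  obtain ⟨r⟩ := hT.connected.nonempty
  obtain ⟨f, hf, rfl⟩ := exists_rooted hT r
  rw [sum_edges_treeGraph hf fun _ => 1, Finset.sum_const, Finset.card_erase_of_mem
    (Finset.mem_univ r), Finset.card_univ]
  have := Fintype.card_pos_iff.2 ⟨r⟩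
  simp only [smul_eq_mul]
  omega

end TreeEdges

/-! ### Series-parallel graphs with a spanning tree as marked trees. -/

section SimplePairs

variable {V β : Type*} [DecidableEq V] [Fintype β]

theorem sum_pairCount [Fintype V] (v : β × Bool → V) (F : Sym2 V → ℕ) :
    ∑ e, pairCount v e * F e = ∑ b, F s(v (b, false), v (b, true)) := by
  simp only [pairCount, Finset.card_filter, Finset.sum_mul]
  rw [Finset.sum_comm]
  refine Finset.sum_congr rfl fun b _ => ?_
  simp

theorem pairCount_pos_iff {v : β × Bool → V} {e : Sym2 V} :
    0 < pairCount v e ↔ ∃ b, s(v (b, false), v (b, true)) = e := by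
  rw [pairCount, Finset.card_pos]
  exact ⟨fun ⟨b, hb⟩ => ⟨b, (Finset.mem_filter.1 hb).2⟩,
    fun ⟨b, hb⟩ => ⟨b, Finset.mem_filter.2 ⟨Finset.mem_univ _, hb⟩⟩⟩

open Classical in
theorem addsSimply_iff_pairCount {G T : SimpleGraph V} {v : β × Bool → V} :
    (AddsSimply T v ∧ glue T v = G) ↔
      (T ≤ G ∧ ∀ e, pairCount v e = if e ∈ G.edgeSet ∧ e ∉ T.edgeSet then 1 else 0) := by
  constructor
  · rintro ⟨h, rfl⟩
    refine ⟨fun x y hxy => Or.inl hxy, fun e => ?_⟩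
    split_ifs with he
    · obtain ⟨he1, he2⟩ := he
      refine le_antisymm ?_ ?_
      · refine Finset.card_le_one.2 fun b hb b' hb' => h.inj ?_
        exact (Finset.mem_filter.1 hb).2.trans (Finset.mem_filter.1 hb').2.symm
      · refine pairCount_pos_iff.2 ?_
        induction e with
        | _ x y => exact ((SimpleGraph.mem_edgeSet _).1 he1).resolve_left he2 |>.2
    · by_contra hne
      obtain ⟨b, rfl⟩ := pairCount_pos_iff.1 (Nat.pos_of_ne_zero hne)
      exact he ⟨Or.inr ⟨h.ne b, b, rfl⟩, h.not_adj b⟩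
  · rintro ⟨hle, h⟩
    have hb : ∀ b, s(v (b, false), v (b, true)) ∈ G.edgeSet ∧
        s(v (b, false), v (b, true)) ∉ T.edgeSet := by
      intro b
      by_contra hne
      have h0 := h s(v (b, false), v (b, true))
      rw [if_neg hne] at h0
      have := (pairCount_pos_iff (v := v)).2 ⟨b, rfl⟩
      omega
    refine ⟨⟨fun b b' hbb => ?_, fun b => (hb b).1.ne, fun b => (hb b).2⟩, ?_⟩
    · have h1 := h s(v (b, false), v (b, true))
      rw [if_pos (hb b)] at h1
      exact Finset.card_le_one.1 h1.le b (Finset.mem_filter.2 ⟨Finset.mem_univ _, rfl⟩) b'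
        (Finset.mem_filter.2 ⟨Finset.mem_univ _, hbb.symm⟩)
    · ext x y
      constructor
      · rintro (h' | ⟨-, b, h'⟩)
        · exact hle h'
        · rw [← SimpleGraph.mem_edgeSet, ← h']
          exact (hb b).1
      · intro hxy
        by_cases hT : T.Adj x y
        · exact Or.inl hT
        · refine Or.inr ⟨hxy.ne, pairCount_pos_iff.1 ?_⟩
          rw [h, if_pos ⟨hxy, hT⟩]
          exact one_pos

theorem card_simple_pairs [Fintype V] {G T : SimpleGraph V} {k : ℕ} (hβ : Fintype.card β = k + 1)
    (hT : T.IsTree) (hle : T ≤ G)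
    (hG : (G.edgeSet.ncard : ℤ) - (Fintype.card V : ℤ) = (k : ℤ)) :
    Nat.card {v : β × Bool → V // AddsSimply T v ∧ glue T v = G} =
      (k + 1)! * 2 ^ (k + 1) := by
  classical
  have hcard : (Finset.univ.filter fun e => e ∈ G.edgeSet ∧ e ∉ T.edgeSet).card = k + 1 := by
    have h1 := sum_edges_isTree hT
    rw [← Finset.card_filter] at h1
    have h2 : G.edgeSet.ncard = (Finset.univ.filter fun e => e ∈ G.edgeSet).card := by
      rw [← Set.ncard_coe_finset]
      congr 1
      ext e
      simp
    have h3 : Finset.univ.filter (fun e => e ∈ G.edgeSet ∧ e ∉ T.edgeSet) =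
        Finset.univ.filter (fun e => e ∈ G.edgeSet) \
          Finset.univ.filter (fun e => e ∈ T.edgeSet) := by
      ext e
      simp
    have h4 : Finset.univ.filter (fun e => e ∈ T.edgeSet) ⊆
        Finset.univ.filter (fun e => e ∈ G.edgeSet) := fun e he =>
      Finset.mem_filter.2 ⟨Finset.mem_univ _, SimpleGraph.edgeSet_mono hle (Finset.mem_filter.1 he).2⟩
    rw [h3, Finset.card_sdiff_of_subset h4]
    omega
  have h := card_pairCount_eq (β := β) (V := V)
    (fun e => if e ∈ G.edgeSet ∧ e ∉ T.edgeSet then 1 else 0)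
    (by rw [← Finset.card_filter, hcard, hβ])
  have hprod : ∏ e, (if e ∈ G.edgeSet ∧ e ∉ T.edgeSet then 1 else 0 : ℕ)! = 1 :=
    Finset.prod_eq_one fun e _ => by split_ifs <;> rfl
  have hsum : ∑ e ∈ Finset.univ.filter (fun e : Sym2 V => ¬ e.IsDiag),
      (if e ∈ G.edgeSet ∧ e ∉ T.edgeSet then 1 else 0) = k + 1 := by
    rw [← hcard, Finset.card_filter, Finset.sum_filter]
    refine Finset.sum_congr rfl fun e _ => ?_
    by_cases he : e ∈ G.edgeSet ∧ e ∉ T.edgeSet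
    · rw [if_pos he, if_pos (G.not_isDiag_of_mem_edgeSet he.1)]
    · rw [if_neg he, ite_self]
  rw [hprod, mul_one, hsum, hβ] at h
  rw [← h]
  refine Nat.card_congr (Equiv.subtypeEquivRight fun v => ?_)
  rw [addsSimply_iff_pairCount]
  exact and_iff_right hle

/-- The k + 1 non-tree edges are distinct and not loops, so all labellings and orientations count.
The root is a mark, hence tree and marks determine the parent function. -/
theorem numSPWithTree_eq [DecidableEq β] {k n : ℕ} (hβ : Fintype.card β = k + 1)
    (r₀ : β × Bool) :
    Nat.card {p : (Fin n → Fin n) × (β × Bool → Fin n) // IsMarkedTree r₀ p} =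
      numSPWithTree k n * ((k + 1)! * 2 ^ (k + 1)) := by
  classical
  unfold numSPWithTree
  rw [← card_prod_subtype (β := β × Bool → Fin n)
    (Q := fun (p : SimpleGraph (Fin n) × SimpleGraph (Fin n)) v =>
      AddsSimply p.2 v ∧ glue p.2 v = p.1)]
  swap
  · rintro ⟨G, T⟩ ⟨-, -, h3, h4, h5⟩
    exact card_simple_pairs hβ h5 h4 (by simpa using h3)
  refine Nat.card_eq_of_bijective (fun p => ⟨((glue (treeGraph p.1.1) p.1.2, treeGraph p.1.1),
    p.1.2), ⟨?_, p.2.sp, ?_, ?_, p.2.rooted.isTree⟩, p.2.simple, rfl⟩) ⟨?_, ?_⟩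
  · exact p.2.rooted.isTree.connected.mono fun x y h => Or.inl h
  · have hT := sum_edges_isTree p.2.rooted.isTree
    obtain ⟨hle, hc⟩ := addsSimply_iff_pairCount.1 ⟨p.2.simple, rfl⟩
    have hs := sum_pairCount p.1.2 fun _ => 1
    simp only [mul_one, Finset.sum_const, Finset.card_univ, hβ, smul_eq_mul] at hs
    have h2 : (glue (treeGraph p.1.1) p.1.2).edgeSet.ncard =
        (Finset.univ.filter fun e => e ∈ (glue (treeGraph p.1.1) p.1.2).edgeSet).card := by
      rw [← Set.ncard_coe_finset]
      congr 1
      ext e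
      simp
    dsimp only
    have h3 : (glue (treeGraph p.1.1) p.1.2).edgeSet.ncard =
        (∑ e, if e ∈ (treeGraph p.1.1).edgeSet then 1 else 0) + ∑ e, pairCount p.1.2 e := by
      rw [h2, Finset.card_filter, ← Finset.sum_add_distrib]
      refine Finset.sum_congr rfl fun e _ => ?_
      rw [hc e]
      by_cases he : e ∈ (treeGraph p.1.1).edgeSet
      · simp [he, SimpleGraph.edgeSet_mono hle he]
      · simp [he]
    rw [h3, hs]
    rw [Fintype.card_fin] at hT
    omega
  · exact fun x y h => Or.inl h
  · rintro ⟨⟨f, v⟩, hp⟩ ⟨⟨f', v'⟩, hp'⟩ heq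
    have h1 := congrArg (fun y => y.1.2) heq
    have h2 := congrArg (fun y => y.1.1.2) heq
    dsimp only at h1 h2
    subst h1
    have := hp.rooted.eq_of_treeGraph_eq hp'.rooted h2
    dsimp only at this
    subst this
    rfl
  · rintro ⟨⟨⟨G, T⟩, v⟩, ⟨h1, h2, h3, h4, h5⟩, h6, h7⟩
    dsimp only at h1 h2 h3 h4 h5 h6 h7
    subst h7
    obtain ⟨f, hf, rfl⟩ := exists_rooted h5 (v r₀)
    exact ⟨⟨(f, v), hf, h6, h2⟩, rfl⟩

end SimplePairs

/-! ### Cubic multigraphs with a spanning tree -/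

section CubicMultigraphs

open Classical in
/-- The multigraph formed by the edges of `T` and the edges joining the pairs of marks. -/
noncomputable def gluedMultigraph {V β : Type*} [DecidableEq V] [Fintype β] (T : SimpleGraph V)
    (v : β × Bool → V) : Multigraph V :=
  ⟨fun e => (if e ∈ T.edgeSet then 1 else 0) + pairCount v e⟩

theorem toSimple_gluedMultigraph {V β : Type*} [DecidableEq V] [Fintype β] (T : SimpleGraph V)
    (v : β × Bool → V) : (gluedMultigraph T v).toSimple = glue T v := by
  ext x y
  simp only [Multigraph.toSimple, gluedMultigraph, SimpleGraph.fromEdgeSet_adj,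
    Set.mem_ofPred_eq, glue, ← pairCount_pos_iff, SimpleGraph.mem_edgeSet]
  by_cases h : T.Adj x y
  · simp [h, h.ne]
  · simp [h, and_comm]

theorem count_toMultiset_mk {V : Type*} [DecidableEq V] (x p q : V) :
    (Sym2.toMultiset s(p, q)).count x = (if p = x then 1 else 0) + if q = x then 1 else 0 := by
  change Multiset.count x {p, q} = _
  rw [Multiset.insert_eq_cons, Multiset.count_cons, Multiset.count_singleton, add_comm]
  simp only [eq_comm]

/-- A spanning tree is a simple tree with a chosen copy of each of its edges; trees using an absent
edge are excluded because `Fin 0` is empty. -/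
theorem numSpanningTrees_eq {V : Type*} (M : Multigraph V) :
    M.numSpanningTrees =
      Nat.card (Σ T : {T : SimpleGraph V // T.IsTree}, (e : T.1.edgeSet) → Fin (M.mult e)) := by
  symm
  let S : (Σ T : {T : SimpleGraph V // T.IsTree}, (e : T.1.edgeSet) → Fin (M.mult e)) →
      Set M.Edge := fun x => Set.range fun e : x.1.1.edgeSet => (⟨e.1, x.2 e⟩ : M.Edge)
  have hS : ∀ x, (fun a : M.Edge => a.1) '' S x = x.1.1.edgeSet := by
    intro x
    exact (Set.range_comp _ _).symm.trans Subtype.range_coe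
  refine Nat.card_eq_of_bijective (fun x => ⟨S x, ?_, ?_, ?_⟩) ⟨?_, ?_⟩
  · rintro _ ⟨e, rfl⟩
    exact x.1.1.not_isDiag_of_mem_edgeSet e.2
  · rintro _ ⟨e, rfl⟩ _ ⟨e', rfl⟩ h
    have : e = e' := Subtype.ext h
    rw [this]
  · rw [hS, SimpleGraph.fromEdgeSet_edgeSet]
    exact x.1.2
  · rintro ⟨⟨T, hT⟩, σ⟩ ⟨⟨T', hT'⟩, σ'⟩ heq
    have heq' : S ⟨⟨T, hT⟩, σ⟩ = S ⟨⟨T', hT'⟩, σ'⟩ := Subtype.ext_iff.1 heq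
    have hTT : T = T' := SimpleGraph.edgeSet_injective (by
      have := congrArg (fun s => (fun a : M.Edge => a.1) '' s) heq'
      rwa [hS, hS] at this)
    subst hTT
    congr 1
    funext e
    have : (⟨e.1, σ e⟩ : M.Edge) ∈ S ⟨⟨T, hT'⟩, σ'⟩ := heq' ▸ ⟨e, rfl⟩
    obtain ⟨e', he'⟩ := this
    have h1 : e' = e := Subtype.ext (congrArg Sigma.fst he')
    subst h1
    exact (eq_of_heq (Sigma.mk.inj he').2).symm
  · rintro ⟨U, h1, h2, h3⟩
    have hE : (SimpleGraph.fromEdgeSet ((fun a : M.Edge => a.1) '' U)).edgeSet =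
        (fun a : M.Edge => a.1) '' U := by
      rw [SimpleGraph.edgeSet_fromEdgeSet, sdiff_eq_left, Set.disjoint_left]
      rintro _ ⟨a, ha, rfl⟩
      exact h1 a ha
    have hex : ∀ e : (SimpleGraph.fromEdgeSet ((fun a : M.Edge => a.1) '' U)).edgeSet,
        ∃ i : Fin (M.mult e), (⟨e.1, i⟩ : M.Edge) ∈ U := by
      rintro ⟨e, he⟩
      rw [hE] at he
      obtain ⟨⟨e', i⟩, ha, rfl⟩ := he
      exact ⟨i, ha⟩
    choose σ hσ using hex
    refine ⟨⟨⟨_, h3⟩, σ⟩, Subtype.ext (Set.Subset.antisymm ?_ fun a ha => ?_)⟩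
    · rintro _ ⟨e, rfl⟩
      exact hσ e
    · have he : a.1 ∈ (SimpleGraph.fromEdgeSet ((fun a : M.Edge => a.1) '' U)).edgeSet := by
        rw [hE]; exact ⟨a, ha, rfl⟩
      exact ⟨⟨a.1, he⟩, h2 (hσ ⟨a.1, he⟩) ha rfl⟩

variable {V β : Type*} [Fintype V] [DecidableEq V] [Fintype β]

/-- Each end of a glued edge is seen as a leaf of the tree with leaves, so the degree is the number
of children plus one for the parent. The parent of the old root is the leaf `inr r₀`. Cubic
therefore means two children everywhere. -/
theorem degree_gluedMultigraph [DecidableEq β] {h : V → V} {a : β × Bool → V} {r₀ : β × Bool}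
    (hh : Rooted h (a r₀)) (x : V) :
    (gluedMultigraph (treeGraph h) a).degree x = (Finset.univ.filter fun d =>
      d ≠ Sum.inr r₀ ∧ withLeaves h a r₀ d = Sum.inl x).card + 1 := by
  classical
  have h1 : (gluedMultigraph (treeGraph h) a).degree x =
      (∑ y ∈ Finset.univ.erase (a r₀), ((if y = x then 1 else 0) + if h y = x then 1 else 0)) +
      ∑ i : β × Bool, if a i = x then 1 else 0 := by
    unfold Multigraph.degree gluedMultigraph
    simp only [add_mul, ite_mul, one_mul, zero_mul]
    rw [Finset.sum_add_distrib, sum_pairCount a (fun e => e.toMultiset.count x),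
      Fintype.sum_prod_type]
    congr 1
    · rw [← Finset.sum_congr rfl fun y _ => count_toMultiset_mk x y (h y),
        ← sum_edges_treeGraph hh fun e => e.toMultiset.count x]
    · refine Finset.sum_congr rfl fun b _ => ?_
      rw [count_toMultiset_mk, Fintype.sum_bool, add_comm]
  have h2 : (Finset.univ.filter fun d : V ⊕ (β × Bool) =>
      d ≠ Sum.inr r₀ ∧ withLeaves h a r₀ d = Sum.inl x).card =
      (∑ y ∈ Finset.univ.erase (a r₀), if h y = x then 1 else 0) +
      ∑ i ∈ Finset.univ.erase r₀, if a i = x then 1 else 0 := by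
    rw [Finset.card_filter, Fintype.sum_sum_type]
    congr 1
    · rw [← Finset.add_sum_erase _ _ (Finset.mem_univ (a r₀)), if_neg (by simp [withLeaves]),
        zero_add]
      refine Finset.sum_congr rfl fun y hy => ?_
      simp [withLeaves, Finset.ne_of_mem_erase hy]
    · rw [← Finset.add_sum_erase _ _ (Finset.mem_univ r₀), if_neg (by simp), zero_add]
      refine Finset.sum_congr rfl fun i hi => ?_
      simp [withLeaves, Finset.ne_of_mem_erase hi]
  have h3 : (∑ y ∈ Finset.univ.erase (a r₀), if y = x then 1 else 0) +
      (if a r₀ = x then 1 else 0) = 1 := by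
    rw [add_comm, Finset.add_sum_erase Finset.univ (fun y => if y = x then 1 else 0)
      (Finset.mem_univ (a r₀))]
    simp
  have h4 := Finset.add_sum_erase Finset.univ (fun i => if a i = x then 1 else 0)
    (Finset.mem_univ r₀)
  rw [h1, h2, Finset.sum_add_distrib, ← h4]
  omega

theorem isSPKernel_iff [DecidableEq β] {h : V → V} {a : β × Bool → V} {r₀ : β × Bool} :
    IsSPKernel r₀ (h, a) ↔ Rooted h (a r₀) ∧ (gluedMultigraph (treeGraph h) a).IsCubic ∧
      (gluedMultigraph (treeGraph h) a).IsSP := by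
  unfold IsSPKernel Multigraph.IsSP
  rw [toSimple_gluedMultigraph]
  constructor
  · rintro ⟨⟨h1, h2⟩, h3⟩
    exact ⟨h1, fun x => by rw [degree_gluedMultigraph h1, h2], h3⟩
  · rintro ⟨h1, h2, h3⟩
    refine ⟨⟨h1, fun x => ?_⟩, h3⟩
    change (Finset.univ.filter fun d => d ≠ Sum.inr r₀ ∧ withLeaves h a r₀ d = Sum.inl x).card = 2
    have := h2 x
    rw [degree_gluedMultigraph h1] at this
    omega

theorem excess_gluedMultigraph {k : ℕ} {T : SimpleGraph V} (hT : T.IsTree)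
    (hβ : Fintype.card β = k + 1) (v : β × Bool → V) :
    (gluedMultigraph T v).excess = k := by
  have h1 := sum_edges_isTree hT
  have h2 := sum_pairCount v fun _ => 1
  simp only [mul_one, Finset.sum_const, Finset.card_univ, hβ, smul_eq_mul] at h2
  unfold Multigraph.excess Multigraph.numEdges gluedMultigraph
  rw [Finset.sum_add_distrib, h2, ← h1]
  push_cast
  ring

theorem mult_diag_le {M : Multigraph V} (hM : M.IsCubic) (x : V) : M.mult s(x, x) ≤ 1 := by
  have h1 := hM x
  unfold Multigraph.degree at h1
  have h2 := Finset.single_le_sum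
    (f := fun e : Sym2 V => M.mult e * e.toMultiset.count x) (fun _ _ => Nat.zero_le _)
    (Finset.mem_univ s(x, x))
  rw [count_toMultiset_mk, if_pos rfl] at h2
  omega

theorem prod_factorial_mult {M : Multigraph V} (hM : M.IsCubic) :
    ∏ e, (M.mult e)! = 2 ^ M.numMultiple 2 * 6 ^ M.numMultiple 3 := by
  have : ∀ e, (M.mult e)! = (if ¬ e.IsDiag ∧ M.mult e = 2 then 2 else 1) *
      (if ¬ e.IsDiag ∧ M.mult e = 3 then 6 else 1) := by
    intro e
    by_cases he : e.IsDiag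
    · have h1 : M.mult e ≤ 1 := by
        induction e with
        | _ x y =>
          rw [Sym2.mk_isDiag_iff] at he
          subst he
          exact mult_diag_le hM x
      simp [he, Nat.factorial_eq_one.2 h1]
    · have h3 := hM.mult_le e
      interval_cases h : M.mult e <;> simp [he, Nat.factorial]
  simp only [this]
  rw [Finset.prod_mul_distrib, Finset.prod_ite, Finset.prod_ite]
  simp [Multigraph.numMultiple]

theorem numLoops_eq (M : Multigraph V) :
    M.numLoops = ∑ e ∈ Finset.univ.filter (fun e : Sym2 V => e.IsDiag), M.mult e := by
  unfold Multigraph.numLoops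
  refine Finset.sum_bij (fun x _ => s(x, x)) ?_ ?_ ?_ ?_
  · intro x _
    simp
  · intro x _ y _ h
    simpa using h
  · intro e he
    induction e with
    | _ x y =>
      have : x = y := by simpa using he
      exact ⟨x, Finset.mem_univ _, by rw [this]⟩
  · intro x _
    rfl

open Classical in
/-- The weight of a cubic multigraph in terms of the labelled and oriented pairs that complete a
given tree to it. -/
theorem card_gluedMultigraph_eq {k : ℕ} (hβ : Fintype.card β = k + 1) {M : Multigraph V}
    (hM : M.IsCubic) (hk : M.excess = k) {T : SimpleGraph V} (hT : T.IsTree) :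
    (Nat.card {v : β × Bool → V // gluedMultigraph T v = M} : ℝ) =
      (k + 1)! * 2 ^ (k + 1) * M.weight * ∏ e : T.edgeSet, (M.mult e : ℝ) := by
  by_cases hpos : ∀ e ∈ T.edgeSet, 1 ≤ M.mult e
  swap
  -- If T uses an edge absent from M, both sides vanish.
  · push Not at hpos
    obtain ⟨e, he, h0⟩ := hpos
    have h0' : M.mult e = 0 := by omega
    rw [Finset.prod_eq_zero (Finset.mem_univ (⟨e, he⟩ : T.edgeSet)) (by simp [h0']), mul_zero]
    have : IsEmpty {v : β × Bool → V // gluedMultigraph T v = M} := by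
      refine ⟨fun v => ?_⟩
      have := congrArg (fun M : Multigraph V => M.mult e) v.2
      simp only [gluedMultigraph, he, if_true, h0'] at this
      omega
    simp
  let m : Sym2 V → ℕ := fun e => M.mult e - if e ∈ T.edgeSet then 1 else 0
  have hm : ∀ e, (if e ∈ T.edgeSet then 1 else 0) + m e = M.mult e := by
    intro e
    by_cases he : e ∈ T.edgeSet
    · have := hpos e he
      simp only [m, he, if_true]
      omega
    · simp [m, he]
  have hms : ∑ e, m e = k + 1 := by
    have h1 := sum_edges_isTree hT
    have h2 : ∑ e, ((if e ∈ T.edgeSet then 1 else 0) + m e) = M.numEdges :=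
      Finset.sum_congr rfl fun e _ => hm e
    rw [Finset.sum_add_distrib] at h2
    unfold Multigraph.excess at hk
    omega
  have hcount := card_pairCount_eq (β := β) m (by rw [hms, hβ])
  have hcongr : Nat.card {v : β × Bool → V // gluedMultigraph T v = M} =
      Nat.card {v : β × Bool → V // ∀ e, pairCount v e = m e} := by
    refine Nat.card_congr (Equiv.subtypeEquivRight fun v => ?_)
    constructor
    · rintro h e
      have h1 := congrArg (fun M : Multigraph V => M.mult e) h
      have h2 := hm e
      simp only [gluedMultigraph] at h1
      omega
    · intro h
      ext e
      simp only [gluedMultigraph]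
      rw [h e, hm]
  have hloops : ∑ e ∈ Finset.univ.filter (fun e : Sym2 V => ¬ e.IsDiag), m e + M.numLoops =
      k + 1 := by
    rw [← hms, numLoops_eq, add_comm, ← Finset.sum_filter_add_sum_filter_not Finset.univ
      (fun e : Sym2 V => e.IsDiag) m]
    congr 1
    refine Finset.sum_congr rfl fun e he => ?_
    rw [← hm e, if_neg fun h => T.not_isDiag_of_mem_edgeSet h (Finset.mem_filter.1 he).2, zero_add]
  -- On a tree edge m is one less than the multiplicity, so the factor `M.mult e` completes the
  -- factorial. For cubic M the right-hand side is the part of the inverse weight coming from double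
  -- and triple edges.
  have hprod : (∏ e : T.edgeSet, M.mult e) * ∏ e, (m e)! = ∏ e, (M.mult e)! := by
    have h1 : ∏ e : T.edgeSet, M.mult e = ∏ e, if e ∈ T.edgeSet then M.mult e else 1 := by
      rw [← Finset.prod_filter]
      exact (Finset.prod_subtype _ (fun e => by simp) _).symm
    rw [h1, ← Finset.prod_mul_distrib]
    refine Finset.prod_congr rfl fun e _ => ?_
    by_cases he : e ∈ T.edgeSet
    · simp only [he, if_true, m]
      exact Nat.mul_factorial_pred (by have := hpos e he; omega)
    · simp [he, m]
  rw [hcongr]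
  rw [hβ] at hcount
  have hm0 : (∏ e, ((m e)! : ℝ)) ≠ 0 :=
    Finset.prod_ne_zero_iff.2 fun e _ => Nat.cast_ne_zero.2 (Nat.factorial_ne_zero _)
  have hcount' : (Nat.card {v : β × Bool → V // ∀ e, pairCount v e = m e} : ℝ) *
      ∏ e, ((m e)! : ℝ) =
      (k + 1)! * 2 ^ ∑ e ∈ Finset.univ.filter (fun e : Sym2 V => ¬ e.IsDiag), m e := by
    exact_mod_cast hcount
  have hprod' : (∏ e : T.edgeSet, (M.mult e : ℝ)) * ∏ e, ((m e)! : ℝ) =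
      2 ^ M.numMultiple 2 * 6 ^ M.numMultiple 3 := by
    rw [prod_factorial_mult hM] at hprod
    exact_mod_cast hprod
  refine mul_right_cancel₀ hm0 ?_
  rw [hcount', mul_assoc _ (∏ e : T.edgeSet, (M.mult e : ℝ)), hprod', Multigraph.weight,
    ← hloops, pow_add, pow_add]
  field_simp

end CubicMultigraphs

/-! ### Kernels and weighted cubic multigraphs -/

section Kernels

open Classical in
theorem numSpanningTrees_eq_sum {V : Type*} [Fintype V] (M : Multigraph V)
    [Fintype {T : SimpleGraph V // T.IsTree}] : (M.numSpanningTrees : ℝ) =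
      ∑ T : {T : SimpleGraph V // T.IsTree}, ∏ e : T.1.edgeSet, (M.mult e : ℝ) := by
  rw [numSpanningTrees_eq, Nat.card_sigma]
  simp

/-- Kernels are grouped by their multigraph M and then by their simple tree. The products of
multiplicities along the trees add up to the number of spanning trees of M. -/
theorem card_isSPKernel {V β : Type*} [Fintype V] [DecidableEq V] [Fintype β] [DecidableEq β]
    {k : ℕ} (hβ : Fintype.card β = k + 1) (r₀ : β × Bool) :
    (Nat.card {q : (V → V) × (β × Bool → V) // IsSPKernel r₀ q} : ℝ) =
      (k + 1)! * 2 ^ (k + 1) *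
        ∑ᶠ M ∈ {M : Multigraph V | M.IsCubic ∧ M.IsSP ∧ M.excess = (k : ℤ)},
          M.weight * (M.numSpanningTrees : ℝ) := by
  classical
  let good : Multigraph V → Prop := fun M => M.IsCubic ∧ M.IsSP ∧ M.excess = (k : ℤ)
  have hfin : {M | good M}.Finite :=
    Multigraph.finite_setOf_isCubic.subset fun M hM => hM.1
  have : Finite {M // good M} := hfin.to_subtype
  let _ := Fintype.ofFinite {M // good M}
  let _ := Fintype.ofFinite {T : SimpleGraph V // T.IsTree}
  have h1 : Nat.card {q : (V → V) × (β × Bool → V) // IsSPKernel r₀ q} =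
      Nat.card {x : {T : SimpleGraph V // T.IsTree} × (β × Bool → V) //
        good (gluedMultigraph x.1.1 x.2)} := by
    refine Nat.card_eq_of_bijective (fun q => ⟨(⟨treeGraph q.1.1, ?_⟩, q.1.2), ?_⟩) ⟨?_, ?_⟩
    · exact (isSPKernel_iff.1 q.2).1.isTree
    · have h := isSPKernel_iff.1 q.2
      exact ⟨h.2.1, h.2.2, excess_gluedMultigraph h.1.isTree hβ _⟩
    · rintro ⟨⟨h, a⟩, hq⟩ ⟨⟨h', a'⟩, hq'⟩ heq
      simp only [Subtype.mk.injEq, Prod.mk.injEq] at heq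
      obtain ⟨h1, rfl⟩ := heq
      have := (isSPKernel_iff.1 hq).1.eq_of_treeGraph_eq (isSPKernel_iff.1 hq').1 h1
      simp [this]
    · rintro ⟨⟨⟨T, hT⟩, a⟩, hg⟩
      obtain ⟨h, hh, rfl⟩ := exists_rooted hT (a r₀)
      exact ⟨⟨(h, a), isSPKernel_iff.2 ⟨hh, hg.1, hg.2.1⟩⟩, rfl⟩
  have h2 : {x : {T : SimpleGraph V // T.IsTree} × (β × Bool → V) //
      good (gluedMultigraph x.1.1 x.2)} ≃
      (Σ M : {M // good M}, Σ T : {T : SimpleGraph V // T.IsTree},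
        {a : β × Bool → V // gluedMultigraph T.1 a = M.1}) :=
    { toFun := fun x => ⟨⟨_, x.2⟩, x.1.1, x.1.2, rfl⟩
      invFun := fun y => ⟨(y.2.1, y.2.2.1), by
        change good (gluedMultigraph y.2.1.1 y.2.2.1)
        rw [y.2.2.2]; exact y.1.2⟩
      left_inv := fun x => rfl
      right_inv := by
        rintro ⟨⟨M, hM⟩, T, ⟨a, h⟩⟩
        change gluedMultigraph T.1 a = M at h
        subst h
        rfl }
  have h3 : ∑ᶠ M ∈ {M : Multigraph V | M.IsCubic ∧ M.IsSP ∧ M.excess = (k : ℤ)},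
      M.weight * (M.numSpanningTrees : ℝ) =
      ∑ M : {M // good M}, M.1.weight * (M.1.numSpanningTrees : ℝ) :=
    (finsum_set_coe_eq_finsum_mem {M : Multigraph V | good M}).symm.trans
      (finsum_eq_sum_of_fintype fun M : {M // good M} => M.1.weight * (M.1.numSpanningTrees : ℝ))
  rw [h1, Nat.card_congr h2, Nat.card_sigma, h3, Nat.cast_sum, Finset.mul_sum]
  refine Finset.sum_congr rfl fun M _ => ?_
  rw [Nat.card_sigma, Nat.cast_sum, numSpanningTrees_eq_sum, Finset.mul_sum, Finset.mul_sum]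
  refine Finset.sum_congr rfl fun T _ => ?_
  rw [card_gluedMultigraph_eq hβ M.2.1 M.2.2.2 T.2, mul_assoc]

theorem gBar_eq (k : ℕ) : gBar k * ((2 * k)! * ((k + 1)! * 2 ^ (k + 1))) =
    Nat.card {q : (Fin (2 * k) → Fin (2 * k)) × (Fin (k + 1) × Bool → Fin (2 * k)) //
      IsSPKernel (0, false) q} := by
  rw [card_isSPKernel (Fintype.card_fin _), gBar]
  field_simp

end Kernels

/-! ### A kernel whose tree is a path -/

section PathKernel

/-- The witness is the path 0, 1, ..., 2k-1 with a loop at either end and with the edges {1,2},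
{3,4}, ..., {2k-3,2k-2} doubled. It is needed because equivalence to a zero main term would not
follow from the limit. -/
theorem exists_isSPKernel {k : ℕ} (hk : 1 ≤ k) :
    ∃ q : (Fin (2 * k) → Fin (2 * k)) × (Fin (k + 1) × Bool → Fin (2 * k)),
      IsSPKernel (0, false) q := by
  classical
  let h : Fin (2 * k) → Fin (2 * k) := fun x => ⟨x.1 - 1, by omega⟩
  -- Pair i joins 2i - 1 to 2i. Truncated subtraction at i = 0 and the minimum at i = k turn the two
  -- extreme pairs into loops.
  let a : Fin (k + 1) × Bool → Fin (2 * k) := fun i =>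
    if i.2 then ⟨min (2 * i.1.1) (2 * k - 1), by omega⟩ else ⟨2 * i.1.1 - 1, by omega⟩
  have ha : a (0, false) = ⟨0, by omega⟩ := by simp [a]
  have hit : ∀ (i : ℕ) (x : Fin (2 * k)), (h^[i] x).1 = x.1 - i := by
    intro i
    induction i with
    | zero => intro x; rfl
    | succ i ih =>
      intro x
      rw [Function.iterate_succ_apply, ih]
      simp only [h]
      omega
  have hroot : Rooted h (a (0, false)) := by
    rw [ha]
    exact ⟨rfl, fun x => ⟨x.1, Fin.ext (by rw [hit]; simp)⟩⟩
  refine ⟨(h, a), ⟨hroot, fun x => ?_⟩, ?_⟩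
  · rw [Finset.card_eq_two]
    refine ⟨if hx : x.1 + 1 < 2 * k then Sum.inl ⟨x.1 + 1, hx⟩ else Sum.inr (⟨k, by omega⟩, true),
      if x.1 = 0 then Sum.inr (0, true) else if x.1 % 2 = 1 then
        Sum.inr (⟨(x.1 + 1) / 2, by omega⟩, false) else Sum.inr (⟨x.1 / 2, by omega⟩, true),
      ?_, ?_⟩
    · split_ifs <;> simp <;> omega
    · ext d
      have hx2 := x.2
      rcases d with y | ⟨i, b⟩
      · have hy2 := y.2
        simp only [Finset.mem_filter, Finset.mem_univ, true_and, withLeaves, Finset.mem_insert,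
          Finset.mem_singleton, ha]
        split_ifs <;> simp [Fin.ext_iff, h] at * <;> omega
      · have hi2 := i.2
        cases b <;>
        · simp only [Finset.mem_filter, Finset.mem_univ, true_and, withLeaves, Finset.mem_insert,
            Finset.mem_singleton, a, Fin.ext_iff, Sum.inr.injEq, Prod.mk.injEq, ne_eq, and_true,
            Bool.false_eq_true, Bool.true_eq_false, and_false, Fin.val_zero, if_false, if_true]
          clear hit hroot ha
          split_ifs <;> simp only [Sum.inr.injEq, Sum.inl.injEq, Prod.mk.injEq, Fin.ext_iff,
            Bool.false_eq_true, Bool.true_eq_false, and_false, and_true,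
            Fin.val_zero, or_false, false_or, false_iff, iff_false, not_false_eq_true, true_and,
            or_self] <;> omega
  -- All pairs are loops or repeat path edges, so the glued graph is the bare path. Without marks it
  -- can be stripped down to its root.
  · have hglue : glue (treeGraph h) a = glue (treeGraph h) (fun i : Empty × Bool => i.1.elim) := by
      ext x y
      have hx2 := x.2
      have hy2 := y.2
      simp only [glue, IsEmpty.exists_iff, and_false, or_false, or_iff_left_iff_imp]
      rintro ⟨hne, i, hi⟩
      have hi2 := i.2
      rw [Sym2.eq_iff] at hi
      refine ⟨hne, ?_⟩
      simp [Fin.ext_iff, a, h] at *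
      omega
    change IsSeriesParallel (glue (treeGraph h) a)
    rw [hglue, isSeriesParallel_forest_iff _ _ {a (0, false)} rfl (fun i => i.1.elim)]
    · convert isSeriesParallel_bot
      rw [eq_bot_iff]
      rintro x y (⟨hne, hxy⟩ | ⟨-, i, -⟩)
      · simp only [restrictTo, Finset.mem_singleton] at hxy
        have := hroot.1
        split_ifs at hxy <;> simp_all
      · exact i.elim
    · simp [hroot.1]
    · simpa using hroot.2

theorem gBar_pos {k : ℕ} (hk : 1 ≤ k) : 0 < gBar k := by
  have h := gBar_eq k
  obtain ⟨q, hq⟩ := exists_isSPKernel hk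
  have : Nonempty {q : (Fin (2 * k) → Fin (2 * k)) × (Fin (k + 1) × Bool → Fin (2 * k)) //
      IsSPKernel (0, false) q} := ⟨⟨q, hq⟩⟩
  have hpos : (0 : ℝ) < Nat.card {q : (Fin (2 * k) → Fin (2 * k)) ×
      (Fin (k + 1) × Bool → Fin (2 * k)) // IsSPKernel (0, false) q} :=
    Nat.cast_pos.2 Nat.card_pos
  rw [← h] at hpos
  exact pos_of_mul_pos_left hpos (by positivity)

end PathKernel

/-! ### Moments of the weights `n (n - 1) ⋯ (n - s + 1) / n ^ s` -/

section Moments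

/-- The proportion of injective maps among all maps from a set of `s` elements to a set of `n`
elements. -/
noncomputable def injProb (n s : ℕ) : ℝ := n.descFactorial s / (n : ℝ) ^ s

/-- The `j`-th moment of the weights `injProb n s`. -/
noncomputable def moment (j n : ℕ) : ℝ := ∑ s ∈ Finset.range (n + 1), injProb n s * (s : ℝ) ^ j

theorem injProb_nonneg (n s : ℕ) : 0 ≤ injProb n s := by unfold injProb; positivity

theorem moment_nonneg (j n : ℕ) : 0 ≤ moment j n :=
  Finset.sum_nonneg fun s _ => mul_nonneg (injProb_nonneg n s) (by positivity)

theorem injProb_zero (n : ℕ) : injProb n 0 = 1 := by simp [injProb]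

theorem injProb_self_succ (n : ℕ) : injProb n (n + 1) = 0 := by
  simp [injProb]

/-- This difference identity converts a factor s into a discrete derivative, so that moments can be
computed by Abel summation. -/
theorem mul_injProb {n s : ℕ} (hn : 0 < n) (hs : s ≤ n) :
    s * injProb n s = n * (injProb n s - injProb n (s + 1)) := by
  have : (n : ℝ) ≠ 0 := by positivity
  unfold injProb
  rw [Nat.descFactorial_succ, Nat.cast_mul, Nat.cast_sub hs]
  field_simp
  ring

theorem moment_succ {n : ℕ} (hn : 0 < n) (j : ℕ) :
    moment (j + 1) n = n * (0 ^ j + ∑ s ∈ Finset.range n,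
      injProb n (s + 1) * (((s : ℝ) + 1) ^ j - (s : ℝ) ^ j)) := by
  have h1 : moment (j + 1) n = ∑ s ∈ Finset.range (n + 1),
      n * (injProb n s * (s : ℝ) ^ j - injProb n (s + 1) * (s : ℝ) ^ j) := by
    refine Finset.sum_congr rfl fun s hs => ?_
    have := mul_injProb hn (Nat.lt_succ_iff.1 (Finset.mem_range.1 hs))
    rw [pow_succ]
    linear_combination (s : ℝ) ^ j * this
  rw [h1, ← Finset.mul_sum, Finset.sum_sub_distrib, Finset.sum_range_succ', Finset.sum_range_succ,
    injProb_self_succ, injProb_zero]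
  simp only [mul_sub, Finset.sum_sub_distrib]
  push_cast
  ring

theorem moment_one {n : ℕ} (hn : 0 < n) : moment 1 n = n := by
  rw [moment_succ hn 0]
  simp

theorem moment_two {n : ℕ} (hn : 0 < n) : moment 2 n = n * (moment 0 n - 1) := by
  rw [moment_succ hn 1, moment, Finset.sum_range_succ']
  simp [injProb_zero]

/-- The leading term is expanded at s + 1 rather than s because Abel summation pairs it with
`injProb n (s + 1)`, which makes the sums moments again. -/
theorem abs_pow_sub_pow_sub_le (s : ℕ) (j : ℕ) :
    |((s : ℝ) + 1) ^ (j + 2) - (s : ℝ) ^ (j + 2) - (j + 2) * ((s : ℝ) + 1) ^ (j + 1)| ≤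
      (j + 2) ^ 2 * ((s : ℝ) + 1) ^ j := by
  induction j with
  | zero =>
    rw [show ((s : ℝ) + 1) ^ (0 + 2) - (s : ℝ) ^ (0 + 2) - ((0 : ℕ) + 2) * ((s : ℝ) + 1) ^ (0 + 1)
      = -1 by push_cast; ring]
    norm_num
  | succ j ih =>
    have h0 : (0 : ℝ) ≤ s := by positivity
    rw [show ((s : ℝ) + 1) ^ (j + 1 + 2) - (s : ℝ) ^ (j + 1 + 2) -
        ((j + 1 : ℕ) + 2) * ((s : ℝ) + 1) ^ (j + 1 + 1) =
        s * (((s : ℝ) + 1) ^ (j + 2) - (s : ℝ) ^ (j + 2) - (j + 2) * ((s : ℝ) + 1) ^ (j + 1)) -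
        (j + 2) * ((s : ℝ) + 1) ^ (j + 1) by push_cast; ring]
    refine (abs_sub _ _).trans ?_
    rw [abs_mul, abs_of_nonneg h0,
      abs_of_nonneg (by positivity : 0 ≤ ((j : ℝ) + 2) * ((s : ℝ) + 1) ^ (j + 1))]
    have h1 := mul_le_mul_of_nonneg_left ih h0
    have h2 : (0 : ℝ) ≤ ((s : ℝ) + 1) ^ j := by positivity
    have h3 : (0 : ℝ) ≤ (j : ℝ) := by positivity
    push_cast
    rw [pow_succ ((s : ℝ) + 1) j]
    refine (add_le_add h1 le_rfl).trans ?_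
    rw [← sub_nonneg]
    have : 0 ≤ (((j : ℝ) + 2) ^ 2 + (j + 3) * (s + 1)) * ((s : ℝ) + 1) ^ j := by positivity
    refine this.trans (le_of_eq ?_)
    ring

/-- The approximate two-step recursion of the moments. From moment one, which is exactly n, it
produces the constants 2^i i!. -/
theorem abs_moment_sub_le {n : ℕ} (hn : 0 < n) (j : ℕ) :
    |moment (j + 3) n - n * ((j + 2) * moment (j + 1) n)| ≤ n * ((j + 2) ^ 2 * moment j n) := by
  have h1 : moment (j + 3) n - n * ((j + 2) * moment (j + 1) n) = n * ∑ s ∈ Finset.range n,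
      injProb n (s + 1) * (((s : ℝ) + 1) ^ (j + 2) - (s : ℝ) ^ (j + 2) -
        (j + 2) * ((s : ℝ) + 1) ^ (j + 1)) := by
    have h2 : moment (j + 1) n =
        ∑ s ∈ Finset.range n, injProb n (s + 1) * ((s : ℝ) + 1) ^ (j + 1) := by
      rw [moment, Finset.sum_range_succ' _ n]
      simp
    rw [moment_succ hn (j + 2), h2, ← mul_sub, zero_pow (by omega), zero_add, Finset.mul_sum,
      ← Finset.sum_sub_distrib]
    congr 1
    refine Finset.sum_congr rfl fun s _ => ?_
    ring
  rw [h1, abs_mul, Nat.abs_cast]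
  refine mul_le_mul_of_nonneg_left ?_ (Nat.cast_nonneg n)
  refine (Finset.abs_sum_le_sum_abs _ _).trans ?_
  rw [moment, Finset.sum_range_succ' _ n, mul_add, Finset.mul_sum]
  refine le_add_of_le_of_nonneg (Finset.sum_le_sum fun s _ => ?_)
    (mul_nonneg (by positivity) (mul_nonneg (injProb_nonneg _ _) (by positivity)))
  rw [abs_mul, abs_of_nonneg (injProb_nonneg _ _), mul_left_comm]
  push_cast
  exact mul_le_mul_of_nonneg_left (abs_pow_sub_pow_sub_le s j) (injProb_nonneg _ _)

/-- Summation of (s - √n)² ≥ 0 against the weights. It controls each moment by its two neighbours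
and spares the exact asymptotics of the even moments. -/
theorem two_sqrt_mul_moment_le (j n : ℕ) :
    2 * √n * moment (j + 1) n ≤ moment (j + 2) n + n * moment j n := by
  unfold moment
  rw [Finset.mul_sum, Finset.mul_sum, ← Finset.sum_add_distrib]
  refine Finset.sum_le_sum fun s _ => ?_
  have h := Real.sq_sqrt (Nat.cast_nonneg (α := ℝ) n)
  have h2 : 0 ≤ injProb n s * (s : ℝ) ^ j * (s - √n) ^ 2 :=
    mul_nonneg (mul_nonneg (injProb_nonneg _ _) (by positivity)) (sq_nonneg _)
  rw [← sub_nonneg]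
  refine h2.trans (le_of_eq ?_)
  linear_combination injProb n s * (s : ℝ) ^ j * h

theorem tendsto_moment_zero : Tendsto (fun n : ℕ => moment 0 n / n) atTop (𝓝 0) := by
  have hsqrt : Tendsto (fun n : ℕ => 1 / (n : ℝ) + 6 / √n) atTop (𝓝 0) := by
    have h1 : Tendsto (fun n : ℕ => 1 / (n : ℝ)) atTop (𝓝 0) :=
      tendsto_one_div_atTop_nhds_zero_nat
    have h2 : Tendsto (fun n : ℕ => 6 / √(n : ℝ)) atTop (𝓝 0) :=
      tendsto_const_nhds.div_atTop (Real.tendsto_sqrt_atTop.comp tendsto_natCast_atTop_atTop)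
    simpa using h1.add h2
  refine squeeze_zero' (Eventually.of_forall fun n => div_nonneg (moment_nonneg _ _)
    (Nat.cast_nonneg n)) ?_ hsqrt
  filter_upwards [eventually_gt_atTop 0] with n hn
  have hn' : (1 : ℝ) ≤ n := Nat.one_le_cast.2 hn
  have h1 := two_sqrt_mul_moment_le 1 n
  have h2 := (abs_le.1 (abs_moment_sub_le hn 0)).2
  have h4 : moment 0 n ≤ n + 1 := by
    have h6 : moment 0 n ≤ ∑ s ∈ Finset.range (n + 1), (1 : ℝ) := by
      refine Finset.sum_le_sum fun s _ => ?_
      rw [pow_zero, mul_one]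
      exact div_le_one_of_le₀ (by exact_mod_cast Nat.descFactorial_le_pow n s) (by positivity)
    simpa using h6
  have h5 := moment_two hn
  have hs : 0 < √(n : ℝ) := Real.sqrt_pos.2 (by linarith)
  have h := Real.sq_sqrt (Nat.cast_nonneg (α := ℝ) n)
  have hn0 : (0 : ℝ) < n := by linarith
  simp only [Nat.reduceAdd, moment_one hn, h5] at h1 h2
  -- The trivial bound n + 1 for moment zero gives moment three at most 2n² + 4n(n+1) ≤ 10n²; adding
  -- n times moment one gives 11n². Since moment two is n (moment zero - 1), moment zero is in fact
  -- O(√n).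
  have h6 : 2 * √n * (moment 0 n - 1) ≤ 11 * n := by
    refine le_of_mul_le_mul_left ?_ hn0
    push_cast at h2
    nlinarith
  have h7 : 2 * (moment 0 n - 1) ≤ 11 * √n := by
    refine le_of_mul_le_mul_left ?_ hs
    nlinarith
  rw [div_le_iff₀ hn0]
  have h8 : (1 / (n : ℝ) + 6 / √n) * n = 1 + 6 * √n := by
    field_simp
    linear_combination (-6) * h
  rw [h8]
  linarith

/-- Odd orders follow from the recursion, whose error term is an even moment already known to be
negligible. The next even moment is then bounded by its odd neighbours and gains a factor √n. -/
theorem tendsto_moment (i : ℕ) :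
    Tendsto (fun n : ℕ => moment (2 * i + 1) n / (n : ℝ) ^ (i + 1)) atTop (𝓝 (2 ^ i * i !)) ∧
    Tendsto (fun n : ℕ => moment (2 * i) n / (n : ℝ) ^ (i + 1)) atTop (𝓝 0) := by
  induction i with
  | zero =>
    refine ⟨?_, by simpa using tendsto_moment_zero⟩
    refine tendsto_const_nhds.congr' ?_
    filter_upwards [eventually_gt_atTop 0] with n hn
    have : (n : ℝ) ≠ 0 := by positivity
    simp [moment_one hn, this]
  | succ i ih =>
    have hodd : Tendsto (fun n : ℕ => moment (2 * (i + 1) + 1) n / (n : ℝ) ^ (i + 1 + 1)) atTop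
        (𝓝 (2 ^ (i + 1) * (i + 1)!)) := by
      have h1 : Tendsto (fun n : ℕ => ((2 * i : ℕ) + 2) *
          (moment (2 * i + 1) n / (n : ℝ) ^ (i + 1))) atTop (𝓝 (2 ^ (i + 1) * (i + 1)!)) := by
        convert ih.1.const_mul _ using 2
        rw [Nat.factorial_succ]
        push_cast
        ring
      have h2 : Tendsto (fun n : ℕ => ((2 * i : ℕ) + 2) ^ 2 *
          (moment (2 * i) n / (n : ℝ) ^ (i + 1))) atTop (𝓝 0) := by
        simpa using ih.2.const_mul (((2 * i : ℕ) + 2 : ℝ) ^ 2)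
      refine tendsto_of_tendsto_of_dist h1 (squeeze_zero' (Eventually.of_forall fun _ =>
        dist_nonneg) ?_ h2)
      filter_upwards [eventually_gt_atTop 0] with n hn
      have hn' : (0 : ℝ) < n := Nat.cast_pos.2 hn
      rw [dist_comm, Real.dist_eq]
      have h := abs_moment_sub_le hn (2 * i)
      rw [show moment (2 * (i + 1) + 1) n / (n : ℝ) ^ (i + 1 + 1) - ((2 * i : ℕ) + 2) *
          (moment (2 * i + 1) n / (n : ℝ) ^ (i + 1)) = (moment (2 * i + 3) n -
          n * (((2 * i : ℕ) + 2) * moment (2 * i + 1) n)) / (n : ℝ) ^ (i + 1 + 1) by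
        field_simp; ring_nf, abs_div, abs_of_pos (by positivity : (0 : ℝ) < (n : ℝ) ^ (i + 1 + 1)),
        div_le_iff₀ (by positivity)]
      refine h.trans (le_of_eq ?_)
      field_simp
      ring
    refine ⟨hodd, ?_⟩
    have h2 : Tendsto (fun n : ℕ => 1 / √(n : ℝ) *
        (moment (2 * (i + 1) + 1) n / (n : ℝ) ^ (i + 1 + 1) +
          moment (2 * i + 1) n / (n : ℝ) ^ (i + 1))) atTop (𝓝 0) := by
      have h3 : Tendsto (fun n : ℕ => 1 / √(n : ℝ)) atTop (𝓝 0) :=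
        tendsto_const_nhds.div_atTop (Real.tendsto_sqrt_atTop.comp tendsto_natCast_atTop_atTop)
      simpa using h3.mul (hodd.add ih.1)
    refine squeeze_zero' (Eventually.of_forall fun n => div_nonneg (moment_nonneg _ _)
      (by positivity)) ?_ h2
    filter_upwards [eventually_gt_atTop 0] with n hn
    have hn' : (0 : ℝ) < n := Nat.cast_pos.2 hn
    have hs : 0 < √(n : ℝ) := Real.sqrt_pos.2 hn'
    have h := two_sqrt_mul_moment_le (2 * i + 1) n
    have h0 := moment_nonneg (2 * (i + 1)) n
    rw [div_le_iff₀ (by positivity), show 1 / √(n : ℝ) *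
        (moment (2 * (i + 1) + 1) n / (n : ℝ) ^ (i + 1 + 1) +
          moment (2 * i + 1) n / (n : ℝ) ^ (i + 1)) * (n : ℝ) ^ (i + 1 + 1) =
        (moment (2 * i + 1 + 2) n + n * moment (2 * i + 1) n) / √(n : ℝ) by
      field_simp; ring_nf, le_div_iff₀ hs]
    change 2 * √n * moment (2 * (i + 1)) n ≤ _ at h
    nlinarith [mul_nonneg hs.le h0]

end Moments

/-! ### Asymptotic number of trees with marked pairs -/

section MarkedTreeAsymptotics

/-- The summation index becomes s = w + i, the number of points of the subdivided reduced tree; the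
two falling factorials merge into one of length s. -/
theorem descFactorial_mul_refinementSum {n w : ℕ} (hn : 0 < n) (hw : w ≤ n) :
    ((n.descFactorial w * refinementSum n (w - 1) w (n - w) : ℕ) : ℝ) =
      (n : ℝ) ^ n * ∑ s ∈ Finset.range (n + 1), injProb n s *
        (s * (if w ≤ s then ((w - 1).multichoose (s - w) : ℝ) else 0)) := by
  have h1 : ∑ s ∈ Finset.range (n + 1), injProb n s *
      (s * (if w ≤ s then ((w - 1).multichoose (s - w) : ℝ) else 0)) =
      ∑ i ∈ Finset.range (n - w + 1), injProb n (w + i) *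
        (((w + i : ℕ) : ℝ) * ((w - 1).multichoose i : ℝ)) := by
    simp only [mul_ite, mul_zero]
    rw [← Finset.sum_filter, show (Finset.range (n + 1)).filter (fun s => w ≤ s) =
      Finset.Ico w (n + 1) by ext; simp; omega, Finset.sum_Ico_eq_sum_range,
      show n + 1 - w = n - w + 1 by omega]
    simp only [Nat.add_sub_cancel_left]
  rw [h1, refinementSum, Finset.mul_sum, Finset.mul_sum, Nat.cast_sum]
  refine Finset.sum_congr rfl fun i hi => ?_
  have hi' : i ≤ n - w := Nat.lt_succ_iff.1 (Finset.mem_range.1 hi)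
  have h2 := Nat.descFactorial_mul_descFactorial (n := n) (k := w) (m := w + i) (by omega)
  rw [Nat.add_sub_cancel_left] at h2
  have hn' : (n : ℝ) ≠ 0 := by positivity
  have h3 : (n : ℝ) ^ n = (n : ℝ) ^ (n - w - i) * (n : ℝ) ^ (w + i) := by
    rw [← pow_add]; congr 1; omega
  rw [injProb, ← h2, h3]
  push_cast
  field_simp

theorem abs_mul_choose_sub_le (s m : ℕ) :
    |(s : ℝ) * (m ! * ((s - 2).choose m : ℕ)) - (s : ℝ) ^ (m + 1)| ≤ (m + 1) ^ 2 * (s : ℝ) ^ m := by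
  have h0 : (0 : ℝ) ≤ s := Nat.cast_nonneg s
  rw [← Nat.cast_mul, ← Nat.descFactorial_eq_factorial_mul_choose, abs_le]
  constructor
  · induction m with
    | zero => simp
    | succ m ih =>
      rw [Nat.descFactorial_succ]
      push_cast at ih ⊢
      -- For such small s the natural subtractions may truncate, but then s^(m+2) alone is already
      -- within the error term.
      by_cases hs : s < m + 2
      · have h1 : (s : ℝ) ≤ (m + 2) ^ 2 := by
          have : (s : ℝ) ≤ m + 2 := by exact_mod_cast hs.le
          nlinarith [Nat.cast_nonneg (α := ℝ) m]
        have h2 : (s : ℝ) ^ (m + 1) * s ≤ (s : ℝ) ^ (m + 1) * (m + 2) ^ 2 :=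
          mul_le_mul_of_nonneg_left h1 (by positivity)
        have h3 : (0 : ℝ) ≤ s * (((s - 2 - m : ℕ) : ℝ) * ((s - 2).descFactorial m : ℝ)) := by
          positivity
        rw [pow_succ (s : ℝ) (m + 1)]
        linarith
      · have h1 : ((s - 2 - m : ℕ) : ℝ) = s - 2 - m := by
          rw [Nat.cast_sub (by omega), Nat.cast_sub (by omega)]
          norm_num
        have h2 : (0 : ℝ) ≤ s - 2 - m := h1 ▸ Nat.cast_nonneg _
        have h3 := mul_le_mul_of_nonneg_left ih h2
        have h4 : (0 : ℝ) ≤ (s : ℝ) ^ m := by positivity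
        rw [h1]
        rw [pow_succ (s : ℝ) m] at h3 ⊢
        rw [pow_succ (s : ℝ) (m + 1), pow_succ (s : ℝ) m]
        have h5 : (0 : ℝ) ≤ m := Nat.cast_nonneg m
        nlinarith [mul_nonneg h4 h5, mul_nonneg (mul_nonneg h4 h5) h0,
          mul_nonneg (mul_nonneg h4 h5) h5, mul_nonneg (mul_nonneg (mul_nonneg h4 h5) h5) h5,
          mul_nonneg h4 h0]
  · have h1 : ((s - 2).descFactorial m : ℝ) ≤ (s : ℝ) ^ m := by
      exact_mod_cast (Nat.descFactorial_le_pow _ _).trans (Nat.pow_le_pow_left (by omega) m)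
    have h2 := mul_le_mul_of_nonneg_left h1 h0
    have h3 : (0 : ℝ) ≤ (m + 1) ^ 2 * (s : ℝ) ^ m := by positivity
    rw [pow_succ]
    linarith

/-- For w ≥ 2 the coefficient is the binomial s - 2 over w - 2, at most s^(w-2). For w ≤ 1 there is
no edge to subdivide and the coefficient is 0 or 1. -/
theorem mul_multichoose_le {s w m : ℕ} (hm : 1 ≤ m) (hw : w ≤ m + 1) (hs : w ≤ s) :
    s * (w - 1).multichoose (s - w) ≤ s ^ m := by
  obtain ⟨m, rfl⟩ := Nat.exists_eq_add_of_le' hm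
  rw [pow_succ']
  rcases Nat.eq_zero_or_pos s with rfl | hs0
  · simp
  refine Nat.mul_le_mul_left s ?_
  match w, hw, hs with
  | 0, _, _ =>
    obtain ⟨t, rfl⟩ := Nat.exists_eq_add_of_le' hs0
    simp
  | 1, _, _ =>
    rcases Nat.eq_zero_or_pos (s - 1) with h | h
    · rw [h, Nat.multichoose_zero_right]
      exact Nat.one_le_pow _ _ hs0
    · obtain ⟨t, ht⟩ := Nat.exists_eq_add_of_le' h
      simp [ht]
  | j + 2, hw, hs =>
    rw [Nat.multichoose_eq, show j + 2 - 1 + (s - (j + 2)) - 1 = s - 2 by omega,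
      ← Nat.choose_symm (by omega), show s - 2 - (s - (j + 2)) = j by omega]
    exact (Nat.choose_le_pow _ _).trans ((Nat.pow_le_pow_left (by omega) j).trans
      (Nat.pow_le_pow_right hs0 (by omega)))

/-- The coefficient of `injProb n s` is s times the binomial s - 2 over 2m, that is s^(2m+1)/(2m)!
up to O(s^(2m)). The main term is an odd moment and the error an even one. -/
theorem tendsto_descFactorial_mul_refinementSum {m : ℕ} (hm : 1 ≤ m) :
    Tendsto (fun n : ℕ => ((n.descFactorial (2 * m + 2) *
      refinementSum n (2 * m + 1) (2 * m + 2) (n - (2 * m + 2)) : ℕ) : ℝ) /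
        (n : ℝ) ^ (n + m + 1)) atTop (𝓝 (2 ^ m * m ! / (2 * m)!)) := by
  have h1 := (tendsto_moment m).1.div_const ((2 * m)! : ℝ)
  have h2 : Tendsto (fun n : ℕ => (((2 * m : ℕ) : ℝ) + 1) ^ 2 / (2 * m)! *
      (moment (2 * m) n / (n : ℝ) ^ (m + 1))) atTop (𝓝 0) := by
    simpa using (tendsto_moment m).2.const_mul ((((2 * m : ℕ) : ℝ) + 1) ^ 2 / (2 * m)!)
  refine tendsto_of_tendsto_of_dist h1 (squeeze_zero' (Eventually.of_forall fun _ =>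
    dist_nonneg) ?_ h2)
  filter_upwards [eventually_ge_atTop (2 * m + 2)] with n hn
  have hn0 : 0 < n := by omega
  have hn' : (0 : ℝ) < n := Nat.cast_pos.2 hn0
  have hf : (0 : ℝ) < (2 * m)! := Nat.cast_pos.2 (Nat.factorial_pos _)
  have h3 : ∀ s ∈ Finset.range (n + 1), injProb n s * (s * (if 2 * m + 2 ≤ s then
      ((2 * m + 2 - 1).multichoose (s - (2 * m + 2)) : ℝ) else 0)) =
      injProb n s * (s * ((s - 2).choose (2 * m) : ℕ)) := by
    intro s _
    split_ifs with h
    · rw [Nat.multichoose_eq, show 2 * m + 2 - 1 + (s - (2 * m + 2)) - 1 = s - 2 by omega,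
        ← Nat.choose_symm (by omega), show s - 2 - (s - (2 * m + 2)) = 2 * m by omega]
    · rw [Nat.choose_eq_zero_of_lt (by omega)]
      simp
  have h4 := descFactorial_mul_refinementSum hn0 hn
  rw [Finset.sum_congr rfl h3] at h4
  rw [show 2 * m + 2 - 1 = 2 * m + 1 from rfl] at h4
  rw [dist_comm, Real.dist_eq, h4]
  have h5 : (n : ℝ) ^ n * (∑ s ∈ Finset.range (n + 1), injProb n s *
      (s * ((s - 2).choose (2 * m) : ℕ))) / (n : ℝ) ^ (n + m + 1) -
      moment (2 * m + 1) n / (n : ℝ) ^ (m + 1) / (2 * m)! =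
      (∑ s ∈ Finset.range (n + 1), injProb n s * ((s : ℝ) * ((2 * m)! *
        ((s - 2).choose (2 * m) : ℕ)) - (s : ℝ) ^ (2 * m + 1))) /
        ((2 * m)! * (n : ℝ) ^ (m + 1)) := by
    have : ∑ s ∈ Finset.range (n + 1), injProb n s * ((s : ℝ) * ((2 * m)! *
        ((s - 2).choose (2 * m) : ℕ)) - (s : ℝ) ^ (2 * m + 1)) =
        (2 * m)! * (∑ s ∈ Finset.range (n + 1), injProb n s *
          (s * ((s - 2).choose (2 * m) : ℕ))) - moment (2 * m + 1) n := by
      rw [moment, Finset.mul_sum, ← Finset.sum_sub_distrib]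
      exact Finset.sum_congr rfl fun s _ => by ring
    rw [this, show n + m + 1 = n + (m + 1) from rfl, pow_add]
    field_simp
  rw [h5, abs_div, abs_of_pos (by positivity : (0 : ℝ) < (2 * m)! * (n : ℝ) ^ (m + 1)),
    div_le_iff₀ (by positivity), show (((2 * m : ℕ) : ℝ) + 1) ^ 2 / (2 * m)! *
      (moment (2 * m) n / (n : ℝ) ^ (m + 1)) * ((2 * m)! * (n : ℝ) ^ (m + 1)) =
      (((2 * m : ℕ) : ℝ) + 1) ^ 2 * moment (2 * m) n by field_simp, moment, Finset.mul_sum]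
  refine (Finset.abs_sum_le_sum_abs _ _).trans (Finset.sum_le_sum fun s _ => ?_)
  rw [abs_mul, abs_of_nonneg (injProb_nonneg _ _), mul_left_comm _ (injProb n s)]
  exact mul_le_mul_of_nonneg_left (abs_mul_choose_sub_le s (2 * m)) (injProb_nonneg _ _)

/-- A smaller reduced tree has fewer edges to subdivide, and the sum is at most the even moment of
order 2m, which is negligible on this scale. -/
theorem tendsto_descFactorial_mul_refinementSum_zero {m w : ℕ} (hm : 1 ≤ m)
    (hw : w ≤ 2 * m + 1) :
    Tendsto (fun n : ℕ => ((n.descFactorial w *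
      refinementSum n (w - 1) w (n - w) : ℕ) : ℝ) / (n : ℝ) ^ (n + m + 1)) atTop (𝓝 0) := by
  refine squeeze_zero' (Eventually.of_forall fun _ => by positivity) ?_ (tendsto_moment m).2
  filter_upwards [eventually_ge_atTop (2 * m + 2)] with n hn
  have hn0 : 0 < n := by omega
  have hn' : (0 : ℝ) < n := Nat.cast_pos.2 hn0
  rw [descFactorial_mul_refinementSum hn0 (by omega), show n + m + 1 = n + (m + 1) from rfl,
    pow_add, mul_div_mul_left _ _ (by positivity)]
  refine div_le_div_of_nonneg_right (Finset.sum_le_sum fun s _ => ?_) (by positivity)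
  refine mul_le_mul_of_nonneg_left ?_ (injProb_nonneg _ _)
  split_ifs with h
  · exact_mod_cast mul_multichoose_le (by omega) hw h
  · rw [mul_zero]; positivity

end MarkedTreeAsymptotics

/-! ### Asymptotic number of series-parallel graphs with a spanning tree -/

section SeriesParallelAsymptotics

theorem tendsto_card_nongeneric {k w : ℕ} (hk : 1 ≤ k) (hw : w < 4 * k + 2) :
    Tendsto (fun n : ℕ => (Nat.card {p : (Fin n → Fin n) × (Fin (k + 1) × Bool → Fin n) //
      IsMarkedTree (0, false) p ∧ (meetClosure p.1 (Finset.univ.image p.2)).card = w} : ℝ) /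
        (n : ℝ) ^ (n + 2 * k)) atTop (𝓝 0) := by
  have h1 := (tendsto_descFactorial_mul_refinementSum_zero (m := 2 * k) (w := w) (by omega)
    (by omega)).const_mul ((w ^ w * w ^ Fintype.card (Fin (k + 1) × Bool) : ℕ) : ℝ)
  rw [mul_zero] at h1
  refine squeeze_zero' (Eventually.of_forall fun _ => by positivity) ?_ h1
  filter_upwards [eventually_gt_atTop 0] with n hn
  have hn' : (0 : ℝ) < n := Nat.cast_pos.2 hn
  have h2 := card_nongeneric_le (V := Fin n) (β := Fin (k + 1)) (0, false) w
  rw [Fintype.card_fin n, mul_right_comm, mul_comm] at h2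
  have h3 := (Nat.cast_le (α := ℝ)).2 h2
  -- The counting bounds carry an extra factor n, which accounts for the exponent n + 2k here
  -- against n + 2k + 1 there.
  rw [← mul_div_assoc, pow_succ, ← div_div]
  rw [div_right_comm]
  refine div_le_div_of_nonneg_right ?_ (by positivity)
  rw [le_div_iff₀ hn', ← Nat.cast_mul]
  refine h3.trans (le_of_eq ?_)
  push_cast
  ring

theorem tendsto_card_generic {k : ℕ} (hk : 1 ≤ k) :
    Tendsto (fun n : ℕ => (Nat.card {p : (Fin n → Fin n) × (Fin (k + 1) × Bool → Fin n) //
      IsMarkedTree (0, false) p ∧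
        (meetClosure p.1 (Finset.univ.image p.2)).card = 4 * k + 2} : ℝ) /
        (n : ℝ) ^ (n + 2 * k)) atTop
      (𝓝 (gBar k * ((k + 1)! * 2 ^ (k + 1)) * (2 ^ (2 * k) * (2 * k)! / (4 * k)!))) := by
  have h1 := (tendsto_descFactorial_mul_refinementSum (m := 2 * k) (by omega)).const_mul
    (gBar k * ((k + 1)! * 2 ^ (k + 1)))
  rw [show 2 * (2 * k) = 4 * k by ring] at h1
  refine h1.congr' ?_
  filter_upwards [eventually_gt_atTop 0] with n hn
  have hn' : (0 : ℝ) < n := Nat.cast_pos.2 hn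
  have h2 := card_generic (V := Fin n) (β := Fin (k + 1)) (A := Fin (2 * k)) hk
    (Fintype.card_fin _) (Fintype.card_fin _) (0, false)
  rw [Fintype.card_fin n] at h2
  have h3 := congrArg (Nat.cast (R := ℝ)) h2
  push_cast at h3
  rw [← gBar_eq k] at h3
  have hf : ((2 * k)! : ℝ) ≠ 0 := Nat.cast_ne_zero.2 (Nat.factorial_ne_zero _)
  rw [← mul_div_assoc, pow_succ, div_eq_div_iff (by positivity) (by positivity)]
  refine mul_left_cancel₀ hf ?_
  push_cast
  linear_combination (-(n : ℝ) ^ (n + 2 * k)) * h3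

theorem tendsto_numSPWithTree {k : ℕ} (hk : 1 ≤ k) :
    Tendsto (fun n : ℕ => (numSPWithTree k n : ℝ) / (n : ℝ) ^ (n + 2 * k)) atTop
      (𝓝 (gBar k * (2 ^ (2 * k) * (2 * k)! / (4 * k)!))) := by
  have hc : (((k + 1)! : ℝ) * 2 ^ (k + 1)) ≠ 0 := by positivity
  have h1 := (tendsto_finsetSum (Finset.range (4 * k + 2)) fun w hw =>
    tendsto_card_nongeneric hk (Finset.mem_range.1 hw)).add (tendsto_card_generic hk)
  have h2 := h1.div_const ((k + 1)! * 2 ^ (k + 1))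
  rw [Finset.sum_const_zero, zero_add, mul_right_comm, mul_div_cancel_right₀ _ hc] at h2
  refine h2.congr fun n => ?_
  rw [← Finset.sum_div, ← add_div, ← Nat.cast_sum, ← Nat.cast_add, ← Finset.sum_range_succ,
    ← card_isMarkedTree (Fintype.card_fin _), numSPWithTree_eq (Fintype.card_fin _)]
  push_cast
  field_simp

theorem factorial_four_mul (k : ℕ) :
    (4 * k)! = (4 * k - 1)‼ * (2 ^ (2 * k) * (2 * k)!) := by
  rcases Nat.eq_zero_or_pos k with rfl | hk
  · rfl
  · obtain ⟨m, hm⟩ := Nat.exists_eq_add_of_le' (show 1 ≤ 4 * k by omega)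
    rw [← Nat.doubleFactorial_two_mul, show 2 * (2 * k) = 4 * k by ring, hm,
      Nat.factorial_eq_mul_doubleFactorial, mul_comm]
    rfl

/-- Here Γ(2k + 1/2) = (4k-1)‼ √π / 2^(2k), and `factorial_four_mul` expresses the double factorial
through (4k)! and (2k)!. -/
theorem two_rpow_div_Gamma (k : ℕ) :
    (2 : ℝ) ^ (-2 * (k : ℝ) - 1 / 2) / Real.Gamma (2 * (k : ℝ) + 1 / 2) =
      2 ^ (2 * k) * (2 * k)! / (4 * k)! / √(2 * Real.pi) := by
  have h1 := Real.Gamma_nat_add_half (2 * k)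
  push_cast at h1
  rw [h1, show 2 * (2 * k) = 4 * k by ring, factorial_four_mul,
    show -2 * (k : ℝ) - 1 / 2 = -((2 * k : ℕ) : ℝ) - 1 / 2 by push_cast; ring,
    Real.rpow_sub two_pos, Real.rpow_neg two_pos.le, Real.rpow_natCast, ← Real.sqrt_eq_rpow,
    Real.sqrt_mul two_pos.le]
  have h2 : ((4 * k - 1)‼ : ℝ) ≠ 0 := Nat.cast_ne_zero.2 (Nat.doubleFactorial_pos _).ne'
  have h3 : √Real.pi ≠ 0 := (Real.sqrt_pos.2 Real.pi_pos).ne'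
  push_cast
  field_simp

end SeriesParallelAsymptotics

end SPGraphs

/-! ### Passage to the coefficients by Stirling's formula. -/

theorem mainTheorem4 (k : ℕ) (hk : 1 < k) :
    (fun n : ℕ => PowerSeries.coeff n (SPGraphs.CBar k)) ~[atTop]
      (fun n : ℕ => SPGraphs.gBar k * (2 : ℝ) ^ (-2 * (k : ℝ) - 1 / 2) *
        ((n : ℝ) ^ (2 * (k : ℝ) - 1 / 2) / Real.Gamma (2 * (k : ℝ) + 1 / 2)) *
        Real.exp (n : ℝ)) := by
  have hg := SPGraphs.gBar_pos hk.le
  have hc : 0 < SPGraphs.gBar k * (2 ^ (2 * k) * (2 * k)! / (4 * k)!) := by positivity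
  have h1 : (fun n : ℕ => (SPGraphs.numSPWithTree k n : ℝ)) ~[atTop] fun n =>
      SPGraphs.gBar k * (2 ^ (2 * k) * (2 * k)! / (4 * k)!) * (n : ℝ) ^ (n + 2 * k) := by
    refine (isEquivalent_iff_tendsto_one ?_).2 ?_
    · filter_upwards [eventually_gt_atTop 0] with n hn
      have hn' : (0 : ℝ) < n := Nat.cast_pos.2 hn
      positivity
    · have := (SPGraphs.tendsto_numSPWithTree hk.le).div_const
        (SPGraphs.gBar k * (2 ^ (2 * k) * (2 * k)! / (4 * k)!))
      rw [div_self hc.ne'] at this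
      refine this.congr fun n => ?_
      simp only [Pi.div_apply]
      rw [div_div, mul_comm ((n : ℝ) ^ _)]
  -- Division by √(2πn) (n/e)^n turns n^(n+2k) into n^(2k-1/2) e^n / √(2π); the factor 1/√(2π) is
  -- absorbed by `two_rpow_div_Gamma`.
  have h2 := h1.div Stirling.factorial_isEquivalent_stirling
  refine (h2.congr_left (Eventually.of_forall fun n => ?_)).congr_right ?_
  · simp [SPGraphs.CBar]
  · filter_upwards [eventually_gt_atTop 0] with n hn
    have hn' : (0 : ℝ) < n := Nat.cast_pos.2 hn
    have h3 := SPGraphs.two_rpow_div_Gamma k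
    have h4 : (n : ℝ) ^ (2 * (k : ℝ) - 1 / 2) = (n : ℝ) ^ (2 * k) / √n := by
      rw [Real.rpow_sub hn', ← Real.sqrt_eq_rpow]
      congr 1
      exact_mod_cast Real.rpow_natCast (n : ℝ) (2 * k)
    have h5 : SPGraphs.gBar k * (2 : ℝ) ^ (-2 * (k : ℝ) - 1 / 2) *
        ((n : ℝ) ^ (2 * (k : ℝ) - 1 / 2) / Real.Gamma (2 * (k : ℝ) + 1 / 2)) *
        Real.exp (n : ℝ) = SPGraphs.gBar k * ((2 : ℝ) ^ (-2 * (k : ℝ) - 1 / 2) /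
          Real.Gamma (2 * (k : ℝ) + 1 / 2)) * (n : ℝ) ^ (2 * (k : ℝ) - 1 / 2) *
        Real.exp (n : ℝ) := by ring
    have hs : 0 < √(n : ℝ) := Real.sqrt_pos.2 hn'
    have hp : 0 < √(2 * Real.pi) := Real.sqrt_pos.2 (by positivity)
    have h6 : √(2 * (n : ℝ) * Real.pi) = √n * √(2 * Real.pi) := by
      rw [← Real.sqrt_mul hn'.le]; congr 1; ring
    have h7 : Real.exp n = Real.exp 1 ^ n := by rw [← Real.exp_nat_mul, mul_one]
    simp only [Pi.div_apply]
    rw [h5, h3, h4, h6, h7, div_pow, pow_add]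
    field_simp
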